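/- Let $(\mathcal M,g)$ be a smooth 4-dimensional time-oriented Lorentzian manifold (signature $(-,+,+,+)$, Hausdorff, second countable), and let $\iota:\mathcal S\hookrightarrow\mathcal M$ be a smooth spacelike Cauchy surface, i.e. an embedded spacelike hypersurface which every inextendible causal curve meets exactly once (so that $\mathcal M$ is globally hyperbolic). On $T^*\mathcal M$ let $\theta=p_a\,dx^a$ be the canonical one-form, $\omega=d\theta$, $H=\tfrac12 g^{ab}p_ap_b$, let $\Delta=p_a\,\partial/\partial p_a$ be the Euler field and $X_G$ the geodesic spray, defined by $X_G\lrcorner\,\omega+dH=0$. Let $N'\mathcal M\subset T^*\mathcal M$ be the 7-dimensional submanifold of nonzero null covectors $p_a$ with $p^a$ future pointing. The space of null geodesics $\mathcal N$ is the quotient of $N'\mathcal M$ by the leaves of the distribution spanned by $\Delta$ and $X_G$, with the quotient topology; let $\pi:N'\mathcal M\to\mathcal N$ be the projection. Let $h=\iota^*g$ and let $T_1^*\mathcal S=\{(x,v)\in T^*\mathcal S : h^{\alpha\beta}v_\alpha v_\beta=1\}$ be the unit cotangent bundle, a 5-dimensional submanifold of $T^*\mathcal S$, whose contact planes are the kernels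 of the restriction to $T_1^*\mathcal S$ of the canonical one-form of $T^*\mathcal S$. Then $\mathcal N$ is a smooth 5-manifold for which $\pi$ is a smooth submersion (this determines its smooth structure), and the following hold. 1. The planes $\ker\theta$ on $N'\mathcal M$ project to a well-defined field of planes $\ker[\theta]:=d\pi(\ker\theta|_{N'\mathcal M})$ on $\mathcal N$: a vector $\zeta$ tangent to $N'\mathcal M$ satisfies $\theta(\zeta)=0$ if and only if $d\pi(\zeta)\in\ker[\theta]$. 2. There is a diffeomorphism $\Phi:T_1^*\mathcal S\to\mathcal N$ that sends $(x,v)$ to the class of the null covector $w+n$ at $\iota(x)$, where $n$ is the future-pointing unit timelike conormal to $\mathcal S$ at $x$ and $w$ is the covector of $\mathcal M$ at $\iota(x)$ that is orthogonal to $n$ and restricts to $v$ on $T_x\mathcal S$. Under $\Phi$ the planes $\ker[\theta]$ are precisely the contact planes: $d\Phi$ maps the contact planes of $T_1^*\mathcal S$ onto the planes $\ker[\theta]$. 3. Hence $\ker[\theta]$ is a contact structure on $\mathcal N$: locally it is the kernel of a smooth nowhere vanishing one-form $\alpha$ whose differential $d\alpha$ is nondegenerate on $\ker\alpha$. -/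

import Mathlib

open Set Filter Topology Bundle Manifold
open scoped Manifold ContDiff

noncomputable section

namespace NullGeodesics

/-! ### Cotangent bundles, one-forms and contact structures -/

/-- The cotangent bundle `T*X` of an `n`-manifold `X`; a point is a pair `⟨x, p⟩` with
`p : T_x X → ℝ` linear. Topology and smooth structure are the ones of the Hom bundle. -/
abbrev Cotangent (n : ℕ) (X : Type*) [TopologicalSpace X]
    [ChartedSpace (EuclideanSpace ℝ (Fin n)) X] : Type _ :=
  TotalSpace (EuclideanSpace ℝ (Fin n) →L[ℝ] ℝ)
    (fun x : X => TangentSpace (𝓡 n) x →L[ℝ] Bundle.Trivial X ℝ x)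

/-- The model with corners (without boundary) of the cotangent bundle of an `n`-manifold. -/
abbrev cotangentModel (n : ℕ) := (𝓡 n).prod 𝓘(ℝ, EuclideanSpace ℝ (Fin n) →L[ℝ] ℝ)

/-- The canonical one-form `θ = p_a dx^a` on `T*X`: `θ_p(ξ) = p (dpr ξ)`, `pr : T*X → X`. -/
def canonicalForm (n : ℕ) (X : Type*) [TopologicalSpace X]
    [ChartedSpace (EuclideanSpace ℝ (Fin n)) X] [IsManifold (𝓡 n) ∞ X] (p : Cotangent n X) :
    TangentSpace (cotangentModel n) p →L[ℝ] ℝ :=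
  ContinuousLinearMap.comp (p.2 : TangentSpace (𝓡 n) p.1 →L[ℝ] ℝ)
    (mfderiv (cotangentModel n) (𝓡 n) (fun q : Cotangent n X => q.1) p)

/-- The exterior derivative `dα` of a one-form on a manifold without boundary, computed at `x`
in the chart at `x`: `dα(v, w) = D_v α̂ (w) - D_w α̂ (v)`, with `α̂` the coordinate expression. -/
def extd {E H : Type*} [NormedAddCommGroup E] [NormedSpace ℝ E] [TopologicalSpace H]
    (I : ModelWithCorners ℝ E H) {X : Type*} [TopologicalSpace X] [ChartedSpace H X]
    (α : ∀ x : X, TangentSpace I x →L[ℝ] ℝ) (x : X) (v w : TangentSpace I x) : ℝ :=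
  let φ := extChartAt I x
  let αhat : E → (E →L[ℝ] ℝ) := fun y =>
    (α (φ.symm y)).comp (mfderiv 𝓘(ℝ, E) I φ.symm y)
  let vhat : E := mfderiv I 𝓘(ℝ, E) φ x v
  let what : E := mfderiv I 𝓘(ℝ, E) φ x w
  fderiv ℝ αhat (φ x) vhat what - fderiv ℝ αhat (φ x) what vhat

/-- A distribution `D` (a set of tangent vectors) on a `k`-manifold is a contact structure if
locally `D = ker α` for a smooth nowhere vanishing one-form `α` such that `dα` is nondegenerate
on `ker α` (for `k = 2 m + 1` this says `α ∧ (dα)^m ≠ 0`). -/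
def IsContactStructure {k : ℕ} {X : Type*} [TopologicalSpace X]
    [ChartedSpace (EuclideanSpace ℝ (Fin k)) X] [IsManifold (𝓡 k) ∞ X]
    (D : Set (TangentBundle (𝓡 k) X)) : Prop :=
  ∀ x₀ : X, ∃ W : Set X, IsOpen W ∧ x₀ ∈ W ∧
    ∃ α : ∀ x : X, TangentSpace (𝓡 k) x →L[ℝ] ℝ,
      ContMDiffOn (𝓡 k) (cotangentModel k) ∞ (fun x => (⟨x, α x⟩ : Cotangent k X)) W ∧
      ∀ x ∈ W,
        (∀ v : TangentSpace (𝓡 k) x, (⟨x, v⟩ : TangentBundle (𝓡 k) X) ∈ D ↔ α x v = 0) ∧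
        α x ≠ 0 ∧
        ∀ v : TangentSpace (𝓡 k) x, α x v = 0 →
          (∀ w : TangentSpace (𝓡 k) x, α x w = 0 → extd (𝓡 k) α x v w = 0) → v = 0

/-- The given charts on the subset `A` (with its subspace topology) make `A` an embedded
`k`-dimensional smooth submanifold of `X`: they are smoothly compatible and the inclusion is a
smooth immersion. Such a smooth structure on `A` is unique. -/
structure IsEmbeddedSubmanifold {E H : Type*} [NormedAddCommGroup E] [NormedSpace ℝ E]
    [TopologicalSpace H] (I : ModelWithCorners ℝ E H) {X : Type*} [TopologicalSpace X]
    [ChartedSpace H X] (k : ℕ) (A : Set X) [ChartedSpace (EuclideanSpace ℝ (Fin k)) A] :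
    Prop where
  isManifold : IsManifold (𝓡 k) ∞ A
  contMDiff_incl : ContMDiff (𝓡 k) I ∞ (Subtype.val : A → X)
  immersion : ∀ a : A, Function.Injective (mfderiv (𝓡 k) I (Subtype.val : A → X) a)

/-! ### Space-times -/

/-- A smooth time-oriented Lorentz metric of signature `(-,+,+,+)` on a 4-manifold. -/
structure Spacetime (M : Type*) [TopologicalSpace M]
    [ChartedSpace (EuclideanSpace ℝ (Fin 4)) M] [IsManifold (𝓡 4) ∞ M] where
  /-- the metric -/
  g : ∀ x : M, TangentSpace (𝓡 4) x →L[ℝ] TangentSpace (𝓡 4) x →L[ℝ] ℝ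
  symm : ∀ (x : M) (v w : TangentSpace (𝓡 4) x), g x v w = g x w v
  lorentzian : ∀ x : M, ∃ v : TangentSpace (𝓡 4) x, g x v v < 0 ∧
    ∀ w : TangentSpace (𝓡 4) x, w ≠ 0 → g x v w = 0 → 0 < g x w w
  smooth : ContMDiff (𝓡 4) ((𝓡 4).prod 𝓘(ℝ, EuclideanSpace ℝ (Fin 4) →L[ℝ]
      EuclideanSpace ℝ (Fin 4) →L[ℝ] ℝ)) ∞
    (fun x => TotalSpace.mk' (EuclideanSpace ℝ (Fin 4) →L[ℝ] EuclideanSpace ℝ (Fin 4) →L[ℝ] ℝ)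
      (E := fun x : M => TangentSpace (𝓡 4) x →L[ℝ] TangentSpace (𝓡 4) x →L[ℝ] ℝ) x (g x))
  /-- a timelike vector field, which defines the time orientation -/
  T : ∀ x : M, TangentSpace (𝓡 4) x
  T_smooth : ContMDiff (𝓡 4) (𝓡 4).tangent ∞ (fun x => (⟨x, T x⟩ : TangentBundle (𝓡 4) M))
  T_timelike : ∀ x : M, g x (T x) (T x) < 0

section
variable {M : Type*} [TopologicalSpace M] [ChartedSpace (EuclideanSpace ℝ (Fin 4)) M]
  [IsManifold (𝓡 4) ∞ M] (𝓜 : Spacetime M)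

/-- Future-pointing causal (timelike or null, hence nonzero) vectors. -/
def Spacetime.IsFutureCausal (x : M) (v : TangentSpace (𝓡 4) x) : Prop :=
  𝓜.g x v v ≤ 0 ∧ 𝓜.g x v (𝓜.T x) < 0

/-- Raising an index, `p_a ↦ p^a = g^{ab} p_b`: the inverse of `v ↦ g(v, ·)`. -/
def Spacetime.sharp (x : M) (p : TangentSpace (𝓡 4) x →L[ℝ] ℝ) : TangentSpace (𝓡 4) x :=
  (𝓜.g x).inverse p

/-- The inverse metric on covectors, `g^{ab} p_a q_b`. -/
def Spacetime.cometric (x : M) (p q : TangentSpace (𝓡 4) x →L[ℝ] ℝ) : ℝ :=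
  p (𝓜.sharp x q)

/-- The Hamiltonian `H = ½ g^{ab} p_a p_b` on the cotangent bundle. -/
def Spacetime.hamiltonian (p : Cotangent 4 M) : ℝ :=
  (1 / 2) * 𝓜.cometric p.1 p.2 p.2

/-- The bundle `N'M` of future-pointing (nonzero) null covectors. -/
def Spacetime.nullBundle : Set (Cotangent 4 M) :=
  {p | 𝓜.hamiltonian p = 0 ∧ 𝓜.IsFutureCausal p.1 (𝓜.sharp p.1 p.2)}

/-- The differential `dH` of the Hamiltonian. -/
def Spacetime.dHamiltonian (p : Cotangent 4 M) : TangentSpace (cotangentModel 4) p →L[ℝ] ℝ :=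
  mfderiv (cotangentModel 4) 𝓘(ℝ, ℝ) 𝓜.hamiltonian p

/-- `c` is an integral curve, on the open set `J` of times, of the geodesic spray `X_G`,
the vector field on `T*M` determined by `X_G ⌟ ω + dH = 0`, where `ω = dθ`. -/
def Spacetime.IsGeodesicFlowLine (c : ℝ → Cotangent 4 M) (J : Set ℝ) : Prop :=
  ∀ t ∈ J, MDifferentiableAt 𝓘(ℝ, ℝ) (cotangentModel 4) c t ∧
    ∀ w : TangentSpace (cotangentModel 4) (c t),
      extd (cotangentModel 4) (canonicalForm 4 M) (c t)
          (mfderiv 𝓘(ℝ, ℝ) (cotangentModel 4) c t (1 : ℝ)) w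
        + 𝓜.dHamiltonian (c t) w = 0

/-- Two elements of `N'M` are related if one is a positive multiple of the other (flow of the
Euler field) or if they lie on a common integral curve of the geodesic spray. The equivalence
classes generated by this relation are the leaves of the distribution on `N'M` spanned by these
two vector fields. -/
def Spacetime.leafRel (p q : 𝓜.nullBundle) : Prop :=
  (∃ a : ℝ, 0 < a ∧ (q : Cotangent 4 M) = ⟨p.1.1, a • p.1.2⟩) ∨
  (∃ (c : ℝ → Cotangent 4 M) (J : Set ℝ), IsOpen J ∧ J.OrdConnected ∧
    𝓜.IsGeodesicFlowLine c J ∧ (p : Cotangent 4 M) ∈ c '' J ∧ (q : Cotangent 4 M) ∈ c '' J)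

/-- The space `N` of (unscaled, future-directed) null geodesics: the quotient of `N'M` by the
leaves, with the quotient topology. -/
abbrev Spacetime.NullGeodesicSpace : Type _ := Quot 𝓜.leafRel

/-- The projection `N'M → N`. -/
def Spacetime.proj (p : 𝓜.nullBundle) : 𝓜.NullGeodesicSpace := Quot.mk _ p

/-- The charts on `N` make it the quotient manifold of `N'M` (whose charts are also given):
they are smoothly compatible and the projection `N'M → N` is a smooth submersion. Such a
smooth structure on `N` is unique. -/
structure Spacetime.IsQuotientManifold [ChartedSpace (EuclideanSpace ℝ (Fin 7)) 𝓜.nullBundle]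
    [ChartedSpace (EuclideanSpace ℝ (Fin 5)) 𝓜.NullGeodesicSpace] : Prop where
  isManifold : IsManifold (𝓡 5) ∞ 𝓜.NullGeodesicSpace
  contMDiff_proj : ContMDiff (𝓡 7) (𝓡 5) ∞ 𝓜.proj
  submersion : ∀ p, Function.Surjective (mfderiv (𝓡 7) (𝓡 5) 𝓜.proj p)

/-- The canonical one-form `θ` of `T*M`, restricted to `N'M`. -/
def Spacetime.theta [ChartedSpace (EuclideanSpace ℝ (Fin 7)) 𝓜.nullBundle]
    (ζ : TangentBundle (𝓡 7) 𝓜.nullBundle) : ℝ :=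
  canonicalForm 4 M ζ.1.1
    (mfderiv (𝓡 7) (cotangentModel 4) (Subtype.val : 𝓜.nullBundle → Cotangent 4 M) ζ.1 ζ.2)

/-- The planes `ker [θ]` on `N`: the image of `ker θ ⊆ T(N'M)` under the differential of the
projection `N'M → N`. -/
def Spacetime.kerTheta [ChartedSpace (EuclideanSpace ℝ (Fin 7)) 𝓜.nullBundle]
    [ChartedSpace (EuclideanSpace ℝ (Fin 5)) 𝓜.NullGeodesicSpace] :
    Set (TangentBundle (𝓡 5) 𝓜.NullGeodesicSpace) :=
  tangentMap (𝓡 7) (𝓡 5) 𝓜.proj '' {ζ | 𝓜.theta ζ = 0}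

/-- `p` is an endpoint of the curve `γ` on the interval `J`, in the future direction. -/
def IsFutureEndpoint (γ : ℝ → M) (J : Set ℝ) (p : M) : Prop :=
  ∀ U ∈ 𝓝 p, ∃ t₀ ∈ J, ∀ t ∈ J, t₀ ≤ t → γ t ∈ U

/-- `p` is an endpoint of the curve `γ` on the interval `J`, in the past direction. -/
def IsPastEndpoint (γ : ℝ → M) (J : Set ℝ) (p : M) : Prop :=
  ∀ U ∈ 𝓝 p, ∃ t₀ ∈ J, ∀ t ∈ J, t ≤ t₀ → γ t ∈ U

/-- `γ`, on the nonempty open interval `J`, is an inextendible smooth future-directed causal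
curve: it has causal future-pointing velocity, and neither a future nor a past endpoint. -/
structure Spacetime.IsInextendibleCausalCurve (γ : ℝ → M) (J : Set ℝ) : Prop where
  isOpen : IsOpen J
  ordConnected : J.OrdConnected
  nonempty : J.Nonempty
  smooth : ContMDiffOn 𝓘(ℝ, ℝ) (𝓡 4) ∞ γ J
  causal : ∀ t ∈ J, 𝓜.IsFutureCausal (γ t) (mfderiv 𝓘(ℝ, ℝ) (𝓡 4) γ t (1 : ℝ))
  no_future_endpoint : ¬ ∃ p, IsFutureEndpoint γ J p
  no_past_endpoint : ¬ ∃ p, IsPastEndpoint γ J p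

/-! ### Cauchy surfaces and their unit cotangent bundles -/

variable {S : Type*} [TopologicalSpace S] [ChartedSpace (EuclideanSpace ℝ (Fin 3)) S]
  [IsManifold (𝓡 3) ∞ S]

/-- `ι : S → M` is (the inclusion of) a smooth spacelike Cauchy surface: an embedded spacelike
hypersurface that every inextendible causal curve meets exactly once. (Spacelike implies that
the differential of `ι` is injective.) -/
structure Spacetime.IsCauchySurface (ι : S → M) : Prop where
  smooth : ContMDiff (𝓡 3) (𝓡 4) ∞ ι
  isEmbedding : IsEmbedding ι
  spacelike : ∀ (x : S) (v : TangentSpace (𝓡 3) x), v ≠ 0 →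
    0 < 𝓜.g (ι x) (mfderiv (𝓡 3) (𝓡 4) ι x v) (mfderiv (𝓡 3) (𝓡 4) ι x v)
  meets_once : ∀ (γ : ℝ → M) (J : Set ℝ), 𝓜.IsInextendibleCausalCurve γ J →
    ∃! t, t ∈ J ∧ γ t ∈ range ι

/-- The metric `h = ι^* g` induced on `S`. -/
def Spacetime.inducedMetric (ι : S → M) (x : S) :
    TangentSpace (𝓡 3) x →L[ℝ] TangentSpace (𝓡 3) x →L[ℝ] ℝ :=
  (ContinuousLinearMap.precomp ℝ (mfderiv (𝓡 3) (𝓡 4) ι x)).comp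
    ((𝓜.g (ι x)).comp (mfderiv (𝓡 3) (𝓡 4) ι x))

/-- The unit cotangent bundle `T*_1 S`, the set of covectors `v` with `h^{αβ} v_α v_β = 1`. -/
def Spacetime.unitCotangent (ι : S → M) : Set (Cotangent 3 S) :=
  {u | (u.2 : TangentSpace (𝓡 3) u.1 →L[ℝ] ℝ) ((𝓜.inducedMetric ι u.1).inverse u.2) = 1}

/-- The contact form of `T*_1 S`: the canonical one-form of `T*S` restricted to `T*_1 S`. -/
def Spacetime.contactForm (ι : S → M)
    [ChartedSpace (EuclideanSpace ℝ (Fin 5)) (𝓜.unitCotangent ι)]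
    (ξ : TangentBundle (𝓡 5) (𝓜.unitCotangent ι)) : ℝ :=
  canonicalForm 3 S ξ.1.1
    (mfderiv (𝓡 5) (cotangentModel 3) (Subtype.val : 𝓜.unitCotangent ι → Cotangent 3 S) ξ.1 ξ.2)

/-- `n` is the future-pointing unit timelike conormal to `S` at `x`. -/
def Spacetime.IsUnitConormal (ι : S → M) (x : S) (n : TangentSpace (𝓡 4) (ι x) →L[ℝ] ℝ) : Prop :=
  (∀ v : TangentSpace (𝓡 3) x, n (mfderiv (𝓡 3) (𝓡 4) ι x v) = 0) ∧
  𝓜.cometric (ι x) n n = -1 ∧ 𝓜.IsFutureCausal (ι x) (𝓜.sharp (ι x) n)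

/-- The covector `q` of `M` at `ι x` is obtained from the covector `v` of `S` at `x` by regarding
`v` as the covector `w` of `M` that restricts to `v` on `T_x S` and is orthogonal to the
conormal, and adding to it the future-pointing unit timelike conormal `n`. -/
def Spacetime.IsLift (ι : S → M) (x : S) (v : TangentSpace (𝓡 3) x →L[ℝ] ℝ)
    (q : TangentSpace (𝓡 4) (ι x) →L[ℝ] ℝ) : Prop :=
  ∃ n w : TangentSpace (𝓡 4) (ι x) →L[ℝ] ℝ, 𝓜.IsUnitConormal ι x n ∧
    w.comp (mfderiv (𝓡 3) (𝓡 4) ι x) = v ∧ 𝓜.cometric (ι x) w n = 0 ∧ q = w + n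

end

end NullGeodesics

end

open NullGeodesics

/-! Each leaf in N'M determines exactly one unit covector of the Cauchy surface, and the theorem is
read off from the resulting map `trace` from N'M to T*_1 S.

That this covector exists and is unique comes from the Cauchy property applied to maximal null
geodesics, once these are known to be inextendible as curves in M
(`isInextendibleCausalCurve_of_maximal`). If such a geodesic had an endpoint q, its velocity near q
would lie in a fixed cone. A Gronwall estimate against a coordinate time
(`exists_compact_of_causal`) would then bound the affine parameter and confine the geodesic to a
compact set of T*M, from which the flow runs for a uniform time: the geodesic would not be maximal.
Over a point of S a future null covector is determined by its restriction to S, which is nonzero, so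
it is a positive multiple of one lift w + n (`exists_eq_scaledLift`). Scaling a covector only
reparametrises its geodesic, so a leaf is reached by one scaling and one flow segment, and unit
covectors correspond bijectively to leaves.

The analytic core is that `trace` is a smooth submersion which pulls the contact form back to a
nonzero multiple of θ. Over S (`isContactSubmersionAt_lift`) the inverse function theorem gives the
hitting time and hitting point as smooth functions, because null vectors are transverse to a
spacelike hypersurface. The variation of the hitting time contributes only a multiple of θ(X_G) = 2H
= 0. The property is then carried along geodesics: the flow does not change `trace`, and it
preserves θ on N'M, since the Lie derivative of θ is d(θ(X_G)) + X_G ⌟ ω = 2dH - dH = dH, which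
vanishes on tangent vectors of N'M (`canonical_flow`). Smoothness of the flow itself comes from the
inverse function theorem in a space of continuous paths.

Hence T*_1 S and N are homeomorphic, and N receives the smooth structure of T*_1 S. The projection
factors as Φ after `trace`, which yields the submersion and the statements about ker θ. The contact
condition is the classical one for a unit cosphere bundle, the level set 2H = 1 of the Hamiltonian
of h in T*S (`IsMetricOn.isContactMap`). -/

noncomputable section

namespace NullGeodesics

/-! ### Inverse functions -/

section Analysis

/-- Inverse function theorem with a smooth local inverse on an open set. -/
theorem exists_openPartialHomeomorph_contDiffOn {E F : Type*} [NormedAddCommGroup E]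
    [NormedSpace ℝ E] [CompleteSpace E] [NormedAddCommGroup F] [NormedSpace ℝ F]
    {f : E → F} {U : Set E} (hU : IsOpen U) (hf : ContDiffOn ℝ ∞ f U) {a : E} (ha : a ∈ U)
    {f' : E ≃L[ℝ] F} (hf' : HasFDerivAt f (f' : E →L[ℝ] F) a) :
    ∃ e : OpenPartialHomeomorph E F, a ∈ e.source ∧ e.source ⊆ U ∧ (∀ x, e x = f x) ∧
      ContDiffOn ℝ ∞ e.symm e.target := by
  have hfa : ContDiffAt ℝ ∞ f a := hf.contDiffAt (hU.mem_nhds ha)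
  let e0 := hfa.toOpenPartialHomeomorph f hf' (by simp)
  have he0 : ∀ x, e0 x = f x := fun x => rfl
  have hcont : ContinuousOn (fderiv ℝ f) U := hf.continuousOn_fderiv_of_isOpen hU (by simp)
  let W : Set E := U ∩ fderiv ℝ f ⁻¹' (range ((↑) : (E ≃L[ℝ] F) → E →L[ℝ] F))
  have hW : IsOpen W := hcont.isOpen_inter_preimage hU (ContinuousLinearEquiv.isOpen)
  have haW : a ∈ W := ⟨ha, by rw [mem_preimage, hf'.fderiv]; exact mem_range_self _⟩
  refine ⟨e0.restrOpen W hW, ⟨hfa.mem_toOpenPartialHomeomorph_source hf' (by simp), haW⟩,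
    fun x hx => hx.2.1, he0, ?_⟩
  intro y hy
  have hy' := (e0.restrOpen W hW).map_target hy
  obtain ⟨L, hL⟩ := hy'.2.2
  have hUx : U ∈ 𝓝 ((e0.restrOpen W hW).symm y) := hU.mem_nhds hy'.2.1
  refine ((e0.restrOpen W hW).contDiffAt_symm (f₀' := L) hy ?_ ?_).contDiffWithinAt
  · rw [hL]
    exact ((hf.contDiffAt hUx).differentiableAt (by simp)).hasFDerivAt
  · exact hf.contDiffAt hUx

/-! ### Smoothness of postcomposition on spaces of continuous maps -/

section Postcomp
universe u
variable {K : Type*} [TopologicalSpace K] [CompactSpace K]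

/-- Pointwise application of a bilinear map to continuous maps. -/
def pointwiseBilin (K : Type*) [TopologicalSpace K] [CompactSpace K]
    {G E F : Type*} [NormedAddCommGroup G] [NormedSpace ℝ G] [NormedAddCommGroup E]
    [NormedSpace ℝ E] [NormedAddCommGroup F] [NormedSpace ℝ F] (B : G →L[ℝ] E →L[ℝ] F) :
    C(K, G) →L[ℝ] C(K, E) →L[ℝ] C(K, F) :=
  LinearMap.mkContinuous₂
    (LinearMap.mk₂ ℝ (fun (A : C(K, G)) (h : C(K, E)) =>
        (⟨fun k => B (A k) (h k), by fun_prop⟩ : C(K, F)))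
      (fun A A' h => by ext k; simp) (fun c A h => by ext k; simp)
      (fun A h h' => by ext k; simp) (fun c A h => by ext k; simp)) ‖B‖
    (fun A h => by
      have hB : 0 ≤ ‖B‖ := B.opNorm_nonneg
      refine (ContinuousMap.norm_le _ (mul_nonneg (mul_nonneg hB (norm_nonneg A))
        (norm_nonneg h))).2 fun k => ?_
      exact (B.le_opNorm₂ _ _).trans (mul_le_mul (mul_le_mul_of_nonneg_left
        (A.norm_coe_le_norm k) hB) (h.norm_coe_le_norm k) (norm_nonneg _)
        (mul_nonneg hB (norm_nonneg A))))

/-- Postcomposition with a continuous map. -/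
def postcomp {E F : Type*} [TopologicalSpace E] [TopologicalSpace F] (f : C(E, F))
    (u : C(K, E)) : C(K, F) := f.comp u

/-- The range of `u` is compact, so a single `δ` of uniform continuity of the derivative serves all
`k`; the mean value inequality on the ball of radius `δ` about `u k` bounds the error by `c` times
the size of `h`. The derivative enters as `B (f' x)` so that `f'` may take values in an auxiliary
space `G`. -/
theorem hasFDerivAt_postcomp {G E F : Type*} [NormedAddCommGroup G] [NormedSpace ℝ G]
    [NormedAddCommGroup E] [NormedSpace ℝ E] [NormedAddCommGroup F] [NormedSpace ℝ F]
    (B : G →L[ℝ] E →L[ℝ] F) (f : C(E, F)) (f' : C(E, G))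
    (hf : ∀ x, HasFDerivAt f (B (f' x)) x) (u : C(K, E)) :
    HasFDerivAt (postcomp f) (pointwiseBilin K B (postcomp f' u)) u := by
  rw [hasFDerivAt_iff_isLittleO_nhds_zero, Asymptotics.isLittleO_iff]
  intro c hc
  have hBf : Continuous fun x => B (f' x) := by fun_prop
  have huc := (isCompact_range u.continuous).uniformContinuousAt_of_continuousAt
    (fun x => B (f' x)) (fun a _ => hBf.continuousAt) (Metric.dist_mem_uniformity hc)
  obtain ⟨δ, hδ, H⟩ := Metric.mem_uniformity_dist.1 huc
  filter_upwards [Metric.ball_mem_nhds (0 : C(K, E)) hδ] with h hh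
  refine (ContinuousMap.norm_le _ (by positivity)).2 fun k => ?_
  have hhk : ‖h k‖ < δ := (h.norm_coe_le_norm k).trans_lt (by simpa using hh)
  have key := (convex_ball (u k) δ).norm_image_sub_le_of_norm_hasFDerivWithin_le'
    (f := f) (f' := fun x => B (f' x)) (φ := B (f' (u k))) (C := c) (x := u k) (y := u k + h k)
    (fun x _ => (hf x).hasFDerivWithinAt)
    (fun x hx => by
      have := H (a := u k) (b := x) (by rw [dist_comm]; exact hx) (mem_range_self k)
      rw [← dist_eq_norm, dist_comm]; exact le_of_lt this)
    (Metric.mem_ball_self hδ) (by simpa using hhk)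
  rw [add_sub_cancel_left] at key
  exact key.trans (mul_le_mul_of_nonneg_left (h.norm_coe_le_norm k) hc.le)

/-- The derivative of postcomposition with `f` is postcomposition with the derivative of `f`,
followed by a continuous linear map, so the induction hypothesis applies to it. The target `F` has
to vary, and `E` and `F` share a universe so that `E →L[ℝ] F` is again an admissible target. -/
theorem contDiff_postcomp_nat {E : Type u} [NormedAddCommGroup E] [NormedSpace ℝ E] (n : ℕ) :
    ∀ {F : Type u} [NormedAddCommGroup F] [NormedSpace ℝ F] (f : C(E, F)),
      ContDiff ℝ ∞ f → ContDiff ℝ n (postcomp (K := K) f) := by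
  induction n with
  | zero =>
    intro F _ _ f hf
    exact contDiff_zero.2 (ContinuousMap.continuous_postcomp f)
  | succ n ih =>
    intro F _ _ f hf
    have hd : ContDiff ℝ ∞ (fderiv ℝ f) := hf.fderiv_right (by simp)
    obtain ⟨G, _, _, B, f', hf', hB⟩ : ∃ (G : Type u) (_ : NormedAddCommGroup G)
        (_ : NormedSpace ℝ G) (B : G →L[ℝ] E →L[ℝ] F) (f' : C(E, G)), ContDiff ℝ ∞ f' ∧
        ∀ x, HasFDerivAt f (B (f' x)) x :=
      ⟨E →L[ℝ] F, inferInstance, inferInstance, ContinuousLinearMap.id ℝ _,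
        ⟨fderiv ℝ f, hd.continuous⟩, hd,
        fun x => (hf.differentiable (by simp) x).hasFDerivAt⟩
    have hder := hasFDerivAt_postcomp (K := K) B f f' hB
    push_cast
    refine contDiff_succ_iff_fderiv.2 ⟨fun u => (hder u).differentiableAt, by simp, ?_⟩
    rw [funext fun u => (hder u).fderiv]
    exact (pointwiseBilin K B).contDiff.comp (ih f' hf')

theorem contDiff_postcomp {E F : Type u} [NormedAddCommGroup E] [NormedSpace ℝ E]
    [NormedAddCommGroup F] [NormedSpace ℝ F] (f : C(E, F)) (hf : ContDiff ℝ ∞ f) :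
    ContDiff ℝ ∞ (postcomp (K := K) f) :=
  contDiff_infty.2 fun n => contDiff_postcomp_nat n f hf

end Postcomp
end Analysis

/-! ### Smooth local flows -/

section Flow
variable {E : Type*} [NormedAddCommGroup E] [NormedSpace ℝ E]

/-- The primitive vanishing at `0` of a continuous function on the unit interval. -/
def primitive (E : Type*) [NormedAddCommGroup E] [NormedSpace ℝ E] [CompleteSpace E] :
    C(unitInterval, E) →L[ℝ] C(unitInterval, E) :=
  LinearMap.mkContinuous
    { toFun := fun u => ⟨fun τ => ∫ s in (0 : ℝ)..τ, u (projIcc 0 1 zero_le_one s),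
        (intervalIntegral.continuous_primitive (fun a b =>
          (u.continuous.comp continuous_projIcc).intervalIntegrable a b) 0).comp
          continuous_subtype_val⟩
      map_add' := fun u v => by
        ext τ
        exact intervalIntegral.integral_add
          ((u.continuous.comp continuous_projIcc).intervalIntegrable _ _)
          ((v.continuous.comp continuous_projIcc).intervalIntegrable _ _)
      map_smul' := fun c u => by
        ext τ
        exact intervalIntegral.integral_smul c _ } 1
    (fun u => by
      refine (ContinuousMap.norm_le _ (by positivity)).2 fun τ => ?_
      have h := intervalIntegral.norm_integral_le_of_norm_le_const (a := 0) (b := (τ : ℝ))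
        (f := fun s => u (projIcc 0 1 zero_le_one s)) (C := ‖u‖)
        (fun s _ => u.norm_coe_le_norm _)
      refine h.trans ?_
      rw [sub_zero, abs_of_nonneg τ.2.1, mul_comm]
      exact mul_le_mul_of_nonneg_right τ.2.2 (norm_nonneg _))

theorem primitive_apply [CompleteSpace E] (u : C(unitInterval, E)) (τ : unitInterval) :
    primitive E u τ = ∫ s in (0 : ℝ)..τ, u (projIcc 0 1 zero_le_one s) := rfl

/-- The local flow of a compactly supported smooth vector field is smooth near time zero. -/
theorem exists_local_flow_of_hasCompactSupport [CompleteSpace E] {V : E → E}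
    (hV : ContDiff ℝ ∞ V) (hc : HasCompactSupport V) (x₀ : E) :
    ∃ ε > 0, ∃ U, IsOpen U ∧ x₀ ∈ U ∧ ∃ F : ℝ × E → E,
      ContDiffOn ℝ ∞ F (Ioo (-ε) ε ×ˢ U) ∧ (∀ x ∈ U, F (0, x) = x) ∧
      ∀ x ∈ U, ∀ t ∈ Ioo (-ε) ε, HasDerivAt (fun s => F (s, x)) (V (F (t, x))) t := by
  obtain ⟨C, hC⟩ := hc.exists_bound_of_continuous hV.continuous
  obtain ⟨r, hr, ε, hε, H⟩ :=
    (hV.contDiffAt (x := x₀)).of_le (m := 1) (by simp)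
      |>.exists_forall_mem_closedBall_exists_eq_forall_mem_Ioo_hasDerivAt 0
  simp only [zero_sub, zero_add] at H
  choose! α hα0 hα using H
  -- For short times a solution starting near `x₀` is uniformly close to the constant path `x₀`, so
  -- it lies where the local inverse found below is defined.
  have hbound : ∀ x ∈ Metric.closedBall x₀ r, ∀ t ∈ Ioo (-ε) ε, ‖α x t - x‖ ≤ C * |t| := by
    intro x hx t ht
    have h := (convex_Ioo (-ε) ε).norm_image_sub_le_of_norm_hasDerivWithin_le
      (f := α x) (f' := fun t => V (α x t)) (C := C) (x := 0) (y := t)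
      (fun s hs => (hα x hx s hs).hasDerivWithinAt) (fun s _ => hC _) ⟨by simpa, hε⟩ ht
    rwa [hα0 x hx, sub_zero, Real.norm_eq_abs] at h
  let Vc : C(E, E) := ⟨V, hV.continuous⟩
  let cst : E →L[ℝ] C(unitInterval, E) := ContinuousLinearMap.const ℝ unitInterval
  -- With time rescaled to the unit interval, the solution from `x` up to time `s` is a path `u`
  -- with u = x + s ∫ V(u). It is therefore the preimage of `((s, x), 0)` under `G`, and a smooth
  -- local inverse of `G` gives smooth dependence on `s` and `x`.
  let G : (ℝ × E) × C(unitInterval, E) → (ℝ × E) × C(unitInterval, E) := fun p =>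
    (p.1, p.2 - cst p.1.2 - p.1.1 • primitive E (postcomp Vc p.2))
  have hP : ContDiff ℝ ∞ (fun u : C(unitInterval, E) => primitive E (postcomp Vc u)) :=
    (primitive E).contDiff.comp (contDiff_postcomp Vc hV)
  have hG : ContDiff ℝ ∞ G := by
    refine contDiff_fst.prodMk ((contDiff_snd.sub (cst.contDiff.comp
      (contDiff_snd.comp contDiff_fst))).sub ((contDiff_fst.comp contDiff_fst).smul
      (hP.comp contDiff_snd)))
  let p₀ : (ℝ × E) × C(unitInterval, E) := ((0, x₀), cst x₀)
  -- At time 0 the derivative in the path variable is the identity, so the derivative of `G` is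
  -- triangular and invertible.
  let L : ((ℝ × E) × C(unitInterval, E)) ≃L[ℝ] ((ℝ × E) × C(unitInterval, E)) :=
    (ContinuousLinearEquiv.refl ℝ (ℝ × E)).skewProd (ContinuousLinearEquiv.refl ℝ C(unitInterval, E))
      (-(cst.comp (ContinuousLinearMap.snd ℝ ℝ E)) -
        (ContinuousLinearMap.fst ℝ ℝ E).smulRight (primitive E (postcomp Vc (cst x₀))))
  have hGL : HasFDerivAt G (L : (ℝ × E) × C(unitInterval, E) →L[ℝ] (ℝ × E) × C(unitInterval, E)) p₀ := by
    have h1 : HasFDerivAt (fun p : (ℝ × E) × C(unitInterval, E) => p.1) (ContinuousLinearMap.fst ℝ _ _) p₀ :=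
      hasFDerivAt_fst
    have h2 : HasFDerivAt (fun p : (ℝ × E) × C(unitInterval, E) => p.2) (ContinuousLinearMap.snd ℝ _ _) p₀ :=
      hasFDerivAt_snd
    have h3 := ((hP.differentiable (by simp) (cst x₀)).hasFDerivAt).comp p₀ h2
    have h4 := (h2.sub (cst.hasFDerivAt.comp p₀ (hasFDerivAt_snd.comp p₀ h1))).sub
      ((hasFDerivAt_fst.comp p₀ h1).smul h3)
    refine (h1.prodMk h4).congr_fderiv ?_
    ext p <;> simp [L, p₀, sub_eq_add_neg]
  obtain ⟨e, hp₀, -, he, hes⟩ := exists_openPartialHomeomorph_contDiffOn isOpen_univ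
    hG.contDiffOn (mem_univ p₀) hGL
  obtain ⟨δ, hδ, hball⟩ := Metric.isOpen_iff.1 e.open_source p₀ hp₀
  have hC0 : 0 ≤ C := (norm_nonneg _).trans (hC x₀)
  -- Half of `δ` is kept for the drift `C * |s|` and half for the distance from `x` to `x₀`; the
  -- summand 1 avoids division by zero.
  let ε' := min ε (δ / (2 * (C + 1)))
  let r' := min r (δ / 2)
  have hε' : 0 < ε' := lt_min hε (by positivity)
  have hr' : 0 < r' := lt_min hr (by positivity)
  have key : ∀ x ∈ Metric.ball x₀ r', ∀ s ∈ Ioo (-ε') ε', ((s, x), (0 : C(unitInterval, E))) ∈ e.target ∧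
      α x s = (e.symm ((s, x), (0 : C(unitInterval, E)))).2 1 := by
    intro x hx s hs
    have hxr : x ∈ Metric.closedBall x₀ r :=
      Metric.ball_subset_closedBall (Metric.ball_subset_ball (min_le_left _ _) hx)
    have hsε : |s| < ε := (abs_lt.2 hs).trans_le (min_le_left _ _)
    have hsδ : |s| < δ / (2 * (C + 1)) := (abs_lt.2 hs).trans_le (min_le_right _ _)
    have hxδ : dist x x₀ < δ / 2 := lt_of_lt_of_le hx (min_le_right _ _)
    have hCs : C * |s| < δ / 2 := by
      rw [lt_div_iff₀ (by positivity)] at hsδ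
      nlinarith [abs_nonneg s]
    have hsτ : ∀ τ ∈ Icc (0 : ℝ) 1, s * τ ∈ Ioo (-ε) ε := fun τ hτ => by
      rw [mem_Ioo, ← abs_lt, abs_mul, abs_of_nonneg hτ.1]
      exact (mul_le_of_le_one_right (abs_nonneg s) hτ.2).trans_lt hsε
    have hderiv : ∀ τ ∈ Icc (0 : ℝ) 1,
        HasDerivAt (fun τ => α x (s * τ)) (s • V (α x (s * τ))) τ := fun τ hτ => by
      have h1 : HasDerivAt (fun τ => s * τ) s τ := by simpa using (hasDerivAt_id τ).const_mul s
      exact (hα x hxr (s * τ) (hsτ τ hτ)).scomp τ h1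
    let w : C(unitInterval, E) := ⟨fun τ => α x (s * τ), continuous_iff_continuousAt.2 fun τ =>
      (hderiv τ τ.2).continuousAt.comp continuousAt_subtype_val⟩
    have hwG : G ((s, x), w) = ((s, x), 0) := by
      refine Prod.ext rfl ?_
      ext τ
      change α x (s * τ) - x - s • primitive E (postcomp Vc w) τ = 0
      rw [primitive_apply, ← intervalIntegral.integral_smul]
      have hsub : uIcc (0 : ℝ) τ ⊆ Icc 0 1 := by
        rw [uIcc_of_le τ.2.1]; exact Icc_subset_Icc_right τ.2.2
      have hval : ∀ σ ∈ uIcc (0 : ℝ) τ, s • (postcomp Vc w) (projIcc 0 1 zero_le_one σ) =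
          s • V (α x (s * σ)) := fun σ hσ => by
        change s • V (α x (s * (projIcc (0 : ℝ) 1 zero_le_one σ))) = _
        rw [projIcc_of_mem _ (hsub hσ)]
      rw [intervalIntegral.integral_congr hval,
        intervalIntegral.integral_eq_sub_of_hasDerivAt (f := fun τ => α x (s * τ))
          (fun σ hσ => hderiv σ (hsub hσ)) ?_]
      · simp [hα0 x hxr]
      · refine ContinuousOn.intervalIntegrable fun σ hσ => ?_
        exact (continuousAt_const.smul (hV.continuous.continuousAt.comp
          (hderiv σ (hsub hσ)).continuousAt)).continuousWithinAt
    have hw : ((s, x), w) ∈ e.source := by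
      apply hball
      have hsd : |s| < δ := hsδ.trans_le (div_le_self hδ.le (by linarith))
      rw [Metric.mem_ball, Prod.dist_eq, Prod.dist_eq]
      refine max_lt (max_lt (by simpa [p₀] using hsd) (hxδ.trans (by linarith))) ?_
      refine lt_of_le_of_lt ((ContinuousMap.dist_le (by positivity)).2 fun τ => ?_)
        (show C * |s| + dist x x₀ < δ by linarith)
      refine (dist_triangle _ x _).trans (add_le_add ?_ le_rfl)
      rw [dist_eq_norm]
      refine (hbound x hxr _ (hsτ τ τ.2)).trans (mul_le_mul_of_nonneg_left ?_ hC0)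
      rw [abs_mul, abs_of_nonneg τ.2.1]
      exact mul_le_of_le_one_right (abs_nonneg s) τ.2.2
    have hew : e ((s, x), w) = ((s, x), 0) := (he _).trans hwG
    refine ⟨hew ▸ e.map_source hw, ?_⟩
    rw [← hew, e.left_inv hw]
    change _ = α x (s * (1 : unitInterval))
    simp
  refine ⟨ε', hε', Metric.ball x₀ r', Metric.isOpen_ball, Metric.mem_ball_self hr',
    fun p => α p.2 p.1, ?_, fun x hx => hα0 x ?_, fun x hx t ht => hα x ?_ t ?_⟩
  · have h1 : ContDiffOn ℝ ∞ (fun p : ℝ × E => (e.symm (p, (0 : C(unitInterval, E)))).2 1)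
        (Ioo (-ε') ε' ×ˢ Metric.ball x₀ r') := by
      have h2 : ContDiffOn ℝ ∞ (fun p : ℝ × E => e.symm (p, (0 : C(unitInterval, E))))
          (Ioo (-ε') ε' ×ˢ Metric.ball x₀ r') :=
        hes.comp (contDiff_id.prodMk contDiff_const).contDiffOn
          fun p hp => (key p.2 hp.2 p.1 hp.1).1
      exact (ContinuousMap.evalCLM ℝ (1 : unitInterval)).contDiff.comp_contDiffOn h2.snd
    exact h1.congr fun p hp => (key p.2 hp.2 p.1 hp.1).2
  · exact Metric.ball_subset_closedBall (Metric.ball_subset_ball (min_le_left _ _) hx)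
  · exact Metric.ball_subset_closedBall (Metric.ball_subset_ball (min_le_left _ _) hx)
  · exact ⟨(neg_le_neg (min_le_left _ _)).trans_lt ht.1, ht.2.trans_le (min_le_left _ _)⟩

/-- Smooth local flow of a smooth vector field on an open set. -/
theorem exists_local_flow [FiniteDimensional ℝ E] {V : E → E} {Ω : Set E} (hΩ : IsOpen Ω)
    (hV : ContDiffOn ℝ ∞ V Ω) {x₀ : E} (hx₀ : x₀ ∈ Ω) :
    ∃ ε > 0, ∃ U, IsOpen U ∧ x₀ ∈ U ∧ ∃ F : ℝ × E → E,
      ContDiffOn ℝ ∞ F (Ioo (-ε) ε ×ˢ U) ∧ (∀ x ∈ U, F (0, x) = x) ∧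
      ∀ x ∈ U, ∀ t ∈ Ioo (-ε) ε, F (t, x) ∈ Ω ∧
        HasDerivAt (fun s => F (s, x)) (V (F (t, x))) t := by
  have := FiniteDimensional.complete ℝ E
  obtain ⟨ρ, hρ, hρΩ⟩ := Metric.nhds_basis_closedBall.mem_iff.1 (hΩ.mem_nhds hx₀)
  -- The field is cut off outside the ball of radius `ρ`. On the ball of radius `ρ / 2` it is
  -- unchanged, and for short times the flow stays there.
  let χ : ContDiffBump x₀ := ⟨ρ / 2, ρ, by positivity, by linarith⟩
  have hW : ContDiff ℝ ∞ fun x => χ x • V x := by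
    refine contDiff_iff_contDiffAt.2 fun x => ?_
    by_cases hx : x ∈ tsupport χ
    · rw [χ.tsupport_eq] at hx
      exact χ.contDiff.contDiffAt.smul (hV.contDiffAt (hΩ.mem_nhds (hρΩ hx)))
    · have : (fun x => χ x • V x) =ᶠ[𝓝 x] fun _ => 0 := by
        filter_upwards [notMem_tsupport_iff_eventuallyEq.1 hx] with y hy
        rw [hy, Pi.zero_apply, zero_smul]
      exact contDiffAt_const.congr_of_eventuallyEq this
  obtain ⟨ε, hε, U, hU, hxU, F, hF, hF0, hFd⟩ :=
    exists_local_flow_of_hasCompactSupport hW (χ.hasCompactSupport.smul_right) x₀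
  have hnhds : Ioo (-ε) ε ×ˢ U ∈ 𝓝 ((0 : ℝ), x₀) :=
    (isOpen_Ioo.prod hU).mem_nhds ⟨⟨by simpa, hε⟩, hxU⟩
  have hev : ∀ᶠ p in 𝓝 ((0 : ℝ), x₀), F p ∈ Metric.ball x₀ (ρ / 2) := by
    refine (hF.contDiffAt hnhds).continuousAt ?_
    rw [hF0 x₀ hxU]
    exact Metric.ball_mem_nhds _ (by positivity)
  obtain ⟨A, hA, B, hB, hAB⟩ := mem_nhds_prod_iff.1 (inter_mem hev hnhds)
  obtain ⟨δ, hδ, hδA⟩ := Metric.mem_nhds_iff.1 hA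
  obtain ⟨B', hB', hBo, hxB⟩ := mem_nhds_iff.1 hB
  rw [Real.ball_eq_Ioo, zero_sub, zero_add] at hδA
  have hsub : Ioo (-δ) δ ×ˢ B' ⊆ F ⁻¹' (Metric.ball x₀ (ρ / 2)) ∩ Ioo (-ε) ε ×ˢ U :=
    (prod_mono hδA hB').trans hAB
  have h0 : (0 : ℝ) ∈ Ioo (-δ) δ := ⟨by simpa, hδ⟩
  refine ⟨δ, hδ, B', hBo, hxB, F, hF.mono (hsub.trans inter_subset_right),
    fun x hx => hF0 x (hsub (mk_mem_prod h0 hx)).2.2, fun x hx t ht => ?_⟩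
  obtain ⟨h1, h2, h3⟩ := hsub (mk_mem_prod ht hx)
  have h1' := Metric.ball_subset_closedBall h1
  refine ⟨hρΩ (Metric.closedBall_subset_closedBall (by linarith) h1'), ?_⟩
  have := hFd x h3 t h2
  rwa [χ.one_of_mem_closedBall h1', one_smul] at this

/-- Integral curves of a locally Lipschitz field that agree at a time agree near this time. -/
theorem eventuallyEq_of_hasDerivAt {V : E → E} {x₀ : E} (hV : ContDiffAt ℝ 1 V x₀)
    {f g : ℝ → E} {t₀ : ℝ} (hf : ∀ᶠ t in 𝓝 t₀, HasDerivAt f (V (f t)) t)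
    (hg : ∀ᶠ t in 𝓝 t₀, HasDerivAt g (V (g t)) t) (hf0 : f t₀ = x₀) (hg0 : g t₀ = x₀) :
    f =ᶠ[𝓝 t₀] g := by
  obtain ⟨K, s, hs, hL⟩ := hV.exists_lipschitzOnWith
  have hfc : ContinuousAt f t₀ := hf.self_of_nhds.continuousAt
  have hgc : ContinuousAt g t₀ := hg.self_of_nhds.continuousAt
  exact ODE_solution_unique_of_eventually (v := fun _ => V) (s := fun _ => s) (K := K)
    (Eventually.of_forall fun _ => hL)
    (hf.and (hfc (by rwa [hf0]))) (hg.and (hgc (by rwa [hg0]))) (hf0.trans hg0.symm)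

end Flow

/-! ### Pullbacks of the canonical one-form of a vector space -/

section Pullback
variable {E G : Type*} [NormedAddCommGroup E] [NormedSpace ℝ E] [NormedAddCommGroup G]
  [NormedSpace ℝ G]

/-- The exterior derivative of the pullback `f₂ ∘ Df₁` of the canonical one-form under `f` is the
pullback of the canonical symplectic form. -/
theorem fderiv_pullback_sub {f : G → E × (E →L[ℝ] ℝ)} {z : G} (hf : ContDiffAt ℝ 2 f z)
    (v w : G) :
    fderiv ℝ (fun y => (f y).2.comp (fderiv ℝ (fun y => (f y).1) y)) z v w -
      fderiv ℝ (fun y => (f y).2.comp (fderiv ℝ (fun y => (f y).1) y)) z w v =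
    (fderiv ℝ f z v).2 (fderiv ℝ f z w).1 - (fderiv ℝ f z w).2 (fderiv ℝ f z v).1 := by
  have hd : DifferentiableAt ℝ f z := hf.differentiableAt (by simp)
  have hf1 : ContDiffAt ℝ 2 (fun y => (f y).1) z := contDiffAt_fst.comp z hf
  have h1 : HasFDerivAt (fun y => (f y).1) ((ContinuousLinearMap.fst ℝ E (E →L[ℝ] ℝ)).comp
    (fderiv ℝ f z)) z := hd.hasFDerivAt.fst
  have h2 : HasFDerivAt (fun y => (f y).2) ((ContinuousLinearMap.snd ℝ E (E →L[ℝ] ℝ)).comp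
    (fderiv ℝ f z)) z := hd.hasFDerivAt.snd
  have h3 : HasFDerivAt (fderiv ℝ (fun y => (f y).1))
      (fderiv ℝ (fderiv ℝ (fun y => (f y).1)) z) z :=
    ((hf1.fderiv_right (m := 1) (by norm_num)).differentiableAt (by simp)).hasFDerivAt
  -- The remaining contribution is a second derivative of the first component; it is symmetric and
  -- cancels in the difference.
  have hsymm : IsSymmSndFDerivAt ℝ (fun y => (f y).1) z :=
    hf1.isSymmSndFDerivAt (by simp)
  rw [(h2.clm_comp h3).fderiv, h1.fderiv]
  simp [hsymm.eq v w]

end Pullback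

/-! ### Submanifolds with local retractions -/

section Submanifold
variable {E H : Type*} [NormedAddCommGroup E] [NormedSpace ℝ E]
    [TopologicalSpace H] {I : ModelWithCorners ℝ E H} {X : Type*} [TopologicalSpace X]
    [ChartedSpace H X]

/-- The charts on `A` make it a smooth submanifold of `X` with smooth local retractions. -/
structure HasRetractions (I : ModelWithCorners ℝ E H) (k : ℕ) (A : Set X)
    [ChartedSpace (EuclideanSpace ℝ (Fin k)) A] : Prop where
  isManifold : IsManifold (𝓡 k) ∞ A
  contMDiff_incl : ContMDiff (𝓡 k) I ∞ (Subtype.val : A → X)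
  exists_retraction : ∀ a : A, ∃ (W : Set X) (r : X → A), IsOpen W ∧ a.1 ∈ W ∧
    ContMDiffOn I (𝓡 k) ∞ r W ∧ ∀ b : A, b.1 ∈ W → r b = b

/-- Maps into a submanifold are smooth if they are smooth into the ambient manifold. -/
theorem HasRetractions.contMDiffAt_of_comp {k : ℕ} {A : Set X}
    [ChartedSpace (EuclideanSpace ℝ (Fin k)) A] (hA : HasRetractions I k A)
    {E' H' : Type*} [NormedAddCommGroup E'] [NormedSpace ℝ E'] [TopologicalSpace H']
    {J : ModelWithCorners ℝ E' H'} {Y : Type*} [TopologicalSpace Y] [ChartedSpace H' Y]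
    {g : Y → A} {y : Y} (hg : ContMDiffAt J I ∞ (fun y => (g y : X)) y) :
    ContMDiffAt J (𝓡 k) ∞ g y := by
  obtain ⟨W, r, hW, haW, hr, hrb⟩ := hA.exists_retraction (g y)
  have h1 : ContMDiffAt J (𝓡 k) ∞ (fun y => r (g y)) y :=
    (hr.contMDiffAt (hW.mem_nhds haW)).comp y hg
  refine h1.congr_of_eventuallyEq ?_
  filter_upwards [hg.continuousAt (hW.mem_nhds haW)] with y' hy'
  exact (hrb _ hy').symm

/-- A local retraction is a left inverse of the inclusion near `a`, and the chain rule turns it into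
a left inverse of the differential. -/
theorem HasRetractions.mfderiv_incl_injective {k : ℕ} {A : Set X}
    [ChartedSpace (EuclideanSpace ℝ (Fin k)) A] (hA : HasRetractions I k A) (a : A) :
    Function.Injective (mfderiv (𝓡 k) I (Subtype.val : A → X) a) := by
  obtain ⟨W, r, hW, haW, hr, hrb⟩ := hA.exists_retraction a
  have h1 : MDifferentiableAt I (𝓡 k) r (a : X) :=
    (hr.contMDiffAt (hW.mem_nhds haW)).mdifferentiableAt (by simp)
  have h2 : MDifferentiableAt (𝓡 k) I (Subtype.val : A → X) a :=
    (hA.contMDiff_incl a).mdifferentiableAt (by simp)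
  have h3 := (h1.hasMFDerivAt.comp a h2.hasMFDerivAt)
  have h4 : HasMFDerivAt (𝓡 k) (𝓡 k) (r ∘ (Subtype.val : A → X)) a
      (ContinuousLinearMap.id ℝ (TangentSpace (𝓡 k) a)) := by
    refine (hasMFDerivAt_id a).congr_of_eventuallyEq ?_
    filter_upwards [continuous_subtype_val.continuousAt (hW.mem_nhds haW)] with b hb
    exact hrb b hb
  have h5 := hasMFDerivAt_unique h3 h4
  intro v w hvw
  have := congrArg (mfderiv I (𝓡 k) r (a : X)) hvw
  have hv := congrArg (fun l => l v) h5
  have hw := congrArg (fun l => l w) h5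
  exact hv.symm.trans (this.trans hw)

theorem HasRetractions.isEmbeddedSubmanifold {k : ℕ} {A : Set X}
    [ChartedSpace (EuclideanSpace ℝ (Fin k)) A] (hA : HasRetractions I k A) :
    IsEmbeddedSubmanifold I k A :=
  ⟨hA.isManifold, hA.contMDiff_incl, hA.mfderiv_incl_injective⟩

/-- A chart of `X` at `a` in which `A` is a coordinate hyperplane. -/
structure SliceChart (I : ModelWithCorners ℝ E H) (k : ℕ) (A : Set X) (a : A) where
  /-- the chart -/
  e : OpenPartialHomeomorph X (EuclideanSpace ℝ (Fin k) × ℝ)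
  mem_source : (a : X) ∈ e.source
  contMDiffOn_e : ContMDiffOn I 𝓘(ℝ, EuclideanSpace ℝ (Fin k) × ℝ) ∞ e e.source
  contMDiffOn_symm : ContMDiffOn 𝓘(ℝ, EuclideanSpace ℝ (Fin k) × ℝ) I ∞ e.symm e.target
  mem_iff : ∀ z ∈ e.source, z ∈ A ↔ (e z).2 = 0

namespace SliceChart
variable {k : ℕ} {A : Set X} {a : A} (s : SliceChart I k A a)

theorem symm_mem {y : EuclideanSpace ℝ (Fin k)} (hy : (y, (0 : ℝ)) ∈ s.e.target) :
    s.e.symm (y, 0) ∈ A := by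
  rw [s.mem_iff _ (s.e.map_target hy), s.e.right_inv hy]

open Classical in
/-- The inverse of the chart of `A` defined by a slice chart. -/
def inv (y : EuclideanSpace ℝ (Fin k)) : A :=
  -- Off the target the value is the arbitrary base point `a`; only values on the target of `chart`
  -- matter.
  if hy : (y, (0 : ℝ)) ∈ s.e.target then ⟨s.e.symm (y, 0), s.symm_mem hy⟩ else a

theorem coe_inv {y : EuclideanSpace ℝ (Fin k)} (hy : (y, (0 : ℝ)) ∈ s.e.target) :
    (s.inv y : X) = s.e.symm (y, 0) := by
  rw [inv, dif_pos hy]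

theorem apply_eq {z : A} (hz : (z : X) ∈ s.e.source) : ((s.e z).1, (0 : ℝ)) = s.e z :=
  Prod.ext rfl ((s.mem_iff _ hz).1 z.2).symm

/-- The chart of `A` defined by a slice chart. -/
def chart : OpenPartialHomeomorph A (EuclideanSpace ℝ (Fin k)) where
  toFun z := (s.e z).1
  invFun := s.inv
  source := Subtype.val ⁻¹' s.e.source
  target := (fun y => (y, (0 : ℝ))) ⁻¹' s.e.target
  map_source' z hz := by
    rw [mem_preimage, s.apply_eq hz]
    exact s.e.map_source hz
  map_target' y hy := by
    rw [mem_preimage, s.coe_inv hy]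
    exact s.e.map_target hy
  left_inv' z hz := by
    have h := s.apply_eq hz
    refine Subtype.ext ?_
    rw [s.coe_inv (by rw [h]; exact s.e.map_source hz), h, s.e.left_inv hz]
  right_inv' y hy := by
    rw [s.coe_inv hy, s.e.right_inv hy]
  open_source := s.e.open_source.preimage continuous_subtype_val
  open_target := s.e.open_target.preimage (by fun_prop)
  continuousOn_toFun := continuous_fst.comp_continuousOn
    (s.e.continuousOn.comp continuous_subtype_val.continuousOn fun _ h => h)
  continuousOn_invFun := by
    refine IsInducing.subtypeVal.continuousOn_iff.2 (ContinuousOn.congr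
      (f := fun y => s.e.symm (y, 0)) ?_ fun y hy => s.coe_inv hy)
    exact s.e.continuousOn_symm.comp (by fun_prop) fun y hy => hy

end SliceChart

/-- The charted space structure on a subset with slice charts. -/
abbrev chartedSpaceOfSlices {k : ℕ} {A : Set X} (s : ∀ a : A, SliceChart I k A a) :
    ChartedSpace (EuclideanSpace ℝ (Fin k)) A where
  atlas := range fun a => (s a).chart
  chartAt a := (s a).chart
  mem_chart_source a := (s a).mem_source
  chart_mem_atlas a := mem_range_self a

/-- Transition maps are ambient transition maps restricted to the hyperplane of vanishing last
coordinate, and a retraction is the linear projection onto this hyperplane, read in a slice chart.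
-/
theorem hasRetractions_of_slices {k : ℕ} {A : Set X} (s : ∀ a : A, SliceChart I k A a) :
    letI := chartedSpaceOfSlices s;
    HasRetractions I k A := by
  let _ := chartedSpaceOfSlices s
  have hmfd : IsManifold (𝓡 k) ∞ A := by
    refine isManifold_of_contDiffOn (𝓡 k) ∞ A ?_
    rintro _ _ ⟨a, rfl⟩ ⟨b, rfl⟩
    have h1 : ContMDiffOn 𝓘(ℝ, EuclideanSpace ℝ (Fin k)) 𝓘(ℝ, EuclideanSpace ℝ (Fin k) × ℝ) ∞
        (fun y => (s b).e ((s a).e.symm (y, 0)))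
        ((fun y => (y, (0 : ℝ))) ⁻¹' ((s a).e.target ∩ (s a).e.symm ⁻¹' (s b).e.source)) := by
      refine (s b).contMDiffOn_e.comp ((s a).contMDiffOn_symm.comp (t := (s a).e.target)
        (contDiff_id.prodMk contDiff_const).contMDiff.contMDiffOn fun y hy => hy.1)
        fun y hy => hy.2
    have h2 := (contMDiffOn_iff_contDiffOn.1 h1).fst
    refine h2.congr_mono ?_ ?_
    · rintro y ⟨⟨hy, -⟩, -⟩
      change (y, (0 : ℝ)) ∈ (s a).e.target at hy
      change ((s b).e ((s a).inv y)).1 = _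
      rw [(s a).coe_inv hy]
    · rintro y ⟨⟨hy, hy'⟩, -⟩
      change (y, (0 : ℝ)) ∈ (s a).e.target at hy
      refine ⟨hy, ?_⟩
      have := (s a).coe_inv hy
      change ((s a).inv y : X) ∈ (s b).e.source at hy'
      rwa [this] at hy'
  have hchart : ∀ a : A, (s a).chart ∈ IsManifold.maximalAtlas (𝓡 k) ∞ A := fun a =>
    IsManifold.subset_maximalAtlas (mem_range_self a)
  refine ⟨hmfd, fun a => ?_, fun a => ?_⟩
  · have h1 : ContMDiffAt (𝓡 k) (𝓡 k) ∞ (s a).chart a :=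
      contMDiffAt_of_mem_maximalAtlas (hchart a) (s a).mem_source
    have h2 : ContMDiffAt (𝓡 k) I ∞ (fun y => (s a).e.symm (y, 0)) ((s a).chart a) := by
      have h0 : ((s a).chart a, (0 : ℝ)) ∈ (s a).e.target := (s a).chart.map_source (s a).mem_source
      refine ContMDiffAt.comp (I' := 𝓘(ℝ, EuclideanSpace ℝ (Fin k) × ℝ)) _
        ((s a).contMDiffOn_symm.contMDiffAt ((s a).e.open_target.mem_nhds h0)) ?_
      exact (contDiff_id.prodMk contDiff_const).contMDiff.contMDiffAt
    refine (h2.comp a h1).congr_of_eventuallyEq ?_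
    filter_upwards [(s a).chart.open_source.mem_nhds (s a).mem_source] with z hz
    change (z : X) = (s a).e.symm ((s a).chart z, 0)
    rw [← (s a).coe_inv ((s a).chart.map_source hz)]
    exact congrArg Subtype.val ((s a).chart.left_inv hz).symm
  -- The domain keeps only the points whose projection to the hyperplane still lies in the target of
  -- the chart.
  · refine ⟨(s a).e.source ∩ (s a).e ⁻¹' ((fun p => (p.1, (0 : ℝ))) ⁻¹' (s a).e.target),
      fun z => (s a).inv ((s a).e z).1, ?_, ⟨(s a).mem_source, ?_⟩, ?_, ?_⟩
    · exact (s a).e.continuousOn.isOpen_inter_preimage (s a).e.open_source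
        ((s a).e.open_target.preimage (by fun_prop))
    · exact (s a).chart.map_source (s a).mem_source
    · have h1 : ContMDiffOn (𝓡 k) (𝓡 k) ∞ (s a).inv (s a).chart.target :=
        contMDiffOn_symm_of_mem_maximalAtlas (hchart a)
      refine h1.comp (t := (s a).chart.target) (g := (s a).inv)
        (f := fun z => ((s a).e z).1) ?_ fun z hz => hz.2
      exact (contDiff_fst.contMDiff.comp_contMDiffOn
        ((s a).contMDiffOn_e.mono inter_subset_left))
    · intro b hb
      exact (s a).chart.left_inv hb.1

/-- A nonzero linear functional is a coordinate in a suitable linear coordinate system. -/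
theorem exists_continuousLinearEquiv_snd [FiniteDimensional ℝ E] {k : ℕ}
    (hk : Module.finrank ℝ E = k + 1) {l : E →L[ℝ] ℝ} (hl : l ≠ 0) :
    ∃ L : E ≃L[ℝ] (EuclideanSpace ℝ (Fin k) × ℝ), ∀ v, (L v).2 = l v := by
  obtain ⟨v₁, hv₁⟩ : ∃ v, l v ≠ 0 := by
    by_contra! h
    exact hl (ContinuousLinearMap.ext h)
  have hv₀ : l ((l v₁)⁻¹ • v₁) = 1 := by rw [map_smul, smul_eq_mul, inv_mul_cancel₀ hv₁]
  generalize (l v₁)⁻¹ • v₁ = v₀ at hv₀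
  have hl' : (l : E →ₗ[ℝ] ℝ) ≠ 0 := fun h => hv₁ (congrArg (fun m : E →ₗ[ℝ] ℝ => m v₁) h)
  have hker : Module.finrank ℝ (LinearMap.ker (l : E →ₗ[ℝ] ℝ)) =
      Module.finrank ℝ (EuclideanSpace ℝ (Fin k)) := by
    have := Module.Dual.finrank_ker_add_one_of_ne_zero hl'
    rw [hk] at this
    rw [finrank_euclideanSpace_fin]
    omega
  let Kq := LinearEquiv.ofFinrankEq _ _ hker
  -- Projection onto the kernel of `l` along `v₀`, which works because `l v₀ = 1`.
  let P : E →ₗ[ℝ] LinearMap.ker (l : E →ₗ[ℝ] ℝ) :=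
    (LinearMap.id - (l : E →ₗ[ℝ] ℝ).smulRight v₀).codRestrict _ fun v => by
      simp [hv₀]
  let T : E →ₗ[ℝ] EuclideanSpace ℝ (Fin k) × ℝ := ((Kq : _ →ₗ[ℝ] _).comp P).prod (l : E →ₗ[ℝ] ℝ)
  have hT : Function.Injective T := by
    refine (injective_iff_map_eq_zero T).2 fun v hv => ?_
    have h2 : l v = 0 := congrArg Prod.snd hv
    have h1 : P v = 0 := Kq.injective ((congrArg Prod.fst hv).trans (map_zero Kq).symm)
    have h3 : v - l v • v₀ = 0 := congrArg Subtype.val h1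
    rwa [h2, zero_smul, sub_zero] at h3
  refine ⟨(LinearEquiv.ofInjectiveOfFinrankEq T hT ?_).toContinuousLinearEquiv, fun v => rfl⟩
  rw [hk, Module.finrank_prod, finrank_euclideanSpace_fin, Module.finrank_self]

/-- A regular level set has slice charts. -/
theorem nonempty_sliceChart [IsManifold I ∞ X] [I.Boundaryless] [FiniteDimensional ℝ E] {k : ℕ}
    (hk : Module.finrank ℝ E = k + 1) {A : Set X} (a : A) {f : X → ℝ} {U : Set X} (hU : IsOpen U)
    (haU : a.1 ∈ U) (hA : ∀ z ∈ U, z ∈ A ↔ f z = 0) (hf : ContMDiffOn I 𝓘(ℝ, ℝ) ∞ f U)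
    (hd : fderiv ℝ (f ∘ (extChartAt I a.1).symm) (extChartAt I a.1 a) ≠ 0) :
    Nonempty (SliceChart I k A a) := by
  have hcomplete : CompleteSpace E := FiniteDimensional.complete ℝ E
  let φ : OpenPartialHomeomorph X E :=
    { toPartialEquiv := extChartAt I a.1
      open_source := isOpen_extChartAt_source a.1
      open_target := isOpen_extChartAt_target a.1
      continuousOn_toFun := continuousOn_extChartAt a.1
      continuousOn_invFun := continuousOn_extChartAt_symm a.1 }
  have hφ : ContMDiffOn I 𝓘(ℝ, E) ∞ φ φ.source := by
    have := contMDiffOn_extChartAt (I := I) (n := ∞) (x := a.1)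
    rwa [← extChartAt_source I] at this
  have hφs : ContMDiffOn 𝓘(ℝ, E) I ∞ φ.symm φ.target := contMDiffOn_extChartAt_symm a.1
  have haφ : a.1 ∈ φ.source := mem_extChartAt_source a.1
  let V : Set E := φ.target ∩ φ.symm ⁻¹' U
  have hV : IsOpen V := φ.symm.continuousOn.isOpen_inter_preimage φ.open_target hU
  have haV : φ a ∈ V := ⟨φ.map_source haφ, by rwa [mem_preimage, φ.left_inv haφ]⟩
  have hfV : ContDiffOn ℝ ∞ (f ∘ φ.symm) V :=
    contMDiffOn_iff_contDiffOn.1 (hf.comp (hφs.mono inter_subset_left) fun y hy => hy.2)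
  obtain ⟨L, hL⟩ := exists_continuousLinearEquiv_snd hk hd
  have hfd : HasFDerivAt (f ∘ φ.symm) (fderiv ℝ (f ∘ φ.symm) (φ a)) (φ a) :=
    ((hfV.contDiffAt (hV.mem_nhds haV)).differentiableAt (by simp)).hasFDerivAt
  -- Replacing the last linear coordinate by the function itself gives a map with derivative `L` at
  -- the point, so the inverse function theorem straightens the level set.
  obtain ⟨e, hae, heV, he, hes⟩ := exists_openPartialHomeomorph_contDiffOn
    (f := fun y => ((L y).1, (f ∘ φ.symm) y)) hV
    (((contDiff_fst.comp L.contDiff).contDiffOn).prodMk hfV) haV (f' := L)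
    (((hasFDerivAt_fst.comp (φ a) L.hasFDerivAt).prodMk hfd).congr_fderiv (by
      refine ContinuousLinearMap.ext fun v => Prod.ext rfl ?_
      exact (hL v).symm))
  have heC : ContDiffOn ℝ ∞ e e.source :=
    ((((contDiff_fst.comp L.contDiff).contDiffOn).prodMk hfV).mono heV).congr fun y _ => he y
  refine ⟨⟨φ.trans e, ⟨haφ, hae⟩, ?_, ?_, ?_⟩⟩
  · exact heC.contMDiffOn.comp (hφ.mono inter_subset_left) fun z hz => hz.2
  · rw [OpenPartialHomeomorph.trans_target]
    exact hφs.comp (hes.contMDiffOn.mono inter_subset_left) fun z hz => hz.2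
  · rintro z ⟨hz, hz'⟩
    have hzU : z ∈ U := by
      have h : φ.symm (φ z) ∈ U := (heV hz').2
      rwa [φ.left_inv hz] at h
    rw [hA z hzU]
    have : ((φ.trans e) z).2 = f z := by
      change (e (φ z)).2 = _
      rw [he]
      change f (φ.symm (φ z)) = _
      rw [φ.left_inv hz]
    rw [this]

end Submanifold

/-! ### Canonical coordinates on the cotangent bundle -/

section Coordinates
variable {n : ℕ} {X : Type*} [TopologicalSpace X] [ChartedSpace (EuclideanSpace ℝ (Fin n)) X]
  [IsManifold (𝓡 n) ∞ X]

variable (n X) in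
/-- The topology of the cotangent bundle. This shortcut speeds up instance search. -/
abbrev cotangentTopology : TopologicalSpace (Cotangent n X) :=
  ContinuousLinearMap.topologicalSpaceTotalSpace (RingHom.id ℝ) (EuclideanSpace ℝ (Fin n))
    (TangentSpace (𝓡 n)) ℝ (Bundle.Trivial X ℝ)

end Coordinates

attribute [local instance] cotangentTopology

section Coordinates
variable {n : ℕ} {X : Type*} [TopologicalSpace X] [ChartedSpace (EuclideanSpace ℝ (Fin n)) X]
  [IsManifold (𝓡 n) ∞ X]

/-- The canonical coordinates `(y, q)` on `T*X` defined by the chart of `X` at `x₀`. -/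
def cotChart (x₀ : X) :
    PartialEquiv (Cotangent n X)
      (EuclideanSpace ℝ (Fin n) × (EuclideanSpace ℝ (Fin n) →L[ℝ] ℝ)) :=
  extChartAt (cotangentModel n) (⟨x₀, 0⟩ : Cotangent n X)

/-- Charts of the bundle depend on the base point only, so all covectors over one point share a
chart. -/
theorem extChartAt_eq_cotChart (z : Cotangent n X) :
    extChartAt (cotangentModel n) z = cotChart z.1 := rfl

theorem hom_trivializationAt_fst (x₀ : X) (z : Cotangent n X) :
    (trivializationAt (EuclideanSpace ℝ (Fin n) →L[ℝ] ℝ)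
      (fun x : X => TangentSpace (𝓡 n) x →L[ℝ] Bundle.Trivial X ℝ x) x₀ z).1 = z.1 := rfl

theorem cotChart_source (x₀ : X) :
    (cotChart x₀ : PartialEquiv (Cotangent n X) _).source =
      {z | z.1 ∈ (extChartAt (𝓡 n) x₀).source} := by
  rw [cotChart, FiberBundle.extChartAt]
  ext z
  simp [hom_trivializationAt_source, hom_trivializationAt_fst]

theorem mem_cotChart_source {x₀ : X} {z : Cotangent n X} :
    z ∈ (cotChart x₀ : PartialEquiv (Cotangent n X) _).source ↔
      z.1 ∈ (extChartAt (𝓡 n) x₀).source := by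
  rw [cotChart_source]; rfl

theorem cotChart_target (x₀ : X) :
    (cotChart x₀ : PartialEquiv (Cotangent n X) _).target =
      (extChartAt (𝓡 n) x₀).target ×ˢ univ := by
  rw [cotChart, FiberBundle.extChartAt_target]
  simp only [hom_trivializationAt_baseSet, TangentBundle.trivializationAt_baseSet,
    Bundle.Trivial.fiberBundle_trivializationAt', Bundle.Trivial.trivialization_baseSet, inter_univ]
  have h : (extChartAt (𝓡 n) x₀).target ⊆ (extChartAt (𝓡 n) x₀).symm ⁻¹'
      (chartAt (EuclideanSpace ℝ (Fin n)) x₀).source := fun y hy => by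
    rw [mem_preimage, ← extChartAt_source (𝓡 n)]
    exact (extChartAt (𝓡 n) x₀).map_target hy
  rw [inter_eq_left.2 h]

theorem cotChart_fst (x₀ : X) (z : Cotangent n X) :
    (cotChart x₀ z).1 = extChartAt (𝓡 n) x₀ z.1 := by
  rw [cotChart, FiberBundle.extChartAt]
  simp [hom_trivializationAt_fst]

theorem cotChart_snd {x₀ : X} {z : Cotangent n X} (hz : z.1 ∈ (extChartAt (𝓡 n) x₀).source)
    (v : TangentSpace (𝓡 n) z.1) :
    (cotChart x₀ z).2 (mfderiv (𝓡 n) 𝓘(ℝ, EuclideanSpace ℝ (Fin n)) (extChartAt (𝓡 n) x₀) z.1 v) =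
      z.2 v := by
  have hz' : z.1 ∈ (chartAt (EuclideanSpace ℝ (Fin n)) x₀).source := by
    rwa [← extChartAt_source (𝓡 n)]
  rw [cotChart, FiberBundle.extChartAt]
  rw [← TangentBundle.continuousLinearMapAt_trivializationAt hz']
  simp only [PartialEquiv.coe_trans, Function.comp_apply, PartialEquiv.prod_coe,
    PartialEquiv.refl_coe, id_eq, OpenPartialHomeomorph.toFun_eq_coe, Trivialization.coe_coe,
    hom_trivializationAt_apply, ContinuousLinearMap.inCoordinates,
    Bundle.Trivial.fiberBundle_trivializationAt',
    Bundle.Trivial.continuousLinearMapAt_trivialization, ContinuousLinearMap.id_comp]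
  change z.2 ((trivializationAt (EuclideanSpace ℝ (Fin n)) (TangentSpace (𝓡 n)) x₀).symmL ℝ z.1
    ((trivializationAt (EuclideanSpace ℝ (Fin n)) (TangentSpace (𝓡 n)) x₀).continuousLinearMapAt
      ℝ z.1 v)) = z.2 v
  rw [Trivialization.symmL_continuousLinearMapAt _
    (by rwa [TangentBundle.trivializationAt_baseSet])]

theorem isOpen_cotChart_source (x₀ : X) :
    IsOpen (cotChart x₀ : PartialEquiv (Cotangent n X) _).source :=
  isOpen_extChartAt_source _

theorem isOpen_cotChart_target (x₀ : X) :
    IsOpen (cotChart x₀ : PartialEquiv (Cotangent n X) _).target :=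
  isOpen_extChartAt_target _

theorem contMDiffOn_cotChart (x₀ : X) :
    ContMDiffOn (cotangentModel n)
      𝓘(ℝ, EuclideanSpace ℝ (Fin n) × (EuclideanSpace ℝ (Fin n) →L[ℝ] ℝ)) ∞
      (cotChart x₀ : Cotangent n X → _) (cotChart x₀ : PartialEquiv (Cotangent n X) _).source := by
  have := contMDiffOn_extChartAt (I := cotangentModel n) (n := ∞) (x := (⟨x₀, 0⟩ : Cotangent n X))
  rwa [← extChartAt_source (cotangentModel n)] at this

theorem contMDiffOn_cotChart_symm (x₀ : X) :
    ContMDiffOn 𝓘(ℝ, EuclideanSpace ℝ (Fin n) × (EuclideanSpace ℝ (Fin n) →L[ℝ] ℝ))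
      (cotangentModel n) ∞
      ((cotChart x₀).symm : _ → Cotangent n X)
      (cotChart x₀ : PartialEquiv (Cotangent n X) _).target :=
  contMDiffOn_extChartAt_symm _

theorem contMDiffAt_cotChart {x₀ : X} {z : Cotangent n X}
    (hz : z.1 ∈ (extChartAt (𝓡 n) x₀).source) :
    ContMDiffAt (cotangentModel n)
      𝓘(ℝ, EuclideanSpace ℝ (Fin n) × (EuclideanSpace ℝ (Fin n) →L[ℝ] ℝ)) ∞
      (cotChart x₀ : Cotangent n X → _) z :=
  (contMDiffOn_cotChart x₀).contMDiffAt
    ((isOpen_cotChart_source x₀).mem_nhds (mem_cotChart_source.2 hz))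

/-- The differential at `x` of the chart of `X` at `x₀`. -/
def coordD (x₀ x : X) : TangentSpace (𝓡 n) x →L[ℝ] EuclideanSpace ℝ (Fin n) :=
  mfderiv (𝓡 n) 𝓘(ℝ, EuclideanSpace ℝ (Fin n)) (extChartAt (𝓡 n) x₀) x

/-- The inverse of the differential at `x` of the chart of `X` at `x₀`. -/
def coordInv (x₀ x : X) : EuclideanSpace ℝ (Fin n) →L[ℝ] TangentSpace (𝓡 n) x :=
  (trivializationAt (EuclideanSpace ℝ (Fin n)) (TangentSpace (𝓡 n)) x₀).symmL ℝ x

theorem coordD_eq {x₀ x : X} (hx : x ∈ (extChartAt (𝓡 n) x₀).source) :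
    coordD x₀ x = (trivializationAt (EuclideanSpace ℝ (Fin n))
      (TangentSpace (𝓡 n)) x₀).continuousLinearMapAt ℝ x := by
  rw [coordD, ← TangentBundle.continuousLinearMapAt_trivializationAt
    (by rwa [← extChartAt_source (𝓡 n)])]

theorem coordInv_coordD {x₀ x : X} (hx : x ∈ (extChartAt (𝓡 n) x₀).source)
    (v : TangentSpace (𝓡 n) x) : coordInv x₀ x (coordD x₀ x v) = v := by
  rw [coordD_eq hx, coordInv, Trivialization.symmL_continuousLinearMapAt _
    (by rwa [TangentBundle.trivializationAt_baseSet, ← extChartAt_source (𝓡 n)])]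

theorem coordD_coordInv {x₀ x : X} (hx : x ∈ (extChartAt (𝓡 n) x₀).source)
    (v : EuclideanSpace ℝ (Fin n)) : coordD x₀ x (coordInv x₀ x v) = v := by
  rw [coordD_eq hx, coordInv, Trivialization.continuousLinearMapAt_symmL _
    (by rwa [TangentBundle.trivializationAt_baseSet, ← extChartAt_source (𝓡 n)])]

theorem cotChart_snd_coordD {x₀ : X} {z : Cotangent n X}
    (hz : z.1 ∈ (extChartAt (𝓡 n) x₀).source) (v : TangentSpace (𝓡 n) z.1) :
    (cotChart x₀ z).2 (coordD x₀ z.1 v) = z.2 v := cotChart_snd hz v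

theorem cotChart_snd_apply {x₀ : X} {z : Cotangent n X}
    (hz : z.1 ∈ (extChartAt (𝓡 n) x₀).source) (v : EuclideanSpace ℝ (Fin n)) :
    (cotChart x₀ z).2 v = z.2 (coordInv x₀ z.1 v) := by
  rw [← cotChart_snd_coordD hz, coordD_coordInv hz]

theorem cotChart_symm_fst {x₀ : X} {y : EuclideanSpace ℝ (Fin n)}
    (hy : y ∈ (extChartAt (𝓡 n) x₀).target) (q : EuclideanSpace ℝ (Fin n) →L[ℝ] ℝ) :
    ((cotChart x₀).symm (y, q) : Cotangent n X).1 = (extChartAt (𝓡 n) x₀).symm y := by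
  have hyq : (y, q) ∈ (cotChart x₀ : PartialEquiv (Cotangent n X) _).target := by
    rw [cotChart_target]; exact ⟨hy, mem_univ _⟩
  have h1 := cotChart_fst x₀ ((cotChart x₀).symm (y, q) : Cotangent n X)
  rw [(cotChart x₀).right_inv hyq] at h1
  rw [show y = _ from h1, (extChartAt (𝓡 n) x₀).left_inv]
  · rw [← h1]
  · exact mem_cotChart_source.1 ((cotChart x₀).map_target hyq)

theorem cotChart_mk {x₀ x : X} (hx : x ∈ (extChartAt (𝓡 n) x₀).source)
    (p : TangentSpace (𝓡 n) x →L[ℝ] ℝ) :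
    cotChart x₀ (⟨x, p⟩ : Cotangent n X) = (extChartAt (𝓡 n) x₀ x, p.comp (coordInv x₀ x)) :=
  Prod.ext (cotChart_fst x₀ _) (ContinuousLinearMap.ext fun v =>
    cotChart_snd_apply (z := (⟨x, p⟩ : Cotangent n X)) hx v)

/-- The canonical one-form in canonical coordinates. -/
theorem canonicalForm_eq {x₀ : X} {z : Cotangent n X}
    (hz : z.1 ∈ (extChartAt (𝓡 n) x₀).source) (v : TangentSpace (cotangentModel n) z) :
    canonicalForm n X z v = (cotChart x₀ z).2 (mfderiv (cotangentModel n)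
      𝓘(ℝ, EuclideanSpace ℝ (Fin n) × (EuclideanSpace ℝ (Fin n) →L[ℝ] ℝ))
      (cotChart x₀ : Cotangent n X → _) z v :
        EuclideanSpace ℝ (Fin n) × (EuclideanSpace ℝ (Fin n) →L[ℝ] ℝ)).1 := by
  have h1 : HasMFDerivAt (cotangentModel n) 𝓘(ℝ, EuclideanSpace ℝ (Fin n))
      (fun z : Cotangent n X => (cotChart x₀ z).1) z _ :=
    (hasFDerivAt_fst (𝕜 := ℝ) (p := cotChart x₀ z)).hasMFDerivAt.comp z
      ((contMDiffAt_cotChart hz).mdifferentiableAt (by simp)).hasMFDerivAt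
  have hz' : z.1 ∈ (chartAt (EuclideanSpace ℝ (Fin n)) x₀).source := by
    rwa [← extChartAt_source (𝓡 n)]
  have h2 : HasMFDerivAt (cotangentModel n) 𝓘(ℝ, EuclideanSpace ℝ (Fin n))
      (fun z : Cotangent n X => extChartAt (𝓡 n) x₀ z.1) z _ :=
    (mdifferentiableAt_extChartAt (I := 𝓡 n) hz').hasMFDerivAt.comp z
      ((contMDiff_proj _ (n := ∞) z).mdifferentiableAt (by simp)).hasMFDerivAt
  have h3 := hasMFDerivAt_unique (h1.congr_of_eventuallyEq
    (Eventually.of_forall fun z => (cotChart_fst x₀ z).symm)) h2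
  have h4 := congrArg (fun l => l v) h3
  rw [canonicalForm, ContinuousLinearMap.comp_apply, ← cotChart_snd hz]
  exact congrArg _ h4.symm

/-- Points with different images are separated in `B`; points of one fibre lie in a common chart and
are separated there. Hausdorffness of T*M is needed for uniqueness of integral curves. -/
theorem t2Space_of_continuous_of_charts {Z B Y : Type*} [TopologicalSpace Z] [TopologicalSpace B]
    [T2Space B] [TopologicalSpace Y] [T2Space Y] {f : Z → B} (hf : Continuous f)
    (h : ∀ z, ∃ e : OpenPartialHomeomorph Z Y, ∀ z', f z = f z' → z' ∈ e.source) :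
    T2Space Z := by
  refine ⟨fun z z' hne => ?_⟩
  by_cases hf' : f z = f z'
  · obtain ⟨e, he⟩ := h z
    obtain ⟨U, V, hU, hV, hzU, hzV, hd⟩ :=
      t2_separation fun h' => hne (e.injOn (he z rfl) (he z' hf') h')
    exact ⟨_, _, e.continuousOn.isOpen_inter_preimage e.open_source hU,
      e.continuousOn.isOpen_inter_preimage e.open_source hV, ⟨he z rfl, hzU⟩, ⟨he z' hf', hzV⟩,
      (hd.preimage e).mono inter_subset_right inter_subset_right⟩
  · obtain ⟨U, V, hU, hV, hzU, hzV, hd⟩ := t2_separation hf'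
    exact ⟨_, _, hU.preimage hf, hV.preimage hf, hzU, hzV, hd.preimage _⟩

theorem continuous_cotangent_proj : Continuous (fun z : Cotangent n X => z.1) :=
  (contMDiff_proj (n := ∞) (IB := 𝓡 n) (F := EuclideanSpace ℝ (Fin n) →L[ℝ] ℝ) _).continuous

theorem t2Space_modelProd (E F : Type*) [TopologicalSpace E] [TopologicalSpace F] [T2Space E]
    [T2Space F] : T2Space (ModelProd E F) :=
  Prod.t2Space (X := E) (Y := F)

theorem t2Space_cotangent [T2Space X] : T2Space (Cotangent n X) := by
  have : T2Space (ModelProd (EuclideanSpace ℝ (Fin n)) (EuclideanSpace ℝ (Fin n) →L[ℝ] ℝ)) :=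
    t2Space_modelProd _ _
  refine t2Space_of_continuous_of_charts continuous_cotangent_proj fun z =>
    ⟨chartAt (ModelProd (EuclideanSpace ℝ (Fin n)) (EuclideanSpace ℝ (Fin n) →L[ℝ] ℝ)) z,
      fun z' h => ?_⟩
  rw [← extChartAt_source (cotangentModel n), extChartAt_eq_cotChart, mem_cotChart_source, ← h]
  exact mem_extChartAt_source _

end Coordinates

/-! ### Exterior derivatives of one-forms pulled back from p dx -/

theorem two_le_infty : (2 : WithTop ℕ∞) ≤ ∞ := by
  exact ENat.LEInfty.out

/-- A one-form that is the pullback of the canonical one-form of a vector space under a smooth map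
has as differential the pullback of the symplectic form. -/
theorem extd_eq_of_pullback {V E H X : Type*} [NormedAddCommGroup V] [NormedSpace ℝ V]
    [NormedAddCommGroup E] [NormedSpace ℝ E]
    [TopologicalSpace H] {I : ModelWithCorners ℝ V H} [I.Boundaryless] [TopologicalSpace X]
    [ChartedSpace H X] [IsManifold I ∞ X] {α : ∀ x : X, TangentSpace I x →L[ℝ] ℝ}
    {G : X → E × (E →L[ℝ] ℝ)} {W : Set X} (hW : IsOpen W)
    (hG : ContMDiffOn I 𝓘(ℝ, E × (E →L[ℝ] ℝ)) ∞ G W)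
    (hα : ∀ x ∈ W, ∀ v, α x v =
      (G x).2 (mfderiv I 𝓘(ℝ, E × (E →L[ℝ] ℝ)) G x v : E × (E →L[ℝ] ℝ)).1)
    {x : X} (hx : x ∈ W) (v w : TangentSpace I x) :
    extd I α x v w =
      (mfderiv I 𝓘(ℝ, E × (E →L[ℝ] ℝ)) G x v : E × (E →L[ℝ] ℝ)).2
        (mfderiv I 𝓘(ℝ, E × (E →L[ℝ] ℝ)) G x w : E × (E →L[ℝ] ℝ)).1 -
      (mfderiv I 𝓘(ℝ, E × (E →L[ℝ] ℝ)) G x w : E × (E →L[ℝ] ℝ)).2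
        (mfderiv I 𝓘(ℝ, E × (E →L[ℝ] ℝ)) G x v : E × (E →L[ℝ] ℝ)).1 := by
  let φ := extChartAt I x
  have hxφ : x ∈ φ.source := mem_extChartAt_source x
  let U : Set V := φ.target ∩ φ.symm ⁻¹' W
  have hU : IsOpen U := (continuousOn_extChartAt_symm x).isOpen_inter_preimage
    (isOpen_extChartAt_target x) hW
  have hxU : φ x ∈ U := ⟨φ.map_source hxφ, by rwa [mem_preimage, φ.left_inv hxφ]⟩
  have hf : ContDiffOn ℝ ∞ (G ∘ φ.symm) U := contMDiffOn_iff_contDiffOn.1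
    (hG.comp ((contMDiffOn_extChartAt_symm x).mono inter_subset_left) fun y hy => hy.2)
  have hcomp : ∀ y ∈ U, ∀ u : V, fderiv ℝ (G ∘ φ.symm) y u =
      mfderiv I 𝓘(ℝ, E × (E →L[ℝ] ℝ)) G (φ.symm y) (mfderiv 𝓘(ℝ, V) I φ.symm y u) := by
    intro y hy u
    have h1 : MDifferentiableAt I 𝓘(ℝ, E × (E →L[ℝ] ℝ)) G (φ.symm y) :=
      (hG.contMDiffAt (hW.mem_nhds hy.2)).mdifferentiableAt (by simp)
    have h2 : MDifferentiableAt 𝓘(ℝ, V) I φ.symm y :=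
      ((contMDiffOn_extChartAt_symm (n := ∞) x).contMDiffAt
        ((isOpen_extChartAt_target x).mem_nhds hy.1)).mdifferentiableAt (by simp)
    have h3 : HasMFDerivAt 𝓘(ℝ, V) 𝓘(ℝ, E × (E →L[ℝ] ℝ)) (G ∘ φ.symm) y _ :=
      h1.hasMFDerivAt.comp y h2.hasMFDerivAt
    rw [← mfderiv_eq_fderiv, h3.mfderiv]
    rfl
  -- In the chart the one-form is the pullback of p dx under the coordinate expression of `G`, which
  -- reduces the claim to `fderiv_pullback_sub`. Both sides get differentiated, so equality is
  -- needed on a neighbourhood.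
  have hαhat : (fun y => (α (φ.symm y)).comp (mfderiv 𝓘(ℝ, V) I φ.symm y) : V → (V →L[ℝ] ℝ))
      =ᶠ[𝓝 (φ x)] fun y => ((G ∘ φ.symm) y).2.comp
        (fderiv ℝ (fun y => ((G ∘ φ.symm) y).1) y) := by
    filter_upwards [hU.mem_nhds hxU] with y hy
    refine ContinuousLinearMap.ext fun u => ?_
    have hd : DifferentiableAt ℝ (G ∘ φ.symm) y :=
      (hf.contDiffAt (hU.mem_nhds hy)).differentiableAt (by simp)
    have := hα _ hy.2 (mfderiv 𝓘(ℝ, V) I φ.symm y u)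
    rw [← hcomp y hy u] at this
    rw [hd.hasFDerivAt.fst.fderiv]
    exact this
  have hv : ∀ v : TangentSpace I x, fderiv ℝ (G ∘ φ.symm) (φ x)
      (mfderiv I 𝓘(ℝ, V) φ x v) = mfderiv I 𝓘(ℝ, E × (E →L[ℝ] ℝ)) G x v := by
    intro v
    have h1 : MDifferentiableAt I 𝓘(ℝ, V) φ x :=
      mdifferentiableAt_extChartAt (mem_chart_source _ x)
    have h2 : HasFDerivAt (G ∘ φ.symm) _ (φ x) :=
      ((hf.contDiffAt (hU.mem_nhds hxU)).differentiableAt (by simp)).hasFDerivAt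
    have h3 := h2.hasMFDerivAt.comp x h1.hasMFDerivAt
    have h4 : HasMFDerivAt I 𝓘(ℝ, E × (E →L[ℝ] ℝ)) G x _ := h3.congr_of_eventuallyEq (by
      filter_upwards [extChartAt_source_mem_nhds (I := I) x] with y hy
      change _ = G (φ.symm (φ y))
      rw [φ.left_inv hy])
    rw [h4.mfderiv]
    rfl
  have key := fderiv_pullback_sub (f := G ∘ φ.symm) (z := φ x)
    ((hf.contDiffAt (hU.mem_nhds hxU)).of_le (m := 2) two_le_infty)
    (mfderiv I 𝓘(ℝ, V) φ x v) (mfderiv I 𝓘(ℝ, V) φ x w)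
  rw [← hαhat.fderiv_eq] at key
  rw [← hv v, ← hv w]
  exact key

/-- The chart `cotChart x₀` pulls p dx back to the canonical form, so `extd_eq_of_pullback` applies
to it. This also fixes the sign: ω is dp ∧ dx, with the momentum part of the first argument counted
positively. -/
theorem extd_canonicalForm {n : ℕ} {X : Type*} [TopologicalSpace X]
    [ChartedSpace (EuclideanSpace ℝ (Fin n)) X]
    [IsManifold (𝓡 n) ∞ X] {x₀ : X} {z : Cotangent n X}
    (hz : z.1 ∈ (extChartAt (𝓡 n) x₀).source) (v w : TangentSpace (cotangentModel n) z) :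
    extd (cotangentModel n) (canonicalForm n X) z v w =
      (mfderiv (cotangentModel n)
        𝓘(ℝ, EuclideanSpace ℝ (Fin n) × (EuclideanSpace ℝ (Fin n) →L[ℝ] ℝ))
        (cotChart x₀ : Cotangent n X → _) z v :
          EuclideanSpace ℝ (Fin n) × (EuclideanSpace ℝ (Fin n) →L[ℝ] ℝ)).2
      (mfderiv (cotangentModel n)
        𝓘(ℝ, EuclideanSpace ℝ (Fin n) × (EuclideanSpace ℝ (Fin n) →L[ℝ] ℝ))
        (cotChart x₀ : Cotangent n X → _) z w :
          EuclideanSpace ℝ (Fin n) × (EuclideanSpace ℝ (Fin n) →L[ℝ] ℝ)).1 -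
      (mfderiv (cotangentModel n)
        𝓘(ℝ, EuclideanSpace ℝ (Fin n) × (EuclideanSpace ℝ (Fin n) →L[ℝ] ℝ))
        (cotChart x₀ : Cotangent n X → _) z w :
          EuclideanSpace ℝ (Fin n) × (EuclideanSpace ℝ (Fin n) →L[ℝ] ℝ)).2
      (mfderiv (cotangentModel n)
        𝓘(ℝ, EuclideanSpace ℝ (Fin n) × (EuclideanSpace ℝ (Fin n) →L[ℝ] ℝ))
        (cotChart x₀ : Cotangent n X → _) z v :
          EuclideanSpace ℝ (Fin n) × (EuclideanSpace ℝ (Fin n) →L[ℝ] ℝ)).1 :=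
  extd_eq_of_pullback (isOpen_cotChart_source x₀) (contMDiffOn_cotChart x₀)
    (fun _ hx v => canonicalForm_eq (mem_cotChart_source.1 hx) v) (mem_cotChart_source.2 hz) v w

/-! ### The geodesic Hamiltonian in coordinates -/

section LocalHamiltonian
set_option maxSynthPendingDepth 3
set_option linter.unusedSectionVars false
variable {E : Type*} [NormedAddCommGroup E] [NormedSpace ℝ E] [FiniteDimensional ℝ E]

/-- A nondegenerate bilinear form defines an isomorphism with the dual space. -/
theorem exists_equiv_dual {b : E →L[ℝ] E →L[ℝ] ℝ} (hb : ∀ v, (∀ w, b v w = 0) → v = 0) :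
    ∃ e : E ≃L[ℝ] (E →L[ℝ] ℝ), (e : E →L[ℝ] E →L[ℝ] ℝ) = b := by
  have hfin : Module.finrank ℝ E = Module.finrank ℝ (E →L[ℝ] ℝ) := by
    rw [← Subspace.dual_finrank_eq (K := ℝ) (V := E)]
    exact LinearEquiv.finrank_eq (LinearMap.toContinuousLinearMap : (E →ₗ[ℝ] ℝ) ≃ₗ[ℝ] _)
  have hinj : Function.Injective (b : E →ₗ[ℝ] E →L[ℝ] ℝ) :=
    (injective_iff_map_eq_zero _).2 fun v hv => hb v fun w =>
      congrArg (fun l : E →L[ℝ] ℝ => l w) hv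
  exact ⟨(LinearEquiv.ofInjectiveOfFinrankEq _ hinj hfin).toContinuousLinearEquiv, rfl⟩

/-- A smooth semi-Riemannian metric on an open subset of a vector space. -/
structure IsMetricOn (g : E → E →L[ℝ] E →L[ℝ] ℝ) (Ω : Set E) : Prop where
  isOpen : IsOpen Ω
  contDiffOn : ContDiffOn ℝ ∞ g Ω
  symm : ∀ y ∈ Ω, ∀ v w, g y v w = g y w v
  nondegenerate : ∀ y ∈ Ω, ∀ v, (∀ w, g y v w = 0) → v = 0

/-- Raising an index. -/
def raise (g : E → E →L[ℝ] E →L[ℝ] ℝ) (z : E × (E →L[ℝ] ℝ)) : E := (g z.1).inverse z.2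

/-- The geodesic Hamiltonian. -/
def ham (g : E → E →L[ℝ] E →L[ℝ] ℝ) (z : E × (E →L[ℝ] ℝ)) : ℝ := (1 / 2) * z.2 (raise g z)

/-- The Hamiltonian vector field of the geodesic Hamiltonian. -/
def hamField (g : E → E →L[ℝ] E →L[ℝ] ℝ) (z : E × (E →L[ℝ] ℝ)) : E × (E →L[ℝ] ℝ) :=
  (raise g z, (1 / 2 : ℝ) • (ContinuousLinearMap.apply ℝ ℝ (raise g z)).comp
    ((ContinuousLinearMap.apply ℝ (E →L[ℝ] ℝ) (raise g z)).comp (fderiv ℝ g z.1)))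

theorem hamField_fst (g : E → E →L[ℝ] E →L[ℝ] ℝ) (z : E × (E →L[ℝ] ℝ)) :
    (hamField g z).1 = raise g z := rfl

theorem hamField_snd (g : E → E →L[ℝ] E →L[ℝ] ℝ) (z : E × (E →L[ℝ] ℝ)) (a : E) :
    (hamField g z).2 a = (1 / 2) * fderiv ℝ g z.1 a (raise g z) (raise g z) := rfl

local instance : NormedSpace ℝ (E × (E →L[ℝ] ℝ)) := Prod.normedSpace

local instance : NormedSpace ℝ (E →L[ℝ] ℝ) := ContinuousLinearMap.toNormedSpace

namespace IsMetricOn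
variable {g : E → E →L[ℝ] E →L[ℝ] ℝ} {Ω : Set E} (hg : IsMetricOn g Ω)
include hg

theorem lower_raise {z : E × (E →L[ℝ] ℝ)} (hz : z.1 ∈ Ω) : g z.1 (raise g z) = z.2 := by
  obtain ⟨e, he⟩ := exists_equiv_dual (hg.nondegenerate z.1 hz)
  rw [raise, ← he, ContinuousLinearMap.inverse_equiv]
  exact e.apply_symm_apply _

theorem raise_lower {y : E} (hy : y ∈ Ω) (v : E) : raise g (y, g y v) = v := by
  obtain ⟨e, he⟩ := exists_equiv_dual (hg.nondegenerate y hy)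
  rw [raise, ← he, ContinuousLinearMap.inverse_equiv]
  exact e.symm_apply_apply _

theorem apply_raise {z : E × (E →L[ℝ] ℝ)} (hz : z.1 ∈ Ω) (w : E) :
    g z.1 (raise g z) w = z.2 w := by rw [hg.lower_raise hz]

theorem contDiffOn_raise : ContDiffOn ℝ ∞ (raise g) (Ω ×ˢ univ) := by
  have := FiniteDimensional.complete ℝ E
  intro z hz
  obtain ⟨e, he⟩ := exists_equiv_dual (hg.nondegenerate z.1 hz.1)
  have h1 : ContDiffAt ℝ ∞ (fun z : E × (E →L[ℝ] ℝ) => g z.1) z :=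
    (hg.contDiffOn.contDiffAt (hg.isOpen.mem_nhds hz.1)).comp z contDiffAt_fst
  have h2 : ContDiffAt ℝ ∞ ContinuousLinearMap.inverse (g z.1) := by
    rw [← he]; exact contDiffAt_map_inverse e
  exact ((h2.comp z h1).clm_apply contDiffAt_snd).contDiffWithinAt

theorem contDiffOn_hamField : ContDiffOn ℝ ∞ (hamField g) (Ω ×ˢ univ) := by
  have hr := hg.contDiffOn_raise
  have hd : ContDiffOn ℝ ∞ (fun z : E × (E →L[ℝ] ℝ) => fderiv ℝ g z.1) (Ω ×ˢ univ) :=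
    (hg.contDiffOn.fderiv_of_isOpen hg.isOpen (m := ∞) (by simp)).comp contDiffOn_fst
      fun z hz => hz.1
  refine hr.prodMk (contDiffOn_clm_apply.2 fun a => ?_)
  exact contDiffOn_const.mul (((hd.clm_apply contDiffOn_const).clm_apply hr).clm_apply hr)

theorem isOpen_domain : IsOpen (Ω ×ˢ (univ : Set (E →L[ℝ] ℝ))) := hg.isOpen.prod isOpen_univ

theorem contDiffOn_ham : ContDiffOn ℝ ∞ (ham g) (Ω ×ˢ univ) :=
  contDiffOn_const.mul (contDiffOn_snd.clm_apply hg.contDiffOn_raise)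

theorem hasFDerivAt_ham {z : E × (E →L[ℝ] ℝ)} (hz : z.1 ∈ Ω) :
    HasFDerivAt (ham g) (fderiv ℝ (ham g) z) z :=
  ((hg.contDiffOn_ham.contDiffAt (hg.isOpen_domain.mem_nhds ⟨hz, mem_univ _⟩)).differentiableAt
    (by simp)).hasFDerivAt

/-- Differentiating the identity `g z.1 (raise g z) = z.2` replaces a formula for the derivative of
the inverse metric; pairing the result with `raise g z` gives -∂H/∂x = ½ ∂g(p♯, p♯). -/
theorem fderiv_ham {z : E × (E →L[ℝ] ℝ)} (hz : z.1 ∈ Ω) (w : E × (E →L[ℝ] ℝ)) :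
    fderiv ℝ (ham g) z w = w.2 (hamField g z).1 - (hamField g z).2 w.1 := by
  have hzd := hg.isOpen_domain.mem_nhds (show z ∈ _ from ⟨hz, mem_univ _⟩)
  have hr : HasFDerivAt (raise g) (fderiv ℝ (raise g) z) z :=
    ((hg.contDiffOn_raise.contDiffAt hzd).differentiableAt (by simp)).hasFDerivAt
  have hgd : HasFDerivAt g (fderiv ℝ g z.1) z.1 :=
    ((hg.contDiffOn.contDiffAt (hg.isOpen.mem_nhds hz)).differentiableAt (by simp)).hasFDerivAt
  have h1 : HasFDerivAt (fun z : E × (E →L[ℝ] ℝ) => g z.1 (raise g z)) _ z :=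
    (hgd.comp z hasFDerivAt_fst).clm_apply hr
  have h2 : HasFDerivAt (fun z : E × (E →L[ℝ] ℝ) => g z.1 (raise g z))
      (ContinuousLinearMap.snd ℝ E (E →L[ℝ] ℝ)) z :=
    hasFDerivAt_snd.congr_of_eventuallyEq (by
      filter_upwards [hzd] with z' hz'
      exact hg.lower_raise hz'.1)
  have h3 := congrArg (fun l : E × (E →L[ℝ] ℝ) →L[ℝ] (E →L[ℝ] ℝ) => l w (raise g z))
    (h1.unique h2)
  have h4 : HasFDerivAt (ham g) _ z := (hasFDerivAt_snd.clm_apply hr).const_mul (1 / 2 : ℝ)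
  have h5 : g z.1 (fderiv ℝ (raise g) z w) (raise g z) = z.2 (fderiv ℝ (raise g) z w) := by
    rw [hg.symm _ hz, hg.apply_raise hz]
  rw [h4.fderiv, hamField_snd, hamField_fst]
  simp at h3 ⊢
  rw [h5] at h3
  linarith

/-- Hamilton's equations: the Hamiltonian vector field is determined by `X ⌟ ω + dH = 0`. -/
theorem eq_hamField_iff {z : E × (E →L[ℝ] ℝ)} (hz : z.1 ∈ Ω) (v : E × (E →L[ℝ] ℝ)) :
    (∀ w : E × (E →L[ℝ] ℝ), v.2 w.1 - w.2 v.1 + fderiv ℝ (ham g) z w = 0) ↔ v = hamField g z := by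
  constructor
  · intro h
    refine Prod.ext ?_ (ContinuousLinearMap.ext fun a => ?_)
    · refine eq_of_sub_eq_zero (hg.nondegenerate z.1 hz _ fun w => ?_)
      have := h (0, g z.1 w)
      rw [hg.fderiv_ham hz] at this
      simp only [map_zero] at this
      rw [hg.symm _ hz, map_sub]
      linarith
    · have := h (a, 0)
      rw [hg.fderiv_ham hz] at this
      simp only [zero_apply] at this
      linarith
  · rintro rfl w
    rw [hg.fderiv_ham hz]
    ring

/-- This is θ(X_G) = 2H. It vanishes on null covectors, which makes θ insensitive there to
displacement along the flow. -/
theorem apply_hamField_fst (z : E × (E →L[ℝ] ℝ)) : z.2 (hamField g z).1 = 2 * ham g z := by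
  rw [ham, hamField_fst]; ring

theorem fderiv_ham_hamField {z : E × (E →L[ℝ] ℝ)} (hz : z.1 ∈ Ω) :
    fderiv ℝ (ham g) z (hamField g z) = 0 := by
  rw [hg.fderiv_ham hz, sub_self]

theorem raise_smul (y : E) (q : E →L[ℝ] ℝ) (a : ℝ) : raise g (y, a • q) = a • raise g (y, q) :=
  map_smul (g y).inverse a q

/-- Raising an index is linear and the momentum part is quadratic in the raised vector, so a
covector scaled by `a` traces the same geodesic `a` times as fast. -/
theorem hamField_smul (y : E) (q : E →L[ℝ] ℝ) (a : ℝ) :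
    hamField g (y, a • q) = (a • (hamField g (y, q)).1, a ^ 2 • (hamField g (y, q)).2) := by
  refine Prod.ext (hg.raise_smul y q a) (ContinuousLinearMap.ext fun b => ?_)
  simp only [hamField_snd, hg.raise_smul, map_smul, smul_apply, smul_eq_mul]
  ring

theorem hasDerivAt_ham {c : ℝ → E × (E →L[ℝ] ℝ)} {t : ℝ} (ht : (c t).1 ∈ Ω)
    (hc : HasDerivAt c (hamField g (c t)) t) : HasDerivAt (fun s => ham g (c s)) 0 t := by
  have := (hg.hasFDerivAt_ham ht).comp_hasDerivAt t hc
  rwa [hg.fderiv_ham_hamField ht] at this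

set_option maxHeartbeats 1600000 in
/-- The flow of the geodesic spray preserves the canonical one-form on vectors that annihilate the
differential of the Hamiltonian. -/
theorem canonical_flow {ε : ℝ} {U : Set (E × (E →L[ℝ] ℝ))} (hU : IsOpen U)
    {F : ℝ × (E × (E →L[ℝ] ℝ)) → E × (E →L[ℝ] ℝ)}
    (hF : ContDiffOn ℝ ∞ F (Ioo (-ε) ε ×ˢ U)) (hF0 : ∀ z ∈ U, F (0, z) = z)
    (hFd : ∀ z ∈ U, ∀ t ∈ Ioo (-ε) ε, F (t, z) ∈ Ω ×ˢ univ ∧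
      HasDerivAt (fun s => F (s, z)) (hamField g (F (t, z))) t)
    {z : E × (E →L[ℝ] ℝ)} (hz : z ∈ U) {ζ : E × (E →L[ℝ] ℝ)} (hζ : fderiv ℝ (ham g) z ζ = 0)
    {t : ℝ} (ht : t ∈ Ioo (-ε) ε) :
    (F (t, z)).2 (fderiv ℝ (fun z => F (t, z)) z ζ).1 = z.2 ζ.1 := by
  have h0 : (0 : ℝ) ∈ Ioo (-ε) ε := ⟨by linarith [ht.1, ht.2], by linarith [ht.1, ht.2]⟩
  have hnhds : ∀ s ∈ Ioo (-ε) ε, ∀ z' ∈ U, Ioo (-ε) ε ×ˢ U ∈ 𝓝 (s, z') := fun s hs z' hz' =>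
    (isOpen_Ioo.prod hU).mem_nhds ⟨hs, hz'⟩
  have hFdiff : ∀ s ∈ Ioo (-ε) ε, ∀ z' ∈ U, HasFDerivAt F (fderiv ℝ F (s, z')) (s, z') :=
    fun s hs z' hz' =>
      ((hF.contDiffAt (hnhds s hs z' hz')).differentiableAt (by simp)).hasFDerivAt
  have hdt : ∀ s ∈ Ioo (-ε) ε, ∀ z' ∈ U, fderiv ℝ F (s, z') (1, 0) = hamField g (F (s, z')) := by
    intro s hs z' hz'
    have h1 : HasDerivAt (fun s : ℝ => (s, z')) ((1 : ℝ), (0 : E × (E →L[ℝ] ℝ))) s :=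
      (hasDerivAt_id s).prodMk (hasDerivAt_const s z')
    exact ((hFdiff s hs z' hz').comp_hasDerivAt s h1).unique (hFd z' hz' s hs).2
  have hdz : ∀ s ∈ Ioo (-ε) ε, HasFDerivAt (fun z => F (s, z))
      ((fderiv ℝ F (s, z)).comp (ContinuousLinearMap.inr ℝ ℝ _)) z := fun s hs =>
    (hFdiff s hs z hz).comp z (hasFDerivAt_prodMk_right s z)
  have hHF : ∀ s ∈ Ioo (-ε) ε, ∀ z' ∈ U, ham g (F (s, z')) = ham g z' := by
    intro s hs z' hz'
    have h1 : ∀ r ∈ Ioo (-ε) ε, HasDerivAt (fun r => ham g (F (r, z'))) 0 r := fun r hr =>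
      hg.hasDerivAt_ham (hFd z' hz' r hr).1.1 (hFd z' hz' r hr).2
    have h2 := (convex_Ioo (-ε) ε).is_const_of_fderivWithin_eq_zero (𝕜 := ℝ)
      (f := fun r => ham g (F (r, z')))
      (fun r hr => (h1 r hr).differentiableAt.differentiableWithinAt)
      (fun r hr => by
        rw [((h1 r hr).hasFDerivAt.hasFDerivWithinAt).fderivWithin
          (isOpen_Ioo.uniqueDiffWithinAt hr)]
        ext; simp) hs h0
    simpa [hF0 z' hz'] using h2
  -- The pullback of p dx under the flow, as a one-form on time times phase space. It suffices that
  -- its value on `(0, ζ)` is constant in time.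
  let β : ℝ × (E × (E →L[ℝ] ℝ)) → (ℝ × (E × (E →L[ℝ] ℝ)) →L[ℝ] ℝ) := fun y =>
    (F y).2.comp (fderiv ℝ (fun y => (F y).1) y)
  have hβ : ∀ s ∈ Ioo (-ε) ε, ∀ z' ∈ U, ∀ w, β (s, z') w =
      (F (s, z')).2 (fderiv ℝ F (s, z') w).1 := fun s hs z' hz' w => by
    change (F (s, z')).2 (fderiv ℝ (fun y => (F y).1) (s, z') w) = _
    rw [(hFdiff s hs z' hz').fst.fderiv]; rfl
  have hβd : ∀ s ∈ Ioo (-ε) ε, HasFDerivAt β (fderiv ℝ β (s, z)) (s, z) := fun s hs => by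
    have h1 := hF.contDiffAt (hnhds s hs z hz)
    have h2 : ContDiffAt ℝ ∞ (fun y => fderiv ℝ (fun y => (F y).1) y) (s, z) :=
      (contDiffAt_fst.comp _ h1).fderiv_right (m := ∞) (by simp)
    have h3 : ContDiffAt ℝ ∞ (fun y => (F y).2) (s, z) := contDiffAt_snd.comp _ h1
    exact ((h3.clm_comp h2).differentiableAt (by simp)).hasFDerivAt
  -- Cartan's formula: the time derivative of `β (s, z) (0, ζ)` is dβ of the time direction and ζ,
  -- plus the derivative along ζ of `β (s, z) (1, 0)`. With W the image of ζ, the first term is ω(X,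
  -- W) = -dH(W), and the second is the derivative of 2H. Both vanish because H is conserved and
  -- dH(ζ) = 0.
  have hu : ∀ s ∈ Ioo (-ε) ε, HasDerivAt (fun s => β (s, z) (0, ζ)) 0 s := by
    intro s hs
    have h1 : HasDerivAt (fun s : ℝ => (s, z)) ((1 : ℝ), (0 : E × (E →L[ℝ] ℝ))) s :=
      (hasDerivAt_id s).prodMk (hasDerivAt_const s z)
    have h2 : HasDerivAt (fun s => β (s, z) (0, ζ)) (fderiv ℝ β (s, z) (1, 0) (0, ζ)) s := by
      simpa using ((hβd s hs).comp_hasDerivAt s h1).clm_apply (hasDerivAt_const s ((0 : ℝ), ζ))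
    have h3 := fderiv_pullback_sub ((hF.contDiffAt (hnhds s hs z hz)).of_le two_le_infty)
      ((1 : ℝ), (0 : E × (E →L[ℝ] ℝ))) (0, ζ)
    have hW : fderiv ℝ (ham g) (F (s, z)) (fderiv ℝ F (s, z) (0, ζ)) = 0 := by
      have h4 := (hg.hasFDerivAt_ham (hFd z hz s hs).1.1).comp z (hdz s hs)
      have h5 : HasFDerivAt (fun z => ham g (F (s, z))) (fderiv ℝ (ham g) z) z := by
        refine (hg.hasFDerivAt_ham ?_).congr_of_eventuallyEq ?_
        · have := (hFd z hz 0 h0).1.1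
          rwa [hF0 z hz] at this
        · filter_upwards [hU.mem_nhds hz] with z' hz'
          exact hHF s hs z' hz'
      have h6 := congrArg (fun l : E × (E →L[ℝ] ℝ) →L[ℝ] ℝ => l ζ) (h4.unique h5)
      exact h6.trans hζ
    rw [hdt s hs z hz] at h3
    have hω : (hamField g (F (s, z))).2 (fderiv ℝ F (s, z) (0, ζ)).1 -
        (fderiv ℝ F (s, z) (0, ζ)).2 (hamField g (F (s, z))).1 = 0 := by
      have := hg.fderiv_ham (hFd z hz s hs).1.1 (fderiv ℝ F (s, z) (0, ζ))
      rw [hW] at this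
      linarith
    have hd : fderiv ℝ β (s, z) (0, ζ) (1, 0) = 0 := by
      have h7 : HasFDerivAt (fun z => β (s, z) (1, 0))
          (((ContinuousLinearMap.apply ℝ ℝ ((1 : ℝ), (0 : E × (E →L[ℝ] ℝ)))).comp
            (fderiv ℝ β (s, z))).comp (ContinuousLinearMap.inr ℝ ℝ _)) z :=
        (((ContinuousLinearMap.apply ℝ ℝ ((1 : ℝ), (0 : E × (E →L[ℝ] ℝ)))).hasFDerivAt.comp
          (s, z) (hβd s hs))).comp z (hasFDerivAt_prodMk_right s z)
      have h8 : HasFDerivAt (fun z => β (s, z) (1, 0)) ((2 : ℝ) • fderiv ℝ (ham g) z) z := by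
        refine ((hg.hasFDerivAt_ham ?_).const_mul 2).congr_of_eventuallyEq ?_
        · have := (hFd z hz 0 h0).1.1
          rwa [hF0 z hz] at this
        · filter_upwards [hU.mem_nhds hz] with z' hz'
          rw [hβ s hs z' hz', hdt s hs z' hz', hg.apply_hamField_fst, hHF s hs z' hz']
      have h9 := congrArg (fun l : E × (E →L[ℝ] ℝ) →L[ℝ] ℝ => l ζ) (h7.unique h8)
      refine h9.trans ?_
      change (2 : ℝ) • fderiv ℝ (ham g) z ζ = 0
      rw [hζ, smul_zero]
    rw [hω, sub_eq_zero] at h3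
    have h10 : fderiv ℝ β (s, z) (1, 0) (0, ζ) = 0 := h3.trans hd
    rwa [h10] at h2
  have hconst := (convex_Ioo (-ε) ε).is_const_of_fderivWithin_eq_zero (𝕜 := ℝ)
    (f := fun s => β (s, z) (0, ζ))
    (fun r hr => (hu r hr).differentiableAt.differentiableWithinAt)
    (fun r hr => by
      rw [((hu r hr).hasFDerivAt.hasFDerivWithinAt).fderivWithin
        (isOpen_Ioo.uniqueDiffWithinAt hr)]
      ext; simp) ht h0
  simp only [hβ t ht z hz, hβ 0 h0 z hz, hF0 z hz] at hconst
  have h11 : (fderiv ℝ F (0, z)).comp (ContinuousLinearMap.inr ℝ ℝ _) =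
      ContinuousLinearMap.id ℝ (E × (E →L[ℝ] ℝ)) :=
    (hdz 0 h0).unique ((hasFDerivAt_id z).congr_of_eventuallyEq (by
      filter_upwards [hU.mem_nhds hz] with z' hz'
      exact hF0 z' hz'))
  have h12 : fderiv ℝ F (0, z) (0, ζ) = ζ := congrArg (fun l => l ζ) h11
  rw [(hdz t ht).fderiv, ← show (fderiv ℝ F (0, z) (0, ζ)).1 = ζ.1 by rw [h12], ← hconst]
  rfl

end IsMetricOn
end LocalHamiltonian

theorem hasDerivAt_of_hasMFDerivAt {F : Type*} [NormedAddCommGroup F] [NormedSpace ℝ F]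
    {f : ℝ → F} {t : ℝ} {L : ℝ →L[ℝ] F} (h : HasMFDerivAt 𝓘(ℝ, ℝ) 𝓘(ℝ, F) f t L) :
    HasDerivAt f (L 1) t := by
  have h2 : HasFDerivAt f L t := hasMFDerivAt_iff_hasFDerivAt.1 h
  exact h2.hasDerivAt

/-! ### The geodesic spray in canonical coordinates -/

section CoordFields
variable {n : ℕ} {X : Type*} [TopologicalSpace X] [ChartedSpace (EuclideanSpace ℝ (Fin n)) X]
  [IsManifold (𝓡 n) ∞ X]

/-- The coordinate vector fields of a chart are smooth. -/
theorem contMDiffOn_coordInv (x₀ : X) (v : EuclideanSpace ℝ (Fin n)) :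
    ContMDiffOn (𝓡 n) (𝓡 n).tangent ∞
      (fun x => (⟨x, coordInv x₀ x v⟩ : TangentBundle (𝓡 n) X)) (extChartAt (𝓡 n) x₀).source := by
  let e := trivializationAt (EuclideanSpace ℝ (Fin n)) (TangentSpace (𝓡 n) : X → Type _) x₀
  have he : e.baseSet = (extChartAt (𝓡 n) x₀).source := by
    rw [TangentBundle.trivializationAt_baseSet, extChartAt_source]
  have h1 : ContMDiffOn ((𝓡 n).prod 𝓘(ℝ, EuclideanSpace ℝ (Fin n))) (𝓡 n).tangent ∞
      e.toOpenPartialHomeomorph.symm e.target := e.contMDiffOn_symm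
  have h2 : ContMDiff (𝓡 n) ((𝓡 n).prod 𝓘(ℝ, EuclideanSpace ℝ (Fin n))) ∞
      (fun x : X => (x, v)) := contMDiff_id.prodMk contMDiff_const
  refine (h1.comp (h2.contMDiffOn (s := e.baseSet)) fun x hx => ?_).congr_mono ?_ he.ge
  · rw [mem_preimage, e.mem_target]; exact hx
  · intro x hx
    rw [← he] at hx
    exact (congrArg (TotalSpace.mk x) (e.symmL_apply hx v)).trans (e.mk_symm hx v)

/-- The isomorphism of tangent spaces defined by a chart. -/
theorem coordD_injective {x₀ x : X} (hx : x ∈ (extChartAt (𝓡 n) x₀).source) :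
    Function.Injective (coordD (n := n) x₀ x) :=
  fun v w h => by
  rw [← coordInv_coordD hx v, ← coordInv_coordD hx w, h]

theorem mfderiv_cotChart_surjective {x₀ : X} {z : Cotangent n X}
    (hz : z.1 ∈ (extChartAt (𝓡 n) x₀).source) :
    Function.Surjective (mfderiv (cotangentModel n)
      𝓘(ℝ, EuclideanSpace ℝ (Fin n) × (EuclideanSpace ℝ (Fin n) →L[ℝ] ℝ))
      (cotChart x₀ : Cotangent n X → _) z) :=
  (isInvertible_mfderiv_extChartAt (mem_cotChart_source.2 hz)).bijective.2

end CoordFields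

section
variable {M : Type*} [TopologicalSpace M] [ChartedSpace (EuclideanSpace ℝ (Fin 4)) M]
  [IsManifold (𝓡 4) ∞ M] (𝓜 : Spacetime M)

namespace Spacetime

theorem nondegenerate (x : M) (v : TangentSpace (𝓡 4) x)
    (hv : ∀ w : TangentSpace (𝓡 4) x, 𝓜.g x v w = 0) : v = 0 := by
  obtain ⟨u, hu, hpos⟩ := 𝓜.lorentzian x
  by_contra hne
  have h1 : 0 < 𝓜.g x v v := hpos v hne (by rw [𝓜.symm]; exact hv u)
  rw [hv v] at h1
  exact lt_irrefl _ h1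

theorem exists_equiv (x : M) : ∃ e : TangentSpace (𝓡 4) x ≃L[ℝ] (TangentSpace (𝓡 4) x →L[ℝ] ℝ),
    (e : TangentSpace (𝓡 4) x →L[ℝ] TangentSpace (𝓡 4) x →L[ℝ] ℝ) = 𝓜.g x :=
  exists_equiv_dual (E := EuclideanSpace ℝ (Fin 4)) (𝓜.nondegenerate x)

theorem g_sharp (x : M) (p : TangentSpace (𝓡 4) x →L[ℝ] ℝ) : 𝓜.g x (𝓜.sharp x p) = p := by
  obtain ⟨e, he⟩ := 𝓜.exists_equiv x
  rw [sharp, ← he, ContinuousLinearMap.inverse_equiv]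
  exact e.apply_symm_apply _

theorem sharp_g (x : M) (v : TangentSpace (𝓡 4) x) : 𝓜.sharp x (𝓜.g x v) = v := by
  obtain ⟨e, he⟩ := 𝓜.exists_equiv x
  rw [sharp, ← he, ContinuousLinearMap.inverse_equiv]
  exact e.symm_apply_apply _

theorem g_sharp_apply (x : M) (p : TangentSpace (𝓡 4) x →L[ℝ] ℝ) (w : TangentSpace (𝓡 4) x) :
    𝓜.g x (𝓜.sharp x p) w = p w := by rw [g_sharp]

theorem hamiltonian_eq (z : Cotangent 4 M) :
    𝓜.hamiltonian z = (1 / 2) * 𝓜.g z.1 (𝓜.sharp z.1 z.2) (𝓜.sharp z.1 z.2) := by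
  rw [hamiltonian, cometric, 𝓜.g_sharp_apply]

/-- The metric in the chart at `x₀`. -/
def coordMetric (x₀ : M) (y : EuclideanSpace ℝ (Fin 4)) :
    EuclideanSpace ℝ (Fin 4) →L[ℝ] EuclideanSpace ℝ (Fin 4) →L[ℝ] ℝ :=
  (ContinuousLinearMap.precomp ℝ (coordInv x₀ ((extChartAt (𝓡 4) x₀).symm y))).comp
    ((𝓜.g ((extChartAt (𝓡 4) x₀).symm y)).comp (coordInv x₀ ((extChartAt (𝓡 4) x₀).symm y)))

theorem coordMetric_apply (x₀ : M) (y v w : EuclideanSpace ℝ (Fin 4)) :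
    𝓜.coordMetric x₀ y v w = 𝓜.g ((extChartAt (𝓡 4) x₀).symm y)
      (coordInv x₀ ((extChartAt (𝓡 4) x₀).symm y) v)
      (coordInv x₀ ((extChartAt (𝓡 4) x₀).symm y) w) := rfl

theorem coordMetric_chart {x₀ x : M} (hx : x ∈ (extChartAt (𝓡 4) x₀).source)
    (v w : EuclideanSpace ℝ (Fin 4)) :
    𝓜.coordMetric x₀ (extChartAt (𝓡 4) x₀ x) v w =
      𝓜.g x (coordInv x₀ x v) (coordInv x₀ x w) := by
  rw [coordMetric_apply, (extChartAt (𝓡 4) x₀).left_inv hx]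

theorem coordMetric_coordD {x₀ x : M} (hx : x ∈ (extChartAt (𝓡 4) x₀).source)
    (v w : TangentSpace (𝓡 4) x) :
    𝓜.coordMetric x₀ (extChartAt (𝓡 4) x₀ x) (coordD x₀ x v) (coordD x₀ x w) = 𝓜.g x v w := by
  rw [𝓜.coordMetric_chart hx, coordInv_coordD hx, coordInv_coordD hx]

theorem isMetricOn_coordMetric (x₀ : M) :
    IsMetricOn (𝓜.coordMetric x₀) (extChartAt (𝓡 4) x₀).target where
  isOpen := isOpen_extChartAt_target x₀
  contDiffOn := by
    refine contDiffOn_clm_apply.2 fun v => contDiffOn_clm_apply.2 fun w => ?_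
    have hs : ContMDiffOn (𝓡 4) 𝓘(ℝ, ℝ) ∞
        (fun x => 𝓜.g x (coordInv x₀ x v) (coordInv x₀ x w)) (extChartAt (𝓡 4) x₀).source := by
      have h1 : ContMDiffOn (𝓡 4) ((𝓡 4).prod 𝓘(ℝ, ℝ)) ∞
          (fun x => TotalSpace.mk' ℝ (E := Bundle.Trivial M ℝ) x
            (𝓜.g x (coordInv x₀ x v) (coordInv x₀ x w))) (extChartAt (𝓡 4) x₀).source := by
        apply ContMDiffOn.clm_bundle_apply₂ (F₁ := EuclideanSpace ℝ (Fin 4))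
          (F₂ := EuclideanSpace ℝ (Fin 4))
        · exact 𝓜.smooth.contMDiffOn
        · exact contMDiffOn_coordInv x₀ v
        · exact contMDiffOn_coordInv x₀ w
      intro x hx
      have h2 := h1 x hx
      simp only [contMDiffWithinAt_totalSpace] at h2
      exact h2.2
    exact contMDiffOn_iff_contDiffOn.1
      (hs.comp (contMDiffOn_extChartAt_symm x₀) fun y hy => (extChartAt (𝓡 4) x₀).map_target hy)
  symm y _ v w := 𝓜.symm _ _ _
  nondegenerate y hy v hv := by
    have hx := (extChartAt (𝓡 4) x₀).map_target hy
    have h1 : coordInv x₀ ((extChartAt (𝓡 4) x₀).symm y) v = 0 :=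
      𝓜.nondegenerate _ _ fun w => by
        have := hv (coordD x₀ _ w)
        rwa [coordMetric_apply, coordInv_coordD hx] at this
    rw [← coordD_coordInv hx v, h1, map_zero]

theorem raise_cotChart {x₀ : M} {z : Cotangent 4 M} (hz : z.1 ∈ (extChartAt (𝓡 4) x₀).source) :
    raise (𝓜.coordMetric x₀) (cotChart x₀ z) = coordD x₀ z.1 (𝓜.sharp z.1 z.2) := by
  have hy : extChartAt (𝓡 4) x₀ z.1 ∈ (extChartAt (𝓡 4) x₀).target :=
    (extChartAt (𝓡 4) x₀).map_source hz
  rw [← (𝓜.isMetricOn_coordMetric x₀).raise_lower hy (coordD x₀ z.1 (𝓜.sharp z.1 z.2))]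
  congr 1
  refine Prod.ext (cotChart_fst x₀ z) (ContinuousLinearMap.ext fun v => ?_)
  rw [cotChart_snd_apply hz, 𝓜.coordMetric_chart hz, coordInv_coordD hz, 𝓜.g_sharp_apply]

theorem ham_cotChart {x₀ : M} {z : Cotangent 4 M} (hz : z.1 ∈ (extChartAt (𝓡 4) x₀).source) :
    ham (𝓜.coordMetric x₀) (cotChart x₀ z) = 𝓜.hamiltonian z := by
  rw [ham, 𝓜.raise_cotChart hz, cotChart_snd_coordD hz]
  rfl

theorem cotChart_fst_mem_target {x₀ : M} {z : Cotangent 4 M}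
    (hz : z.1 ∈ (extChartAt (𝓡 4) x₀).source) :
    (cotChart x₀ z).1 ∈ (extChartAt (𝓡 4) x₀).target := by
  rw [cotChart_fst]
  exact (extChartAt (𝓡 4) x₀).map_source hz

theorem hasMFDerivAt_hamiltonian {x₀ : M} {z : Cotangent 4 M}
    (hz : z.1 ∈ (extChartAt (𝓡 4) x₀).source) :
    HasMFDerivAt (cotangentModel 4) 𝓘(ℝ, ℝ) 𝓜.hamiltonian z
      ((fderiv ℝ (ham (𝓜.coordMetric x₀)) (cotChart x₀ z)).comp
        (mfderiv (cotangentModel 4)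
          𝓘(ℝ, EuclideanSpace ℝ (Fin 4) × (EuclideanSpace ℝ (Fin 4) →L[ℝ] ℝ))
          (cotChart x₀ : Cotangent 4 M → _) z)) := by
  have h1 := ((𝓜.isMetricOn_coordMetric x₀).hasFDerivAt_ham
    (cotChart_fst_mem_target hz)).hasMFDerivAt
  have h2 := ((contMDiffAt_cotChart hz).mdifferentiableAt (by simp)).hasMFDerivAt
  refine (h1.comp z h2).congr_of_eventuallyEq ?_
  filter_upwards [(isOpen_cotChart_source x₀).mem_nhds (mem_cotChart_source.2 hz)] with z' hz'
  exact (𝓜.ham_cotChart (mem_cotChart_source.1 hz')).symm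

theorem dHamiltonian_eq {x₀ : M} {z : Cotangent 4 M}
    (hz : z.1 ∈ (extChartAt (𝓡 4) x₀).source) (w : TangentSpace (cotangentModel 4) z) :
    𝓜.dHamiltonian z w = fderiv ℝ (ham (𝓜.coordMetric x₀)) (cotChart x₀ z)
      (mfderiv (cotangentModel 4)
          𝓘(ℝ, EuclideanSpace ℝ (Fin 4) × (EuclideanSpace ℝ (Fin 4) →L[ℝ] ℝ))
          (cotChart x₀ : Cotangent 4 M → _) z w) := by
  rw [dHamiltonian, (𝓜.hasMFDerivAt_hamiltonian hz).mfderiv]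
  rfl

/-- The equations of the geodesic spray at one time, in canonical coordinates. -/
theorem geodesicEquation_iff {x₀ : M} {c : ℝ → Cotangent 4 M} {t : ℝ}
    (hz : (c t).1 ∈ (extChartAt (𝓡 4) x₀).source) :
    (MDifferentiableAt 𝓘(ℝ, ℝ) (cotangentModel 4) c t ∧
      ∀ w : TangentSpace (cotangentModel 4) (c t),
      extd (cotangentModel 4) (canonicalForm 4 M) (c t)
          (mfderiv 𝓘(ℝ, ℝ) (cotangentModel 4) c t (1 : ℝ)) w
        + 𝓜.dHamiltonian (c t) w = 0) ↔
    ContinuousAt c t ∧ HasDerivAt (fun s => cotChart x₀ (c s))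
      (hamField (𝓜.coordMetric x₀) (cotChart x₀ (c t))) t := by
  have hκ := (contMDiffAt_cotChart (x₀ := x₀) hz).mdifferentiableAt (by simp)
  have key : MDifferentiableAt 𝓘(ℝ, ℝ) (cotangentModel 4) c t →
      ((∀ w : TangentSpace (cotangentModel 4) (c t),
        extd (cotangentModel 4) (canonicalForm 4 M) (c t)
          (mfderiv 𝓘(ℝ, ℝ) (cotangentModel 4) c t (1 : ℝ)) w
        + 𝓜.dHamiltonian (c t) w = 0) ↔ HasDerivAt (fun s => cotChart x₀ (c s))
      (hamField (𝓜.coordMetric x₀) (cotChart x₀ (c t))) t) := by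
    intro hc
    have h1 : HasDerivAt (fun s => cotChart x₀ (c s)) (mfderiv (cotangentModel 4)
        𝓘(ℝ, EuclideanSpace ℝ (Fin 4) × (EuclideanSpace ℝ (Fin 4) →L[ℝ] ℝ))
        (cotChart x₀ : Cotangent 4 M → _) (c t)
          (mfderiv 𝓘(ℝ, ℝ) (cotangentModel 4) c t (1 : ℝ))) t :=
      hasDerivAt_of_hasMFDerivAt (hκ.hasMFDerivAt.comp t hc.hasMFDerivAt)
    have h2 := (𝓜.isMetricOn_coordMetric x₀).eq_hamField_iff (cotChart_fst_mem_target hz)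
      (mfderiv (cotangentModel 4)
        𝓘(ℝ, EuclideanSpace ℝ (Fin 4) × (EuclideanSpace ℝ (Fin 4) →L[ℝ] ℝ))
        (cotChart x₀ : Cotangent 4 M → _) (c t)
          (mfderiv 𝓘(ℝ, ℝ) (cotangentModel 4) c t (1 : ℝ)))
    constructor
    · intro h
      rw [← h2.1 fun w => ?_]
      · exact h1
      · obtain ⟨w, rfl⟩ := mfderiv_cotChart_surjective hz w
        have := h w
        rw [extd_canonicalForm hz, 𝓜.dHamiltonian_eq hz] at this
        exact this
    · intro h w
      rw [extd_canonicalForm hz, 𝓜.dHamiltonian_eq hz]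
      exact h2.2 (h1.unique h) _
  constructor
  · rintro ⟨hc, h⟩
    exact ⟨hc.continuousAt, (key hc).1 h⟩
  · rintro ⟨hc, h⟩
    -- Continuity keeps `c` in the chart near `t`, so `c` is the inverse chart applied to its
    -- differentiable coordinate expression.
    have hcd : MDifferentiableAt 𝓘(ℝ, ℝ) (cotangentModel 4) c t := by
      have hs := (cotChart x₀).map_source (mem_cotChart_source.2 hz)
      have h3 := ((contMDiffOn_cotChart_symm x₀).contMDiffAt
        ((isOpen_cotChart_target x₀).mem_nhds hs)).mdifferentiableAt (by simp)
      refine (h3.comp t h.differentiableAt.mdifferentiableAt).congr_of_eventuallyEq ?_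
      filter_upwards [hc ((isOpen_cotChart_source x₀).mem_nhds (mem_cotChart_source.2 hz))]
        with s hs
      exact ((cotChart x₀).left_inv hs).symm
    exact ⟨hcd, (key hcd).2 h⟩

end Spacetime
end

/-! ### Integral curves of the geodesic spray -/

section
variable {M : Type*} [TopologicalSpace M] [ChartedSpace (EuclideanSpace ℝ (Fin 4)) M]
  [IsManifold (𝓡 4) ∞ M] (𝓜 : Spacetime M)

namespace Spacetime

/-- The equation of the geodesic spray at time `t`. -/
def GeodesicAt (c : ℝ → Cotangent 4 M) (t : ℝ) : Prop :=
  MDifferentiableAt 𝓘(ℝ, ℝ) (cotangentModel 4) c t ∧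
    ∀ w : TangentSpace (cotangentModel 4) (c t),
      extd (cotangentModel 4) (canonicalForm 4 M) (c t)
          (mfderiv 𝓘(ℝ, ℝ) (cotangentModel 4) c t (1 : ℝ)) w
        + 𝓜.dHamiltonian (c t) w = 0

variable {𝓜}

theorem geodesicAt_iff {x₀ : M} {c : ℝ → Cotangent 4 M} {t : ℝ}
    (hz : (c t).1 ∈ (extChartAt (𝓡 4) x₀).source) :
    𝓜.GeodesicAt c t ↔ ContinuousAt c t ∧ HasDerivAt (fun s => cotChart x₀ (c s))
      (hamField (𝓜.coordMetric x₀) (cotChart x₀ (c t))) t := 𝓜.geodesicEquation_iff hz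

theorem GeodesicAt.continuousAt {c : ℝ → Cotangent 4 M} {t : ℝ} (h : 𝓜.GeodesicAt c t) :
    ContinuousAt c t := h.1.continuousAt

theorem GeodesicAt.hasDerivAt {x₀ : M} {c : ℝ → Cotangent 4 M} {t : ℝ} (h : 𝓜.GeodesicAt c t)
    (hz : (c t).1 ∈ (extChartAt (𝓡 4) x₀).source) :
    HasDerivAt (fun s => cotChart x₀ (c s))
      (hamField (𝓜.coordMetric x₀) (cotChart x₀ (c t))) t := ((geodesicAt_iff hz).1 h).2

theorem GeodesicAt.congr {c c' : ℝ → Cotangent 4 M} {t : ℝ} (h : 𝓜.GeodesicAt c t)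
    (hc : c' =ᶠ[𝓝 t] c) : 𝓜.GeodesicAt c' t := by
  have ht := hc.self_of_nhds
  have hz : (c t).1 ∈ (extChartAt (𝓡 4) (c t).1).source := mem_extChartAt_source _
  rw [geodesicAt_iff (x₀ := (c t).1) (by rwa [ht]), ht]
  exact ⟨h.continuousAt.congr hc.symm, (h.hasDerivAt hz).congr_of_eventuallyEq
    (hc.mono fun s hs => congrArg (cotChart (c t).1) hs)⟩

theorem GeodesicAt.comp_add_const {c : ℝ → Cotangent 4 M} {t a : ℝ}
    (h : 𝓜.GeodesicAt c (t + a)) : 𝓜.GeodesicAt (fun s => c (s + a)) t := by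
  have hz : (c (t + a)).1 ∈ (extChartAt (𝓡 4) (c (t + a)).1).source := mem_extChartAt_source _
  exact (geodesicAt_iff (c := fun s => c (s + a)) hz).2
    ⟨ContinuousAt.comp (f := fun s => s + a) h.continuousAt (by fun_prop),
      (h.hasDerivAt hz).comp_add_const t a⟩

/-- Coordinate curves solving Hamilton's equations are integral curves of the geodesic spray. -/
theorem geodesicAt_of_hasDerivAt {x₀ : M}
    {f : ℝ → EuclideanSpace ℝ (Fin 4) × (EuclideanSpace ℝ (Fin 4) →L[ℝ] ℝ)} {t : ℝ}
    (hf : f t ∈ (cotChart x₀ : PartialEquiv (Cotangent 4 M) _).target)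
    (hd : HasDerivAt f (hamField (𝓜.coordMetric x₀) (f t)) t) :
    𝓜.GeodesicAt (fun s => (cotChart x₀).symm (f s)) t := by
  have hz : ((cotChart x₀).symm (f t) : Cotangent 4 M).1 ∈ (extChartAt (𝓡 4) x₀).source :=
    mem_cotChart_source.1 ((cotChart x₀).map_target hf)
  rw [geodesicAt_iff hz]
  constructor
  · exact ContinuousAt.comp ((contMDiffOn_cotChart_symm x₀).continuousOn.continuousAt
      ((isOpen_cotChart_target x₀).mem_nhds hf)) hd.continuousAt
  · rw [(cotChart x₀).right_inv hf]
    refine hd.congr_of_eventuallyEq ?_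
    filter_upwards [hd.continuousAt ((isOpen_cotChart_target x₀).mem_nhds hf)] with s hs
    exact (cotChart x₀).right_inv hs

/-- The velocity of the position is multiplied by `a` and that of the momentum by `a ^ 2`, one
factor from time and one from the covector, as `hamField_smul` demands. This lets scalings be moved
past flow segments. -/
theorem GeodesicAt.smul {c : ℝ → Cotangent 4 M} {t a : ℝ} (h : 𝓜.GeodesicAt c (a * t)) :
    𝓜.GeodesicAt (fun s => (⟨(c (a * s)).1, a • (c (a * s)).2⟩ : Cotangent 4 M)) t := by
  set x₀ := (c (a * t)).1
  have hz : (c (a * t)).1 ∈ (extChartAt (𝓡 4) x₀).source := mem_extChartAt_source _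
  have hd := h.hasDerivAt hz
  have hmul : HasDerivAt (fun s => a * s) a t := by simpa using (hasDerivAt_id t).const_mul a
  have hd2 := HasDerivAt.scomp t hd hmul
  set κ := fun s => cotChart x₀ (c (a * s)) with hκ
  have hd3 : HasDerivAt (fun s => ((κ s).1, a • (κ s).2))
      (hamField (𝓜.coordMetric x₀) ((κ t).1, a • (κ t).2)) t := by
    rw [(𝓜.isMetricOn_coordMetric x₀).hamField_smul]
    have h1 := (ContinuousLinearMap.fst ℝ (EuclideanSpace ℝ (Fin 4))
      (EuclideanSpace ℝ (Fin 4) →L[ℝ] ℝ)).hasFDerivAt.comp_hasDerivAt t hd2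
    have h2 := (ContinuousLinearMap.snd ℝ (EuclideanSpace ℝ (Fin 4))
      (EuclideanSpace ℝ (Fin 4) →L[ℝ] ℝ)).hasFDerivAt.comp_hasDerivAt t hd2
    have h3 : HasDerivAt (fun s => ((κ s).1, a • (κ s).2)) _ t := h1.prodMk (h2.const_smul a)
    convert h3 using 1
    refine Prod.ext rfl ?_
    simp [κ, pow_two, mul_smul]
  have htgt : ((κ t).1, a • (κ t).2) ∈
      (cotChart x₀ : PartialEquiv (Cotangent 4 M) _).target := by
    rw [cotChart_target]
    exact ⟨cotChart_fst_mem_target hz, mem_univ _⟩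
  refine (geodesicAt_of_hasDerivAt (f := fun s => ((κ s).1, a • (κ s).2)) htgt hd3).congr ?_
  have hcont : ContinuousAt (fun s => (c (a * s)).1) t :=
    continuous_cotangent_proj.continuousAt.comp
      (ContinuousAt.comp (f := fun s => a * s) h.continuousAt (by fun_prop))
  filter_upwards [hcont (extChartAt_source_mem_nhds (I := 𝓡 4) x₀)] with s hs
  have hs' : (⟨(c (a * s)).1, a • (c (a * s)).2⟩ : Cotangent 4 M) ∈
    (cotChart x₀ : PartialEquiv (Cotangent 4 M) _).source := mem_cotChart_source.2 hs
  rw [← (cotChart x₀).left_inv hs']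
  congr 1
  rw [cotChart_mk hs]
  have h5 : κ s = _ := cotChart_mk (x₀ := x₀) hs (c (a * s)).2
  rw [h5]
  rfl

/-- Homogeneity with factor 0 makes the field vanish on zero covectors. Together with uniqueness
this keeps a nonzero covector from ever reaching zero. -/
theorem geodesicAt_const_zero (x : M) (t : ℝ) :
    𝓜.GeodesicAt (fun _ => (⟨x, 0⟩ : Cotangent 4 M)) t := by
  have hz : x ∈ (extChartAt (𝓡 4) x).source := mem_extChartAt_source _
  rw [geodesicAt_iff (x₀ := x) (c := fun _ => (⟨x, 0⟩ : Cotangent 4 M)) hz]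
  refine ⟨continuousAt_const, ?_⟩
  rw [cotChart_mk hz]
  have h1 := (𝓜.isMetricOn_coordMetric x).hamField_smul (extChartAt (𝓡 4) x x) 0 0
  simp only [zero_smul, ne_eq, OfNat.ofNat_ne_zero, not_false_eq_true, zero_pow] at h1
  rw [ContinuousLinearMap.zero_comp, h1]
  exact hasDerivAt_const _ _

theorem eventuallyEq_of_geodesicAt {c c' : ℝ → Cotangent 4 M} {t : ℝ}
    (h : ∀ᶠ s in 𝓝 t, 𝓜.GeodesicAt c s) (h' : ∀ᶠ s in 𝓝 t, 𝓜.GeodesicAt c' s)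
    (heq : c t = c' t) : c =ᶠ[𝓝 t] c' := by
  have hz : c t ∈ (cotChart (c t).1 : PartialEquiv (Cotangent 4 M) _).source :=
    mem_cotChart_source.2 (mem_extChartAt_source _)
  have hs : ∀ᶠ s in 𝓝 t, c s ∈ (cotChart (c t).1 : PartialEquiv (Cotangent 4 M) _).source :=
    h.self_of_nhds.continuousAt ((isOpen_cotChart_source _).mem_nhds hz)
  have hs' : ∀ᶠ s in 𝓝 t, c' s ∈ (cotChart (c t).1 : PartialEquiv (Cotangent 4 M) _).source :=
    h'.self_of_nhds.continuousAt ((isOpen_cotChart_source _).mem_nhds (heq ▸ hz))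
  have hm := 𝓜.isMetricOn_coordMetric (c t).1
  have hV : ContDiffAt ℝ 1 (hamField (𝓜.coordMetric (c t).1)) (cotChart (c t).1 (c t)) :=
    (hm.contDiffOn_hamField.contDiffAt (hm.isOpen_domain.mem_nhds
      ⟨cotChart_fst_mem_target (mem_cotChart_source.1 hz), mem_univ _⟩)).of_le (by simp)
  have key := eventuallyEq_of_hasDerivAt hV (t₀ := t)
    (f := fun s => cotChart (c t).1 (c s)) (g := fun s => cotChart (c t).1 (c' s))
    (by filter_upwards [h, hs] with s h1 h2 using h1.hasDerivAt (mem_cotChart_source.1 h2))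
    (by filter_upwards [h', hs'] with s h1 h2 using h1.hasDerivAt (mem_cotChart_source.1 h2))
    rfl (by rw [heq])
  filter_upwards [key, hs, hs'] with s h1 h2 h3
  exact (cotChart (c t).1).injOn h2 h3 h1

theorem IsGeodesicFlowLine.eventually {c : ℝ → Cotangent 4 M} {J : Set ℝ} (hJ : IsOpen J)
    (h : 𝓜.IsGeodesicFlowLine c J) {t : ℝ} (ht : t ∈ J) : ∀ᶠ s in 𝓝 t, 𝓜.GeodesicAt c s := by
  filter_upwards [hJ.mem_nhds ht] with s hs using h s hs

/-- The set of times near which the curves agree is open. It is relatively closed in `J`, because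
T*M is Hausdorff and local uniqueness holds, and `J` is connected. -/
theorem IsGeodesicFlowLine.eqOn [T2Space M] {c c' : ℝ → Cotangent 4 M} {J : Set ℝ}
    (hJ : IsOpen J) (hJc : J.OrdConnected) (h : 𝓜.IsGeodesicFlowLine c J)
    (h' : 𝓜.IsGeodesicFlowLine c' J) {t₀ : ℝ} (ht₀ : t₀ ∈ J) (heq : c t₀ = c' t₀) :
    EqOn c c' J := by
  have := t2Space_cotangent (n := 4) (X := M)
  have hsub : J ⊆ {t | c =ᶠ[𝓝 t] c'} := by
    refine hJc.isPreconnected.subset_of_closure_inter_subset isOpen_setOfPred_eventually_nhds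
      ⟨t₀, ht₀, eventuallyEq_of_geodesicAt (h.eventually hJ ht₀) (h'.eventually hJ ht₀) heq⟩ ?_
    rintro t ⟨ht, htJ⟩
    refine eventuallyEq_of_geodesicAt (h.eventually hJ htJ) (h'.eventually hJ htJ) ?_
    refine tendsto_nhds_unique_of_frequently_eq (GeodesicAt.continuousAt (h t htJ))
      (GeodesicAt.continuousAt (h' t htJ)) ?_
    exact (mem_closure_iff_frequently.1 ht).mono fun s hs => hs.self_of_nhds
  exact fun t ht => (hsub ht).self_of_nhds

theorem IsGeodesicFlowLine.mono {c : ℝ → Cotangent 4 M} {J J' : Set ℝ}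
    (h : 𝓜.IsGeodesicFlowLine c J) (hJ : J' ⊆ J) : 𝓜.IsGeodesicFlowLine c J' :=
  fun t ht => h t (hJ ht)

/-- By uniqueness on the interval `J ∩ J'`, the curve that follows `c` on `J` and `c'` elsewhere
agrees with `c'` on all of `J'`, so near each time it coincides with one of the two. -/
theorem IsGeodesicFlowLine.union [T2Space M] {c c' : ℝ → Cotangent 4 M} {J J' : Set ℝ}
    (hJ : IsOpen J) (hJ' : IsOpen J') (hJc : J.OrdConnected) (hJc' : J'.OrdConnected)
    (h : 𝓜.IsGeodesicFlowLine c J) (h' : 𝓜.IsGeodesicFlowLine c' J') {t₀ : ℝ} (ht₀ : t₀ ∈ J)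
    (ht₀' : t₀ ∈ J') (heq : c t₀ = c' t₀) :
    ∃ c'', 𝓜.IsGeodesicFlowLine c'' (J ∪ J') ∧ EqOn c'' c J ∧ EqOn c'' c' J' := by
  classical
  have hE : EqOn c c' (J ∩ J') := (h.mono inter_subset_left).eqOn (hJ.inter hJ')
    (hJc.inter hJc') (h'.mono inter_subset_right) ⟨ht₀, ht₀'⟩ heq
  have h1 : EqOn (J.piecewise c c') c J := piecewise_eqOn J c c'
  have h2 : EqOn (J.piecewise c c') c' J' := fun t ht => by
    by_cases htJ : t ∈ J
    · rw [piecewise_eq_of_mem _ _ _ htJ, hE ⟨htJ, ht⟩]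
    · rw [piecewise_eq_of_notMem _ _ _ htJ]
  refine ⟨J.piecewise c c', ?_, h1, h2⟩
  rintro t (ht | ht)
  · exact GeodesicAt.congr (h t ht) (h1.eventuallyEq_of_mem (hJ.mem_nhds ht))
  · exact GeodesicAt.congr (h' t ht) (h2.eventuallyEq_of_mem (hJ'.mem_nhds ht))

variable (𝓜)

/-- The geodesic spray has a smooth local flow in canonical coordinates. -/
theorem exists_coord_flow (x₀ : M) {w₀ : EuclideanSpace ℝ (Fin 4) × (EuclideanSpace ℝ (Fin 4) →L[ℝ] ℝ)}
    (hw₀ : w₀ ∈ (cotChart x₀ : PartialEquiv (Cotangent 4 M) _).target) :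
    ∃ ε > 0, ∃ U ⊆ (cotChart x₀ : PartialEquiv (Cotangent 4 M) _).target, IsOpen U ∧ w₀ ∈ U ∧
      ∃ F : ℝ × (EuclideanSpace ℝ (Fin 4) × (EuclideanSpace ℝ (Fin 4) →L[ℝ] ℝ)) →
        EuclideanSpace ℝ (Fin 4) × (EuclideanSpace ℝ (Fin 4) →L[ℝ] ℝ),
      ContDiffOn ℝ ∞ F (Ioo (-ε) ε ×ˢ U) ∧ (∀ w ∈ U, F (0, w) = w) ∧
      ∀ w ∈ U, ∀ t ∈ Ioo (-ε) ε,
        F (t, w) ∈ (cotChart x₀ : PartialEquiv (Cotangent 4 M) _).target ∧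
        HasDerivAt (fun s => F (s, w)) (hamField (𝓜.coordMetric x₀) (F (t, w))) t := by
  have hm := 𝓜.isMetricOn_coordMetric x₀
  have hT := cotChart_target (n := 4) x₀
  obtain ⟨ε, hε, U, hU, hw, F, hF, hF0, hFd⟩ := exists_local_flow hm.isOpen_domain
    hm.contDiffOn_hamField (hT ▸ hw₀)
  refine ⟨ε, hε, U ∩ (cotChart x₀ : PartialEquiv (Cotangent 4 M) _).target, inter_subset_right,
    hU.inter (isOpen_cotChart_target x₀), ⟨hw, hw₀⟩, F,
    hF.mono (prod_mono_right inter_subset_left), fun w h => hF0 w h.1, fun w h t ht => ?_⟩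
  rw [hT]
  exact hFd w h.1 t ht

/-- Each point has a neighbourhood with a common existence time, and compactness reduces to a
minimum of finitely many. The uniform time is what continues a geodesic trapped in a compact set. -/
theorem exists_flowLine_of_mem (x₀ : M)
    {K : Set (EuclideanSpace ℝ (Fin 4) × (EuclideanSpace ℝ (Fin 4) →L[ℝ] ℝ))} (hK : IsCompact K)
    (hKt : K ⊆ (cotChart x₀ : PartialEquiv (Cotangent 4 M) _).target) :
    ∃ ε > 0, ∀ w ∈ K, ∃ c, 𝓜.IsGeodesicFlowLine c (Ioo (-ε) ε) ∧ c 0 = (cotChart x₀).symm w := by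
  refine hK.induction_on (p := fun K => ∃ ε > 0, ∀ w ∈ K, ∃ c,
    𝓜.IsGeodesicFlowLine c (Ioo (-ε) ε) ∧ c 0 = (cotChart x₀).symm w)
    ⟨1, one_pos, fun w hw => hw.elim⟩ ?_ ?_ ?_
  · rintro s t hst ⟨ε, hε, h⟩
    exact ⟨ε, hε, fun w hw => h w (hst hw)⟩
  · rintro s t ⟨ε, hε, h⟩ ⟨ε', hε', h'⟩
    refine ⟨min ε ε', lt_min hε hε', ?_⟩
    rintro w (hw | hw)
    · obtain ⟨c, hc, hc0⟩ := h w hw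
      exact ⟨c, hc.mono (Ioo_subset_Ioo (neg_le_neg (min_le_left _ _)) (min_le_left _ _)), hc0⟩
    · obtain ⟨c, hc, hc0⟩ := h' w hw
      exact ⟨c, hc.mono (Ioo_subset_Ioo (neg_le_neg (min_le_right _ _)) (min_le_right _ _)), hc0⟩
  · intro w hw
    obtain ⟨ε, hε, U, hUt, hU, hwU, F, -, hF0, hFd⟩ := 𝓜.exists_coord_flow x₀ (hKt hw)
    refine ⟨U, mem_nhdsWithin_of_mem_nhds (hU.mem_nhds hwU), ε, hε, fun w' hw' =>
      ⟨fun t => (cotChart x₀).symm (F (t, w')), fun t ht => ?_,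
        congrArg (cotChart x₀).symm (hF0 w' hw')⟩⟩
    exact geodesicAt_of_hasDerivAt (f := fun t => F (t, w')) (hFd w' hw' t ht).1
      (hFd w' hw' t ht).2

/-- Maximal integral curves of the geodesic spray. -/
theorem exists_maximal_flowLine [T2Space M] (z : Cotangent 4 M) :
    ∃ (c : ℝ → Cotangent 4 M) (J : Set ℝ), IsOpen J ∧ J.OrdConnected ∧ 0 ∈ J ∧
      𝓜.IsGeodesicFlowLine c J ∧ c 0 = z ∧
      ∀ (c' : ℝ → Cotangent 4 M) (J' : Set ℝ), IsOpen J' → J'.OrdConnected → 0 ∈ J' →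
        𝓜.IsGeodesicFlowLine c' J' → c' 0 = z → J' ⊆ J := by
  let P : ℝ → (ℝ → Cotangent 4 M) → Set ℝ → Prop := fun t c J =>
    t ∈ J ∧ IsOpen J ∧ J.OrdConnected ∧ 0 ∈ J ∧ 𝓜.IsGeodesicFlowLine c J ∧ c 0 = z
  let I : Set ℝ := {t | ∃ c J, P t c J}
  have hsub : ∀ {t c J}, P t c J → J ⊆ I := fun {t c J} h s hs => ⟨c, J, hs, h.2⟩
  have : Nonempty (Cotangent 4 M) := ⟨z⟩
  -- A curve `c t` is chosen for every time `t` reached by some candidate; uniqueness makes the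
  -- diagonal `s ↦ c s s` agree with every candidate on its interval.
  choose! c J hcJ using fun t (ht : t ∈ I) => (show ∃ c J, P t c J from ht)
  have huniq : ∀ {t c₁ J₁}, P t c₁ J₁ → EqOn (fun s => c s s) c₁ J₁ := by
    intro t c₁ J₁ h s hs
    obtain ⟨hs', hop, hoc, h0, hf, hz⟩ := hcJ s (hsub h hs)
    obtain ⟨-, hop₁, hoc₁, h0₁, hf₁, hz₁⟩ := h
    exact (hf.mono inter_subset_left).eqOn (hop.inter hop₁) (hoc.inter hoc₁)
      (hf₁.mono inter_subset_right) ⟨h0, h0₁⟩ (hz.trans hz₁.symm) ⟨hs', hs⟩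
  have h0I : (0 : ℝ) ∈ I := by
    have hw : cotChart z.1 z ∈ (cotChart z.1 : PartialEquiv (Cotangent 4 M) _).target :=
      (cotChart z.1).map_source (mem_cotChart_source.2 (mem_extChartAt_source _))
    obtain ⟨ε, hε, h⟩ := 𝓜.exists_flowLine_of_mem z.1 (isCompact_singleton (x := cotChart z.1 z))
      (singleton_subset_iff.2 hw)
    obtain ⟨c, hc, hc0⟩ := h _ rfl
    rw [(cotChart z.1).left_inv (mem_cotChart_source.2 (mem_extChartAt_source _))] at hc0
    have h0 : (0 : ℝ) ∈ Ioo (-ε) ε := ⟨by linarith, hε⟩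
    exact ⟨c, Ioo (-ε) ε, h0, isOpen_Ioo, ordConnected_Ioo, h0, hc, hc0⟩
  refine ⟨fun s => c s s, I, ?_, ?_, h0I, ?_, (hcJ 0 h0I).2.2.2.2.2, ?_⟩
  · refine isOpen_iff_mem_nhds.2 fun t ht => ?_
    exact mem_of_superset ((hcJ t ht).2.1.mem_nhds (hcJ t ht).1) (hsub (hcJ t ht))
  · refine ⟨fun a ha b hb s hs => ?_⟩
    rcases le_total s 0 with h | h
    · exact hsub (hcJ a ha) ((hcJ a ha).2.2.1.out (hcJ a ha).1 (hcJ a ha).2.2.2.1 ⟨hs.1, h⟩)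
    · exact hsub (hcJ b hb) ((hcJ b hb).2.2.1.out (hcJ b hb).2.2.2.1 (hcJ b hb).1 ⟨h, hs.2⟩)
  · intro t ht
    exact GeodesicAt.congr ((hcJ t ht).2.2.2.2.1 t (hcJ t ht).1)
      ((huniq (hcJ t ht)).eventuallyEq_of_mem ((hcJ t ht).2.1.mem_nhds (hcJ t ht).1))
  · intro c' J' h1 h2 h3 h4 h5 t ht
    exact ⟨c', J', ht, h1, h2, h3, h4, h5⟩

variable {𝓜}

/-- The Hamiltonian is conserved. -/
theorem IsGeodesicFlowLine.hamiltonian_eq {c : ℝ → Cotangent 4 M} {J : Set ℝ}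
    (hJ : IsOpen J) (hJc : J.OrdConnected) (h : 𝓜.IsGeodesicFlowLine c J) {s t : ℝ}
    (hs : s ∈ J) (ht : t ∈ J) : 𝓜.hamiltonian (c s) = 𝓜.hamiltonian (c t) := by
  have hd : ∀ t ∈ J, HasDerivAt (fun t => 𝓜.hamiltonian (c t)) 0 t := by
    intro t ht
    have hz : (c t).1 ∈ (extChartAt (𝓡 4) (c t).1).source := mem_extChartAt_source _
    have hg := GeodesicAt.hasDerivAt (h t ht) hz
    refine ((𝓜.isMetricOn_coordMetric (c t).1).hasDerivAt_ham (cotChart_fst_mem_target hz)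
      hg).congr_of_eventuallyEq ?_
    filter_upwards [GeodesicAt.continuousAt (h t ht) ((isOpen_cotChart_source _).mem_nhds
      (mem_cotChart_source.2 hz))] with s hs
    exact (𝓜.ham_cotChart (mem_cotChart_source.1 hs)).symm
  exact hJ.is_const_of_deriv_eq_zero hJc.isPreconnected
    (fun t ht => (hd t ht).differentiableAt.differentiableWithinAt)
    (fun t ht => (hd t ht).deriv) hs ht

/-- Integral curves of the geodesic spray are smooth. -/
theorem IsGeodesicFlowLine.contMDiffAt {c : ℝ → Cotangent 4 M} {J : Set ℝ}
    (hJ : IsOpen J) (h : 𝓜.IsGeodesicFlowLine c J) {t : ℝ} (ht : t ∈ J) :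
    ContMDiffAt 𝓘(ℝ, ℝ) (cotangentModel 4) ∞ c t := by
  have hz : c t ∈ (cotChart (c t).1 : PartialEquiv (Cotangent 4 M) _).source :=
    mem_cotChart_source.2 (mem_extChartAt_source _)
  have hw := (cotChart (c t).1).map_source hz
  obtain ⟨ε, hε, U, hUt, hU, hwU, F, hF, hF0, hFd⟩ := 𝓜.exists_coord_flow (c t).1 hw
  set w := cotChart (c t).1 (c t)
  have h0 : (0 : ℝ) ∈ Ioo (-ε) ε := ⟨by linarith, hε⟩
  have hFw : ContDiffAt ℝ ∞ (fun s => F (s - t, w)) t := by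
    have h1 : ContDiffAt ℝ ∞ F (t - t, w) :=
      hF.contDiffAt ((isOpen_Ioo.prod hU).mem_nhds ⟨by simpa using h0, hwU⟩)
    exact ContDiffAt.comp (f := fun s => (s - t, w)) t h1 (by fun_prop)
  have h2 : ContMDiffAt 𝓘(ℝ, ℝ) (cotangentModel 4) ∞
      (fun s => (cotChart (c t).1).symm (F (s - t, w)) : ℝ → Cotangent 4 M) t := by
    have h3 : F (t - t, w) ∈ (cotChart (c t).1 : PartialEquiv (Cotangent 4 M) _).target := by
      rw [sub_self, hF0 w hwU]; exact hw
    exact ContMDiffAt.comp t ((contMDiffOn_cotChart_symm (c t).1).contMDiffAt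
      ((isOpen_cotChart_target _).mem_nhds h3)) hFw.contMDiffAt
  refine h2.congr_of_eventuallyEq ?_
  refine eventuallyEq_of_geodesicAt (h.eventually hJ ht) ?_ ?_
  · have h4 : ∀ᶠ s in 𝓝 t, s - t ∈ Ioo (-ε) ε := by
      have : ContinuousAt (fun s => s - t) t := by fun_prop
      exact this (isOpen_Ioo.mem_nhds (by simpa using h0))
    filter_upwards [h4] with s hs
    refine geodesicAt_of_hasDerivAt (f := fun s => F (s - t, w)) (hFd w hwU _ hs).1 ?_
    exact HasDerivAt.comp_sub_const s t (hFd w hwU _ hs).2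
  · rw [sub_self, hF0 w hwU, (cotChart (c t).1).left_inv hz]

end Spacetime
end

/-! ### Lorentzian linear algebra and escape estimates -/

section Abstract
variable {E : Type*} [NormedAddCommGroup E] [NormedSpace ℝ E]

/-- A bilinear form of Lorentzian signature. -/
structure IsLorentzian (b : E →L[ℝ] E →L[ℝ] ℝ) : Prop where
  symm : ∀ v w, b v w = b w v
  exists_timelike : ∃ u, b u u < 0 ∧ ∀ w, w ≠ 0 → b u w = 0 → 0 < b w w

/-- The definition tests a single timelike vector `u`; here the property passes to every timelike
`T`. The combination `x` of `w` and `T` that is orthogonal to `u` satisfies b(x, x) = b(u, T)² b(w,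
w) + b(u, w)² b(T, T). If b(w, w) ≤ 0 this is not positive, so x = 0; pairing with `T` gives b(u, w)
= 0, and then w = 0. -/
theorem IsLorentzian.pos_of_orthogonal {b : E →L[ℝ] E →L[ℝ] ℝ} (hb : IsLorentzian b) {T w : E}
    (hT : b T T < 0) (hTw : b T w = 0) (hw : w ≠ 0) : 0 < b w w := by
  obtain ⟨u, hu, hpos⟩ := hb.exists_timelike
  have hT0 : T ≠ 0 := by rintro rfl; simp at hT
  have hβ : b u T ≠ 0 := fun h => lt_asymm hT (hpos T hT0 h)
  by_contra! hneg
  set x := b u T • w - b u w • T with hx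
  have h1 : b u x = 0 := by simp [hx]; ring
  have h2 : b x x = (b u T) ^ 2 * b w w + (b u w) ^ 2 * b T T := by
    have : b w T = 0 := by rw [hb.symm, hTw]
    simp [hx, this, hTw]; ring
  have h3 : x = 0 := by
    by_contra hne
    have := hpos x hne h1
    rw [h2] at this
    nlinarith [sq_nonneg (b u T), sq_nonneg (b u w), mul_nonneg (sq_nonneg (b u T))
      (neg_nonneg.2 hneg), mul_nonneg (sq_nonneg (b u w)) (neg_nonneg.2 hT.le)]
  have h4 : b u w = 0 := by
    have : b T x = 0 := by rw [h3, map_zero]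
    simp only [hx, map_sub, map_smul, hTw, smul_eq_mul, mul_zero, zero_sub, neg_eq_zero] at this
    exact (mul_eq_zero.1 this).resolve_right hT.ne
  rw [hx, h4, zero_smul, sub_zero, smul_eq_zero] at h3
  exact h3.elim hβ hw

theorem IsLorentzian.eq_zero_of_orthogonal {b : E →L[ℝ] E →L[ℝ] ℝ} (hb : IsLorentzian b) {T v : E}
    (hT : b T T < 0) (hv : b v v ≤ 0) (hTv : b v T = 0) : v = 0 := by
  by_contra hne
  exact (hb.pos_of_orthogonal hT (by rw [hb.symm, hTv]) hne).not_ge hv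

/-- Future causal vectors lie uniformly inside a cone. -/
theorem exists_cone_estimate [FiniteDimensional ℝ E] {g : E → E →L[ℝ] E →L[ℝ] ℝ} {T : E → E}
    {y₀ : E} (hg : ContinuousAt g y₀) (hT : ContinuousAt T y₀) (hb : IsLorentzian (g y₀))
    (hT₀ : g y₀ (T y₀) (T y₀) < 0) :
    ∃ κ > 0, ∀ᶠ y in 𝓝 y₀, ∀ v, g y v v ≤ 0 → g y v (T y) ≤ 0 →
      κ * ‖v‖ ≤ -g y₀ (T y₀) v ∧ κ * ‖v‖ ≤ -g y v (T y₀) := by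
  -- The future causal unit vectors at `y₀`: a compact set on which -g(v, T) is positive. The
  -- constant `κ` is taken strictly below its minimum, which leaves room to move `y`.
  let C : Set E := {v | v ∈ Metric.sphere (0 : E) 1 ∧ g y₀ v v ≤ 0 ∧ g y₀ v (T y₀) ≤ 0}
  have hq : Continuous fun v => g y₀ v v := by fun_prop
  have hl : Continuous fun v => g y₀ v (T y₀) := by fun_prop
  have hC : IsCompact C := (isCompact_sphere 0 1).inter_right
    ((isClosed_le hq continuous_const).inter (isClosed_le hl continuous_const))
  have hpos : ∀ v ∈ C, 0 < -g y₀ v (T y₀) := fun v hv => by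
    refine neg_pos.2 (lt_of_le_of_ne hv.2.2 fun h => ?_)
    have := hv.1
    rw [hb.eq_zero_of_orthogonal hT₀ hv.2.1 h] at this
    simp at this
  obtain ⟨κ, hκ, hκC⟩ : ∃ κ > 0, ∀ v ∈ C, κ < -g y₀ v (T y₀) := by
    rcases C.eq_empty_or_nonempty with h | h
    · exact ⟨1, one_pos, by simp [h]⟩
    · obtain ⟨v, hv, hmin⟩ := hC.exists_isMinOn h hl.neg.continuousOn
      exact ⟨_, half_pos (hpos v hv), fun w hw =>
        (half_lt_self (hpos v hv)).trans_le (hmin hw)⟩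
  refine ⟨κ, hκ, ?_⟩
  have hg' : ∀ v, ContinuousAt (fun z : E × E => g z.1) (y₀, v) := fun v =>
    ContinuousAt.comp (f := Prod.fst) hg continuousAt_fst
  have hT' : ∀ v, ContinuousAt (fun z : E × E => T z.1) (y₀, v) := fun v =>
    ContinuousAt.comp (f := Prod.fst) hT continuousAt_fst
  -- Near a vector of `C` both estimates are open conditions; near any other unit vector one of the
  -- premises fails. Compactness of the sphere gives one neighbourhood of `y₀`, and homogeneity
  -- extends the estimates to all vectors.
  have key : ∀ᶠ y in 𝓝 y₀, ∀ v ∈ Metric.sphere (0 : E) 1, (g y v v ≤ 0 → g y v (T y) ≤ 0 →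
      κ ≤ -g y₀ (T y₀) v ∧ κ ≤ -g y v (T y₀)) := by
    refine (isCompact_sphere (0 : E) 1).eventually_forall_of_forall_eventually fun v hv => ?_
    have c1 : ContinuousAt (fun z : E × E => g z.1 z.2 z.2) (y₀, v) :=
      ((hg' v).clm_apply continuousAt_snd).clm_apply continuousAt_snd
    have c2 : ContinuousAt (fun z : E × E => g z.1 z.2 (T z.1)) (y₀, v) :=
      ((hg' v).clm_apply continuousAt_snd).clm_apply (hT' v)
    have c3 : ContinuousAt (fun z : E × E => -g y₀ (T y₀) z.2) (y₀, v) := by fun_prop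
    have c4 : ContinuousAt (fun z : E × E => -g z.1 z.2 (T y₀)) (y₀, v) :=
      (((hg' v).clm_apply continuousAt_snd).clm_apply continuousAt_const).neg
    by_cases hvC : v ∈ C
    · have h3 : κ < -g y₀ (T y₀) v := by rw [hb.symm]; exact hκC v hvC
      filter_upwards [c3.eventually (lt_mem_nhds h3), c4.eventually (lt_mem_nhds (hκC v hvC))]
        with z h1 h2 _ _ using ⟨h1.le, h2.le⟩
    · by_cases h1 : g y₀ v v ≤ 0
      · have h2 : 0 < g y₀ v (T y₀) := by
          by_contra! h
          exact hvC ⟨hv, h1, h⟩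
        filter_upwards [c2.eventually (lt_mem_nhds h2)] with z hz _ h using absurd h hz.not_ge
      · filter_upwards [c1.eventually (lt_mem_nhds (not_le.1 h1))] with z hz h
          using absurd h hz.not_ge
  filter_upwards [key] with y hy v hv hvT
  rcases eq_or_ne v 0 with rfl | hne
  · simp
  have hn : 0 < ‖v‖ := norm_pos_iff.2 hne
  have hs : ‖v‖⁻¹ • v ∈ Metric.sphere (0 : E) 1 := by
    simp [norm_smul, inv_mul_cancel₀ hn.ne']
  have h := hy _ hs (by
      simp only [map_smul, smul_apply, smul_eq_mul]
      exact mul_nonpos_of_nonneg_of_nonpos (by positivity)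
        (mul_nonpos_of_nonneg_of_nonpos (by positivity) hv)) (by
      simp only [map_smul, smul_apply, smul_eq_mul]
      exact mul_nonpos_of_nonneg_of_nonpos (by positivity) hvT)
  simp only [map_smul, smul_apply, smul_eq_mul, ← mul_neg] at h
  constructor
  · have := mul_le_mul_of_nonneg_left h.1 hn.le
    rw [← mul_assoc, mul_inv_cancel₀ hn.ne', one_mul] at this
    linarith
  · have := mul_le_mul_of_nonneg_left h.2 hn.le
    rw [← mul_assoc, mul_inv_cancel₀ hn.ne', one_mul] at this
    linarith

theorem monotoneOn_of_hasDerivAt_nonneg {A : Set ℝ} (hA : A.OrdConnected) {f f' : ℝ → ℝ}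
    (hf : ∀ t ∈ A, HasDerivAt f (f' t) t) (h : ∀ t ∈ A, 0 ≤ f' t) : MonotoneOn f A :=
  monotoneOn_of_deriv_nonneg hA.convex (fun t ht => (hf t ht).continuousAt.continuousWithinAt)
    (fun t ht => (hf t (interior_subset ht)).differentiableAt.differentiableWithinAt)
    fun t ht => by rw [(hf t (interior_subset ht)).deriv]; exact h t (interior_subset ht)

set_option maxSynthPendingDepth 3 in
/-- If a causal geodesic stays in a small ball, then its affine parameter is bounded and it stays in
a compact set of the cotangent bundle. -/
theorem exists_compact_of_causal [FiniteDimensional ℝ E] {g : E → E →L[ℝ] E →L[ℝ] ℝ} {Ω : Set E}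
    (hg : IsMetricOn g Ω) {y₀ : E} {r : ℝ} (hB : Metric.closedBall y₀ r ⊆ Ω) {T₀ : E} {κ : ℝ}
    (hκ : 0 < κ) {τ : E →L[ℝ] ℝ} {c : ℝ → E × (E →L[ℝ] ℝ)} {A : Set ℝ} (hA : A.OrdConnected)
    (hc : ∀ t ∈ A, HasDerivAt c (hamField g (c t)) t)
    (hx : ∀ t ∈ A, (c t).1 ∈ Metric.closedBall y₀ r)
    (h1 : ∀ t ∈ A, κ * ‖raise g (c t)‖ ≤ τ (raise g (c t)))
    (h2 : ∀ t ∈ A, κ * ‖raise g (c t)‖ ≤ -g (c t).1 (raise g (c t)) T₀)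
    (h3 : ∀ t ∈ A, raise g (c t) ≠ 0) :
    ∃ K ⊆ Ω ×ˢ (univ : Set (E →L[ℝ] ℝ)), IsCompact K ∧ (∀ t ∈ A, c t ∈ K) ∧
      ∃ L, ∀ s ∈ A, ∀ t ∈ A, t - s ≤ L := by
  rcases A.eq_empty_or_nonempty with rfl | ⟨t₀, ht₀⟩
  · exact ⟨∅, empty_subset _, isCompact_empty, by simp, 0, by simp⟩
  have hcomp := isCompact_closedBall y₀ r
  obtain ⟨C₁, hC₁⟩ := hcomp.exists_bound_of_continuousOn
    ((hg.contDiffOn.continuousOn_fderiv_of_isOpen hg.isOpen (by simp)).mono hB)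
  obtain ⟨C₂, hC₂⟩ := hcomp.exists_bound_of_continuousOn (hg.contDiffOn.continuousOn.mono hB)
  have hC₁0 : 0 ≤ C₁ := (norm_nonneg _).trans (hC₁ _ (hx t₀ ht₀))
  have hC₂0 : 0 ≤ C₂ := (norm_nonneg _).trans (hC₂ _ (hx t₀ ht₀))
  set V : ℝ → E := fun t => raise g (c t) with hV
  have hVpos : ∀ t ∈ A, 0 < ‖V t‖ := fun t ht => norm_pos_iff.2 (h3 t ht)
  -- `u` is a coordinate time and `f` the energy with respect to the constant vector `T₀`. Both the
  -- rate of `u` and the value of `f` dominate `κ` times the speed.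
  set u : ℝ → ℝ := fun t => τ (c t).1 with hu
  set f : ℝ → ℝ := fun t => -(c t).2 T₀ with hf
  have hu' : ∀ t ∈ A, HasDerivAt u (τ (V t)) t := fun t ht =>
    τ.hasFDerivAt.comp_hasDerivAt t ((hc t ht).fst)
  have hf' : ∀ t ∈ A, HasDerivAt f (-(hamField g (c t)).2 T₀) t := fun t ht =>
    ((ContinuousLinearMap.apply ℝ ℝ T₀).hasFDerivAt.comp_hasDerivAt t ((hc t ht).snd)).neg
  have hfV : ∀ t ∈ A, f t = -g (c t).1 (V t) T₀ := fun t ht => by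
    rw [hf, hV]; exact congrArg Neg.neg (hg.apply_raise (hB (hx t ht)) T₀).symm
  have hfκ : ∀ t ∈ A, κ * ‖V t‖ ≤ f t := fun t ht => by rw [hfV t ht]; exact h2 t ht
  have hfpos : ∀ t ∈ A, 0 < f t := fun t ht =>
    (mul_pos hκ (hVpos t ht)).trans_le (hfκ t ht)
  set B := ‖τ‖ * (r + r)
  have huB : ∀ s ∈ A, ∀ t ∈ A, u t - u s ≤ B := fun s hs t ht => by
    have e1 : u t - u s = τ ((c t).1 - (c s).1) := by simp [hu]
    rw [e1]
    refine (le_abs_self _).trans ((τ.le_opNorm _).trans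
      (mul_le_mul_of_nonneg_left ?_ (norm_nonneg _)))
    rw [← dist_eq_norm]
    exact (dist_triangle_right _ _ y₀).trans (add_le_add (hx t ht) (hx s hs))
  -- The force is quadratic in the velocity, and `κ ^ 2 * ‖V t‖ ^ 2` is at most u' f, so |f'| ≤ D u'
  -- f. The logarithm of the energy is thus controlled by coordinate time, without reference to the
  -- affine parameter.
  set D := (1 / 2) * C₁ * ‖T₀‖ / κ ^ 2
  have hD0 : 0 ≤ D := by positivity
  have hf'b : ∀ t ∈ A, |(hamField g (c t)).2 T₀| ≤ D * τ (V t) * f t := by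
    intro t ht
    have e1 : |(hamField g (c t)).2 T₀| ≤ (1 / 2) * (C₁ * ‖T₀‖ * ‖V t‖ * ‖V t‖) := by
      rw [hamField_snd, abs_mul, abs_of_pos (by norm_num : (0 : ℝ) < 1 / 2)]
      refine mul_le_mul_of_nonneg_left ?_ (by norm_num)
      have e2 := (fderiv ℝ g (c t).1 T₀).le_opNorm₂ (V t) (V t)
      have e3 := (fderiv ℝ g (c t).1).le_opNorm T₀
      rw [Real.norm_eq_abs] at e2
      refine e2.trans ?_
      gcongr
      refine e3.trans ?_
      gcongr
      exact hC₁ _ (hx t ht)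
    refine e1.trans ?_
    have e4 : (κ * ‖V t‖) * (κ * ‖V t‖) ≤ τ (V t) * f t :=
      mul_le_mul (h1 t ht) (hfκ t ht) (by positivity)
        ((mul_nonneg hκ.le (norm_nonneg _)).trans (h1 t ht))
    have e5 := mul_le_mul_of_nonneg_left e4 hD0
    have e6 : D * (κ * ‖V t‖ * (κ * ‖V t‖)) = (1 / 2) * (C₁ * ‖T₀‖ * ‖V t‖ * ‖V t‖) := by
      simp only [D]; field_simp
    rw [← e6, mul_assoc D (τ (V t))]
    exact e5
  have hlog : ∀ t ∈ A, HasDerivAt (fun t => Real.log (f t))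
      (-(hamField g (c t)).2 T₀ / f t) t := fun t ht => (hf' t ht).log (hfpos t ht).ne'
  have hlogb : ∀ t ∈ A, |-(hamField g (c t)).2 T₀ / f t| ≤ D * τ (V t) := fun t ht => by
    rw [abs_div, abs_neg, abs_of_pos (hfpos t ht), div_le_iff₀ (hfpos t ht)]
    exact hf'b t ht
  -- The change of log f is at most `D` times the change of `u`, and `u` varies by at most `B` on
  -- the ball, so the energy stays between two positive constants.
  have hm1 : MonotoneOn (fun t => Real.log (f t) + D * u t) A :=
    monotoneOn_of_hasDerivAt_nonneg hA
      (fun t ht => (hlog t ht).add ((hu' t ht).const_mul D)) fun t ht => by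
        linarith [neg_abs_le (-(hamField g (c t)).2 T₀ / f t), hlogb t ht]
  have hm2 : MonotoneOn (fun t => D * u t - Real.log (f t)) A :=
    monotoneOn_of_hasDerivAt_nonneg hA
      (fun t ht => ((hu' t ht).const_mul D).sub (hlog t ht)) fun t ht => by
        linarith [le_abs_self (-(hamField g (c t)).2 T₀ / f t), hlogb t ht]
  have hDB : ∀ s ∈ A, ∀ t ∈ A, D * u t - D * u s ≤ D * B := fun s hs t ht => by
    rw [← mul_sub]; exact mul_le_mul_of_nonneg_left (huB s hs t ht) hD0
  have hbd : ∀ t ∈ A, |Real.log (f t) - Real.log (f t₀)| ≤ D * B := by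
    intro t ht
    rw [abs_le]
    rcases le_total t t₀ with h | h
    · have a1 := hm1 ht ht₀ h
      have a2 := hm2 ht ht₀ h
      have a3 := hDB t ht t₀ ht₀
      simp only at a1 a2
      constructor <;> linarith
    · have a1 := hm1 ht₀ ht h
      have a2 := hm2 ht₀ ht h
      have a3 := hDB t₀ ht₀ t ht
      simp only at a1 a2
      constructor <;> linarith
  set m := Real.exp (Real.log (f t₀) - D * B)
  set R := Real.exp (Real.log (f t₀) + D * B)
  have hfm : ∀ t ∈ A, m ≤ f t := fun t ht => by
    rw [← Real.exp_log (hfpos t ht)]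
    exact Real.exp_le_exp.2 (by linarith [(abs_le.1 (hbd t ht)).1])
  have hfR : ∀ t ∈ A, f t ≤ R := fun t ht => by
    rw [← Real.exp_log (hfpos t ht)]
    exact Real.exp_le_exp.2 (by linarith [(abs_le.1 (hbd t ht)).2])
  have hVR : ∀ t ∈ A, ‖V t‖ ≤ R / κ := fun t ht => by
    rw [le_div_iff₀ hκ, mul_comm]; exact (hfκ t ht).trans (hfR t ht)
  refine ⟨Metric.closedBall y₀ r ×ˢ Metric.closedBall 0 (C₂ * (R / κ)),
    prod_mono hB (subset_univ _), hcomp.prod (isCompact_closedBall _ _), fun t ht => ⟨hx t ht, ?_⟩,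
    ?_⟩
  · rw [mem_closedBall_zero_iff, ← hg.lower_raise (hB (hx t ht))]
    refine ((g (c t).1).le_opNorm _).trans ?_
    gcongr
    · exact hC₂ _ (hx t ht)
    · exact hVR t ht
  -- A lower bound for the energy is one for the speed, so `u` grows at rate at least `δ`; being
  -- bounded, it leaves only a bounded range of parameters. The summand 1 keeps the denominator
  -- positive.
  · set δ := κ * (m / (C₂ * ‖T₀‖ + 1))
    have hden : 0 < C₂ * ‖T₀‖ + 1 := by positivity
    have hδ : 0 < δ := by positivity
    have hδV : ∀ t ∈ A, δ ≤ τ (V t) := by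
      intro t ht
      refine le_trans ?_ (h1 t ht)
      refine mul_le_mul_of_nonneg_left ?_ hκ.le
      rw [div_le_iff₀ hden]
      refine (hfm t ht).trans ?_
      rw [hfV t ht]
      refine (neg_le_abs _).trans ?_
      refine ((g (c t).1).le_opNorm₂ (V t) T₀).trans ?_
      have e1 := mul_le_mul_of_nonneg_right (hC₂ _ (hx t ht))
        (mul_nonneg (norm_nonneg (V t)) (norm_nonneg T₀))
      nlinarith [norm_nonneg (V t)]
    have hm3 : MonotoneOn (fun t => u t - δ * t) A := by
      refine monotoneOn_of_hasDerivAt_nonneg hA (f' := fun t => τ (V t) - δ * 1)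
        (fun t ht => (hu' t ht).sub ((hasDerivAt_id t).const_mul δ)) fun t ht => ?_
      rw [mul_one]
      exact sub_nonneg.2 (hδV t ht)
    refine ⟨max 0 (B / δ), fun s hs t ht => ?_⟩
    rcases le_total t s with h | h
    · exact (sub_nonpos.2 h).trans (le_max_left _ _)
    · refine le_trans ?_ (le_max_right _ _)
      rw [le_div_iff₀ hδ]
      have a1 := hm3 hs ht h
      simp only at a1
      linarith [huB s hs t ht]

end Abstract

/-! ### Null geodesics are inextendible causal curves -/

section
variable {M : Type*} [TopologicalSpace M] [ChartedSpace (EuclideanSpace ℝ (Fin 4)) M]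
  [IsManifold (𝓡 4) ∞ M] (𝓜 : Spacetime M)

namespace Spacetime

theorem isLorentzian (x : M) : IsLorentzian (E := EuclideanSpace ℝ (Fin 4)) (𝓜.g x) :=
  ⟨𝓜.symm x, 𝓜.lorentzian x⟩

/-- The time-orienting vector field in the chart at `x₀`. -/
def coordT (x₀ : M) (y : EuclideanSpace ℝ (Fin 4)) : EuclideanSpace ℝ (Fin 4) :=
  coordD x₀ ((extChartAt (𝓡 4) x₀).symm y) (𝓜.T ((extChartAt (𝓡 4) x₀).symm y))

theorem coordT_chart {x₀ x : M} (hx : x ∈ (extChartAt (𝓡 4) x₀).source) :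
    𝓜.coordT x₀ (extChartAt (𝓡 4) x₀ x) = coordD x₀ x (𝓜.T x) := by
  rw [coordT, (extChartAt (𝓡 4) x₀).left_inv hx]

theorem contDiffOn_coordT (x₀ : M) :
    ContDiffOn ℝ ∞ (𝓜.coordT x₀) (extChartAt (𝓡 4) x₀).target := by
  let e := trivializationAt (EuclideanSpace ℝ (Fin 4)) (TangentSpace (𝓡 4) : M → Type _) x₀
  have he : e.baseSet = (extChartAt (𝓡 4) x₀).source := by
    rw [TangentBundle.trivializationAt_baseSet, extChartAt_source]
  have h1 : ContMDiffOn (𝓡 4).tangent ((𝓡 4).prod 𝓘(ℝ, EuclideanSpace ℝ (Fin 4))) ∞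
      e e.source := e.contMDiffOn
  have h2 : ContMDiffOn (𝓡 4) ((𝓡 4).prod 𝓘(ℝ, EuclideanSpace ℝ (Fin 4))) ∞
      (fun x => e ⟨x, 𝓜.T x⟩) (extChartAt (𝓡 4) x₀).source :=
    h1.comp 𝓜.T_smooth.contMDiffOn fun x hx => by
      rw [mem_preimage, e.mem_source, he]; exact hx
  have h3 : ContMDiffOn (𝓡 4) 𝓘(ℝ, EuclideanSpace ℝ (Fin 4)) ∞
      (fun x => coordD x₀ x (𝓜.T x)) (extChartAt (𝓡 4) x₀).source := by
    refine (contMDiff_snd.comp_contMDiffOn h2).congr fun x hx => ?_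
    rw [coordD_eq hx]
    exact congrFun (e.coe_linearMapAt_of_mem (R := ℝ) (by rw [he]; exact hx)) (𝓜.T x)
  exact contMDiffOn_iff_contDiffOn.1
    (h3.comp (contMDiffOn_extChartAt_symm x₀) fun y hy => (extChartAt (𝓡 4) x₀).map_target hy)

theorem continuous_apply_T : Continuous fun z : Cotangent 4 M => z.2 (𝓜.T z.1) := by
  refine continuous_iff_continuousAt.2 fun z₀ => ?_
  have hz : z₀.1 ∈ (extChartAt (𝓡 4) z₀.1).source := mem_extChartAt_source _
  have hκ := (contMDiffAt_cotChart hz).continuousAt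
  have hy := cotChart_fst_mem_target hz
  have h1 : ContinuousAt (fun z : Cotangent 4 M =>
      (cotChart z₀.1 z).2 (𝓜.coordT z₀.1 (cotChart z₀.1 z).1)) z₀ := by
    have h2 : ContinuousAt (𝓜.coordT z₀.1) (cotChart z₀.1 z₀).1 :=
      (𝓜.contDiffOn_coordT z₀.1).continuousOn.continuousAt
        ((isOpen_extChartAt_target z₀.1).mem_nhds hy)
    exact hκ.snd.clm_apply (ContinuousAt.comp (f := fun z : Cotangent 4 M => (cotChart z₀.1 z).1)
      h2 hκ.fst)
  refine h1.congr ?_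
  filter_upwards [(isOpen_cotChart_source z₀.1).mem_nhds (mem_cotChart_source.2 hz)] with z hz'
  rw [cotChart_fst, 𝓜.coordT_chart (mem_cotChart_source.1 hz'),
    cotChart_snd_coordD (mem_cotChart_source.1 hz')]

theorem g_sharp_sharp (z : Cotangent 4 M) :
    𝓜.g z.1 (𝓜.sharp z.1 z.2) (𝓜.sharp z.1 z.2) = 2 * 𝓜.hamiltonian z := by
  rw [𝓜.hamiltonian_eq]; ring

variable {𝓜}

/-- Since g(p♯, p♯) = 2H and g(p♯, T) = p(T), the bundle is the zero level of H inside an open set,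
the form needed for slice charts and for propagation along geodesics. -/
theorem mem_nullBundle_iff {z : Cotangent 4 M} :
    z ∈ 𝓜.nullBundle ↔ 𝓜.hamiltonian z = 0 ∧ z.2 (𝓜.T z.1) < 0 := by
  refine and_congr_right fun h => ?_
  have h1 := 𝓜.g_sharp_sharp z
  rw [h, mul_zero] at h1
  rw [IsFutureCausal, and_iff_right h1.le, 𝓜.g_sharp_apply]

theorem eq_zero_of_hamiltonian_eq_zero {z : Cotangent 4 M} (h : 𝓜.hamiltonian z = 0)
    (hT : z.2 (𝓜.T z.1) = 0) : z.2 = 0 := by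
  have h1 := 𝓜.g_sharp_sharp z
  rw [h, mul_zero] at h1
  have h2 : 𝓜.sharp z.1 z.2 = 0 :=
    (𝓜.isLorentzian z.1).eq_zero_of_orthogonal (𝓜.T_timelike z.1) h1.le
      ((𝓜.g_sharp_apply z.1 z.2 (𝓜.T z.1)).trans hT)
  have h3 := 𝓜.g_sharp z.1 z.2
  rw [h2, map_zero] at h3
  exact h3.symm

/-- H is conserved, and p(T) cannot change sign: where it vanished, the null covector p would be
zero, and by uniqueness the whole geodesic would be a constant zero covector. -/
theorem IsGeodesicFlowLine.mem_nullBundle [T2Space M] {c : ℝ → Cotangent 4 M} {J : Set ℝ}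
    (hJ : IsOpen J) (hJc : J.OrdConnected) (h : 𝓜.IsGeodesicFlowLine c J) {s t : ℝ}
    (hs : s ∈ J) (ht : t ∈ J) (hsN : c s ∈ 𝓜.nullBundle) : c t ∈ 𝓜.nullBundle := by
  have hH : ∀ t ∈ J, 𝓜.hamiltonian (c t) = 0 := fun t ht =>
    (h.hamiltonian_eq hJ hJc ht hs).trans hsN.1
  have hcont : ∀ t ∈ J, ContinuousAt (fun t => (c t).2 (𝓜.T (c t).1)) t := fun t ht =>
    𝓜.continuous_apply_T.continuousAt.comp (GeodesicAt.continuousAt (h t ht))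
  have hne : ∀ t ∈ J, (c t).2 (𝓜.T (c t).1) ≠ 0 := by
    intro t ht h0
    have h1 := eq_zero_of_hamiltonian_eq_zero (hH t ht) h0
    have h2 : EqOn c (fun _ => (⟨(c t).1, 0⟩ : Cotangent 4 M)) J :=
      h.eqOn hJ hJc (fun s _ => geodesicAt_const_zero _ s) ht (by rw [← h1])
    have h3 := (mem_nullBundle_iff.1 hsN).2
    rw [h2 hs] at h3
    exact lt_irrefl _ h3
  refine mem_nullBundle_iff.2 ⟨hH t ht, ?_⟩
  by_contra! hpos
  obtain ⟨r, hr, hr0⟩ := hJc.isPreconnected.intermediate_value hs ht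
    (fun t ht => (hcont t ht).continuousWithinAt)
    ⟨(mem_nullBundle_iff.1 hsN).2.le, hpos⟩
  exact hne r hr hr0

/-- The velocity of a geodesic is the vector dual to its momentum. -/
theorem GeodesicAt.mfderiv_proj {c : ℝ → Cotangent 4 M} {t : ℝ} (h : 𝓜.GeodesicAt c t) :
    mfderiv 𝓘(ℝ, ℝ) (𝓡 4) (fun s => (c s).1) t (1 : ℝ) = 𝓜.sharp (c t).1 (c t).2 := by
  have hz : (c t).1 ∈ (extChartAt (𝓡 4) (c t).1).source := mem_extChartAt_source _
  refine coordD_injective hz ?_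
  rw [← 𝓜.raise_cotChart hz, ← hamField_fst]
  have h1 : HasMFDerivAt 𝓘(ℝ, ℝ) (𝓡 4) (fun s => (c s).1) t _ :=
    ((contMDiff_proj (n := ∞) _ (c t)).mdifferentiableAt (by simp)).hasMFDerivAt.comp t
      h.1.hasMFDerivAt
  have h2 : HasMFDerivAt 𝓘(ℝ, ℝ) 𝓘(ℝ, EuclideanSpace ℝ (Fin 4))
      (fun s => extChartAt (𝓡 4) (c t).1 (c s).1) t _ :=
    (mdifferentiableAt_extChartAt (I := 𝓡 4) (mem_chart_source _ (c t).1)).hasMFDerivAt.comp t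
      h1
  have h3 := hasDerivAt_of_hasMFDerivAt h2
  have h4 : HasDerivAt (fun s => (cotChart (c t).1 (c s)).1) _ t := (h.hasDerivAt hz).fst
  simp only [cotChart_fst] at h4
  rw [h1.mfderiv]
  exact h3.unique h4

theorem GeodesicAt.isFutureCausal {c : ℝ → Cotangent 4 M} {t : ℝ} (h : 𝓜.GeodesicAt c t)
    (hN : c t ∈ 𝓜.nullBundle) : 𝓜.IsFutureCausal (c t).1
      (mfderiv 𝓘(ℝ, ℝ) (𝓡 4) (fun s => (c s).1) t (1 : ℝ)) := by
  rw [h.mfderiv_proj]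
  exact hN.2

/-- Near each point of `M`, geodesics have a uniform time of existence. -/
theorem exists_nhds_extension [T2Space M] {c : ℝ → Cotangent 4 M} {J : Set ℝ} (hJ : IsOpen J)
    (hJc : J.OrdConnected) (h0 : 0 ∈ J) (h : 𝓜.IsGeodesicFlowLine c J)
    (hmax : ∀ (c' : ℝ → Cotangent 4 M) (J' : Set ℝ), IsOpen J' → J'.OrdConnected → 0 ∈ J' →
        𝓜.IsGeodesicFlowLine c' J' → c' 0 = c 0 → J' ⊆ J)
    (hN : ∀ t ∈ J, c t ∈ 𝓜.nullBundle) (q : M) :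
    ∃ U ∈ 𝓝 q, ∀ A ⊆ J, A.OrdConnected → (∀ t ∈ A, (c t).1 ∈ U) →
      ∃ ε > 0, (∃ L, ∀ s ∈ A, ∀ t ∈ A, t - s ≤ L) ∧ ∀ t ∈ A, Ioo (t - ε) (t + ε) ⊆ J := by
  have hm := 𝓜.isMetricOn_coordMetric q
  set φ := extChartAt (𝓡 4) q
  have hq : q ∈ φ.source := mem_extChartAt_source q
  have hy : φ q ∈ φ.target := φ.map_source hq
  have hb : IsLorentzian (𝓜.coordMetric q (φ q)) := by
    refine ⟨hm.symm _ hy, coordD q q (𝓜.T q), ?_, fun w hw hTw => ?_⟩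
    · rw [𝓜.coordMetric_coordD hq]; exact 𝓜.T_timelike q
    · rw [← coordD_coordInv hq w, 𝓜.coordMetric_coordD hq] at hTw ⊢
      refine (𝓜.isLorentzian q).pos_of_orthogonal (𝓜.T_timelike q) hTw fun h => hw ?_
      rw [← coordD_coordInv hq w]
      exact (congrArg (coordD q q) h).trans (map_zero _)
  have hTq : 𝓜.coordMetric q (φ q) (𝓜.coordT q (φ q)) (𝓜.coordT q (φ q)) < 0 := by
    rw [𝓜.coordT_chart hq, 𝓜.coordMetric_coordD hq]; exact 𝓜.T_timelike q
  obtain ⟨κ, hκ, hcone⟩ := exists_cone_estimate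
    (hm.contDiffOn.continuousOn.continuousAt (hm.isOpen.mem_nhds hy))
    ((𝓜.contDiffOn_coordT q).continuousOn.continuousAt (hm.isOpen.mem_nhds hy)) hb hTq
  obtain ⟨r, hr, hball⟩ := Metric.nhds_basis_closedBall.mem_iff.1
    (inter_mem hcone (hm.isOpen.mem_nhds hy))
  refine ⟨φ.source ∩ φ ⁻¹' Metric.closedBall (φ q) r, inter_mem (extChartAt_source_mem_nhds q)
    ((continuousAt_extChartAt q) (Metric.closedBall_mem_nhds _ hr)), fun A hAJ hA hAU => ?_⟩
  have hz : ∀ t ∈ A, (c t).1 ∈ φ.source := fun t ht => (hAU t ht).1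
  have hest : ∀ t ∈ A, κ * ‖raise (𝓜.coordMetric q) (cotChart q (c t))‖ ≤
      -𝓜.coordMetric q (φ q) (𝓜.coordT q (φ q)) (raise (𝓜.coordMetric q) (cotChart q (c t))) ∧
      κ * ‖raise (𝓜.coordMetric q) (cotChart q (c t))‖ ≤
      -𝓜.coordMetric q (cotChart q (c t)).1 (raise (𝓜.coordMetric q) (cotChart q (c t)))
        (𝓜.coordT q (φ q)) := by
    intro t ht
    have hN' := hN t (hAJ ht)
    rw [cotChart_fst, 𝓜.raise_cotChart (hz t ht)]
    refine (hball (hAU t ht).2).1 _ ?_ ?_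
    · rw [𝓜.coordMetric_coordD (hz t ht)]; exact hN'.2.1
    · rw [𝓜.coordT_chart (hz t ht), 𝓜.coordMetric_coordD (hz t ht)]; exact hN'.2.2.le
  -- While the geodesic stays in the chart ball, its coordinates lie in a compact set `K`, and from
  -- `K` the flow runs for a uniform time `ε`.
  obtain ⟨K, hKΩ, hK, hKA, hL⟩ := exists_compact_of_causal hm (fun y hy => (hball hy).2) hκ
    (T₀ := 𝓜.coordT q (φ q))
    (τ := -𝓜.coordMetric q (φ q) (𝓜.coordT q (φ q))) (c := fun t => cotChart q (c t)) hA
    (fun t ht => GeodesicAt.hasDerivAt (h t (hAJ ht)) (hz t ht))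
    (fun t ht => by rw [cotChart_fst]; exact (hAU t ht).2)
    (fun t ht => (hest t ht).1) (fun t ht => (hest t ht).2) (fun t ht h0 => by
      rw [𝓜.raise_cotChart (hz t ht)] at h0
      have h1 : 𝓜.sharp (c t).1 (c t).2 = 0 :=
        coordD_injective (hz t ht) (h0.trans (map_zero _).symm)
      have h2 := (hN t (hAJ ht)).2.2
      rw [h1, map_zero] at h2
      exact lt_irrefl _ h2)
  rw [← cotChart_target] at hKΩ
  obtain ⟨ε, hε, hflow⟩ := 𝓜.exists_flowLine_of_mem q hK hKΩ
  refine ⟨ε, hε, hL, fun t ht => ?_⟩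
  obtain ⟨c', hc', hc'0⟩ := hflow _ (hKA t ht)
  rw [(cotChart q).left_inv (mem_cotChart_source.2 (hz t ht))] at hc'0
  have hshift : 𝓜.IsGeodesicFlowLine (fun s => c' (s + -t)) (Ioo (t - ε) (t + ε)) := fun s hs =>
    GeodesicAt.comp_add_const (hc' _ ⟨by linarith [hs.1], by linarith [hs.2]⟩)
  have htI : t ∈ Ioo (t - ε) (t + ε) := ⟨by linarith, by linarith⟩
  -- Gluing the short flow line from `c t` onto `c` gives a competitor through `c 0`, whose interval
  -- maximality absorbs into `J`.
  obtain ⟨c'', hc'', hE, -⟩ := h.union hJ isOpen_Ioo hJc ordConnected_Ioo hshift (hAJ ht) htI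
    (by rw [add_neg_cancel, hc'0])
  have := hmax c'' _ (hJ.union isOpen_Ioo)
    (hJc.isPreconnected.union t (hAJ ht) htI isPreconnected_Ioo).ordConnected (Or.inl h0) hc''
    (hE h0)
  exact subset_union_right.trans this

/-- Maximal null geodesics are inextendible causal curves. -/
theorem isInextendibleCausalCurve_of_maximal [T2Space M] {c : ℝ → Cotangent 4 M} {J : Set ℝ}
    (hJ : IsOpen J) (hJc : J.OrdConnected) (h0 : 0 ∈ J) (h : 𝓜.IsGeodesicFlowLine c J)
    (hmax : ∀ (c' : ℝ → Cotangent 4 M) (J' : Set ℝ), IsOpen J' → J'.OrdConnected → 0 ∈ J' →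
        𝓜.IsGeodesicFlowLine c' J' → c' 0 = c 0 → J' ⊆ J)
    (hN0 : c 0 ∈ 𝓜.nullBundle) : 𝓜.IsInextendibleCausalCurve (fun t => (c t).1) J := by
  have hN : ∀ t ∈ J, c t ∈ 𝓜.nullBundle := fun t ht => h.mem_nullBundle hJ hJc h0 ht hN0
  refine ⟨hJ, hJc, ⟨0, h0⟩, fun t ht => ?_, fun t ht => GeodesicAt.isFutureCausal (h t ht) (hN t ht),
    ?_, ?_⟩
  · exact ((contMDiff_proj (n := ∞) _ (c t)).comp t (h.contMDiffAt hJ ht)).contMDiffWithinAt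
  · rintro ⟨q, hq⟩
    obtain ⟨U, hU, H⟩ := exists_nhds_extension hJ hJc h0 h hmax hN q
    obtain ⟨t₀, ht₀, hA⟩ := hq U hU
    obtain ⟨ε, hε, ⟨L, hL⟩, hext⟩ := H (J ∩ Ici t₀) inter_subset_left (hJc.inter ordConnected_Ici)
      fun t ht => hA t ht.1 ht.2
    have hbdd : BddAbove (J ∩ Ici t₀) := ⟨t₀ + L, fun t ht => by
      linarith [hL t₀ ⟨ht₀, self_mem_Ici⟩ t ht]⟩
    -- A time within `ε / 2` of the supremum can be advanced by `ε / 2` inside `J`, which passes the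
    -- supremum.
    obtain ⟨t, ht, hlt⟩ := exists_lt_of_lt_csSup (s := J ∩ Ici t₀) ⟨t₀, ht₀, self_mem_Ici⟩
      (sub_lt_self (sSup (J ∩ Ici t₀)) (half_pos hε))
    have := le_csSup hbdd (show t + ε / 2 ∈ J ∩ Ici t₀ from
      ⟨hext t ht ⟨by linarith, by linarith⟩, le_trans (mem_Ici.1 ht.2) (by linarith : t ≤ t + ε / 2)⟩)
    linarith
  · rintro ⟨q, hq⟩
    obtain ⟨U, hU, H⟩ := exists_nhds_extension hJ hJc h0 h hmax hN q
    obtain ⟨t₀, ht₀, hA⟩ := hq U hU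
    obtain ⟨ε, hε, ⟨L, hL⟩, hext⟩ := H (J ∩ Iic t₀) inter_subset_left (hJc.inter ordConnected_Iic)
      fun t ht => hA t ht.1 ht.2
    have hbdd : BddBelow (J ∩ Iic t₀) := ⟨t₀ - L, fun t ht => by
      linarith [hL t ht t₀ ⟨ht₀, self_mem_Iic⟩]⟩
    obtain ⟨t, ht, hlt⟩ := exists_lt_of_csInf_lt (s := J ∩ Iic t₀) ⟨t₀, ht₀, self_mem_Iic⟩
      (lt_add_of_pos_right (sInf (J ∩ Iic t₀)) (half_pos hε))
    have := csInf_le hbdd (show t - ε / 2 ∈ J ∩ Iic t₀ from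
      ⟨hext t ht ⟨by linarith, by linarith⟩, le_trans (by linarith : t - ε / 2 ≤ t) (mem_Iic.1 ht.2)⟩)
    linarith

end Spacetime
end

/-! ### Spacelike hyperplanes and lifts of covectors -/

section Abstract
variable {E F : Type*} [NormedAddCommGroup E] [NormedSpace ℝ E] [NormedAddCommGroup F]
  [NormedSpace ℝ F]

/-- If b(v, n) ≥ 0, then `x` is a combination of `n` and `T` with nonnegative coefficients, hence
timelike, and it is orthogonal to `v`; a causal vector orthogonal to a timelike one is zero, against
b(v, T) < 0. So the time orientation can be tested with any future timelike vector. -/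
theorem IsLorentzian.neg_of_causal {b : E →L[ℝ] E →L[ℝ] ℝ} (hb : IsLorentzian b) {T n v : E}
    (hT : b T T < 0) (hn : b n n < 0) (hnT : b n T < 0) (hv : b v v ≤ 0) (hvT : b v T < 0) :
    b v n < 0 := by
  by_contra! h
  set x := (-b v T) • n + b v n • T with hx
  have h1 : b v x = 0 := by simp [hx]; ring
  have h2 : b x x < 0 := by
    have : b x x = (b v T) ^ 2 * b n n + 2 * (-b v T) * b v n * b n T + (b v n) ^ 2 * b T T := by
      have : b T n = b n T := hb.symm _ _
      simp [hx, this]; ring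
    rw [this]
    have e1 : (b v T) ^ 2 * b n n < 0 := mul_neg_of_pos_of_neg (sq_pos_of_neg hvT) hn
    have e2 : 2 * (-b v T) * b v n * b n T ≤ 0 :=
      mul_nonpos_of_nonneg_of_nonpos (mul_nonneg (by linarith) h) hnT.le
    have e3 : (b v n) ^ 2 * b T T ≤ 0 := mul_nonpos_of_nonneg_of_nonpos (sq_nonneg _) hT.le
    linarith
  rw [hb.eq_zero_of_orthogonal h2 hv h1] at hvT
  simp at hvT

/-- The pullback of a bilinear form. -/
def pullForm (D : F →L[ℝ] E) (b : E →L[ℝ] E →L[ℝ] ℝ) : F →L[ℝ] F →L[ℝ] ℝ :=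
  (ContinuousLinearMap.precomp ℝ D).comp (b.comp D)

theorem pullForm_apply (D : F →L[ℝ] E) (b : E →L[ℝ] E →L[ℝ] ℝ) (v w : F) :
    pullForm D b v w = b (D v) (D w) := rfl

/-- The component of `T` orthogonal to the range of `D`. -/
def normalPart (D : F →L[ℝ] E) (b : E →L[ℝ] E →L[ℝ] ℝ) (T : E) : E :=
  T - D ((pullForm D b).inverse ((b T).comp D))

/-- The unit normal to the range of `D`. -/
def unitNormal (D : F →L[ℝ] E) (b : E →L[ℝ] E →L[ℝ] ℝ) (T : E) : E :=
  (√(-b (normalPart D b T) (normalPart D b T)))⁻¹ • normalPart D b T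

/-- The vector dual to the lift of `v`. -/
def liftVec (D : F →L[ℝ] E) (b : E →L[ℝ] E →L[ℝ] ℝ) (T : E) (v : F →L[ℝ] ℝ) : E :=
  D ((pullForm D b).inverse v) + unitNormal D b T

/-- The lift of a covector `v` on a spacelike hyperplane. -/
def liftCov (D : F →L[ℝ] E) (b : E →L[ℝ] E →L[ℝ] ℝ) (T : E) (v : F →L[ℝ] ℝ) : E →L[ℝ] ℝ :=
  b (liftVec D b T v)

/-- The range of `D` is spacelike for the Lorentzian form `b`, which is time-oriented by `T`. -/
structure IsSpacelikeFor (D : F →L[ℝ] E) (b : E →L[ℝ] E →L[ℝ] ℝ) (T : E) : Prop where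
  lorentzian : IsLorentzian b
  timelike : b T T < 0
  spacelike : ∀ v, v ≠ 0 → 0 < b (D v) (D v)

namespace IsSpacelikeFor
variable {D : F →L[ℝ] E} {b : E →L[ℝ] E →L[ℝ] ℝ} {T : E} (h : IsSpacelikeFor D b T)
include h

theorem apply_nonneg (v : F) : 0 ≤ b (D v) (D v) := by
  rcases eq_or_ne v 0 with rfl | hv
  · simp
  · exact (h.spacelike v hv).le

theorem nondegenerate (v : F) (hv : ∀ w, pullForm D b v w = 0) : v = 0 := by
  by_contra hne
  exact (h.spacelike v hne).ne' (hv v)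

variable [FiniteDimensional ℝ F]

theorem pullForm_inverse (v : F →L[ℝ] ℝ) : pullForm D b ((pullForm D b).inverse v) = v := by
  obtain ⟨e, he⟩ := exists_equiv_dual h.nondegenerate
  rw [← he, ContinuousLinearMap.inverse_equiv]
  exact e.apply_symm_apply _

theorem apply_inverse (v : F →L[ℝ] ℝ) (w : F) :
    b (D ((pullForm D b).inverse v)) (D w) = v w := by
  rw [← pullForm_apply, h.pullForm_inverse]

theorem normalPart_apply (w : F) : b (normalPart D b T) (D w) = 0 := by
  rw [normalPart, map_sub, sub_apply, h.apply_inverse]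
  simp

theorem normalPart_apply_self :
    b (normalPart D b T) (normalPart D b T) = b (normalPart D b T) T := by
  conv_lhs => arg 2; rw [normalPart]
  rw [map_sub, h.normalPart_apply, sub_zero]

/-- Pythagoras: removing the spacelike tangential part from `T` only makes it more timelike. -/
theorem normalPart_neg : b (normalPart D b T) (normalPart D b T) < 0 := by
  have h1 : b T (normalPart D b T) = b (normalPart D b T) T := h.lorentzian.symm _ _
  set x := (pullForm D b).inverse ((b T).comp D) with hx
  have h2 : normalPart D b T = T - D x := rfl
  have h3 : b (normalPart D b T) T = b T T - b (D x) T := by rw [h2, map_sub, sub_apply]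
  have h4 : b (D x) T = b (D x) (D x) := by
    rw [h.lorentzian.symm, hx, h.apply_inverse]; rfl
  rw [h.normalPart_apply_self, h3, h4]
  linarith [h.timelike, h.apply_nonneg x]

theorem sqrt_pos : 0 < √(-b (normalPart D b T) (normalPart D b T)) :=
  Real.sqrt_pos.2 (neg_pos.2 h.normalPart_neg)

theorem unitNormal_apply (w : F) : b (unitNormal D b T) (D w) = 0 := by
  rw [unitNormal, map_smul, smul_apply, h.normalPart_apply, smul_zero]

theorem unitNormal_apply_self : b (unitNormal D b T) (unitNormal D b T) = -1 := by
  have h1 := Real.mul_self_sqrt (neg_pos.2 h.normalPart_neg).le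
  have h2 := h.sqrt_pos
  simp only [unitNormal, map_smul, smul_apply, smul_eq_mul]
  set s := √(-b (normalPart D b T) (normalPart D b T))
  rw [← neg_eq_iff_eq_neg, ← mul_neg, ← mul_neg, ← h1]
  field_simp

theorem unitNormal_apply_T : b (unitNormal D b T) T < 0 := by
  rw [unitNormal, map_smul, smul_apply, smul_eq_mul, ← h.normalPart_apply_self]
  exact mul_neg_of_pos_of_neg (inv_pos.2 h.sqrt_pos) h.normalPart_neg

theorem liftVec_apply (v : F →L[ℝ] ℝ) (w : F) : b (liftVec D b T v) (D w) = v w := by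
  rw [liftVec, map_add, add_apply, h.apply_inverse, h.unitNormal_apply, add_zero]

theorem liftVec_apply_unitNormal (v : F →L[ℝ] ℝ) :
    b (liftVec D b T v) (unitNormal D b T) = -1 := by
  rw [liftVec, map_add, add_apply, h.unitNormal_apply_self, h.lorentzian.symm, h.unitNormal_apply,
    zero_add]

/-- The tangential part contributes the squared length of `v` and the unit normal contributes -1, so
the lift is null exactly for unit covectors. -/
theorem liftVec_apply_self (v : F →L[ℝ] ℝ) :
    b (liftVec D b T v) (liftVec D b T v) = v ((pullForm D b).inverse v) - 1 := by
  conv_lhs => arg 2; rw [liftVec]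
  rw [map_add, h.liftVec_apply, h.liftVec_apply_unitNormal]
  ring

theorem liftVec_apply_T {v : F →L[ℝ] ℝ} (hv : v ((pullForm D b).inverse v) ≤ 1) :
    b (liftVec D b T v) T < 0 := by
  refine h.lorentzian.neg_of_causal (T := unitNormal D b T) ?_ h.timelike ?_ ?_ ?_
  · rw [h.unitNormal_apply_self]; norm_num
  · rw [h.lorentzian.symm]; exact h.unitNormal_apply_T
  · rw [h.liftVec_apply_self]; linarith
  · rw [h.liftVec_apply_unitNormal]; norm_num

variable [FiniteDimensional ℝ E] (hdim : Module.finrank ℝ E = Module.finrank ℝ F + 1)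
include hdim

/-- By dimension the range of `D` and the unit normal together fill `E`; the tangential component of
a vector orthogonal to the range vanishes because the form is positive definite there. -/
theorem exists_eq_smul_unitNormal {U : E} (hU : ∀ w, b U (D w) = 0) :
    ∃ a : ℝ, U = a • unitNormal D b T := by
  let L : (F × ℝ) →ₗ[ℝ] E := (D : F →ₗ[ℝ] E).coprod (LinearMap.toSpanSingleton ℝ E
    (unitNormal D b T))
  have hL : ∀ p, L p = D p.1 + p.2 • unitNormal D b T := fun p => rfl
  have hinj : Function.Injective L := by
    refine (injective_iff_map_eq_zero _).2 fun p hp => ?_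
    rw [hL] at hp
    have h1 : p.2 = 0 := by
      have := congrArg (fun x => b (unitNormal D b T) x) hp
      simp only [map_add, map_smul, h.unitNormal_apply, h.unitNormal_apply_self, map_zero,
        smul_eq_mul] at this
      linarith
    rw [h1, zero_smul, add_zero] at hp
    refine Prod.ext ?_ h1
    by_contra hne
    have := h.spacelike p.1 hne
    rw [hp] at this
    simp at this
  obtain ⟨p, hp⟩ := (LinearMap.injective_iff_surjective_of_finrank_eq_finrank
    (by rw [Module.finrank_prod, Module.finrank_self, hdim])).1 hinj U
  rw [hL] at hp
  have h2 : p.1 = 0 := by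
    by_contra hne
    have h3 := hU p.1
    rw [← hp, map_add, add_apply, map_smul, smul_apply, h.unitNormal_apply, smul_zero,
      add_zero] at h3
    exact (h.spacelike _ hne).ne' h3
  exact ⟨p.2, by rw [← hp, h2, map_zero, zero_add]⟩

omit [FiniteDimensional ℝ E] hdim in
theorem apply_unitNormal_neg {V : E} (hV : b V V = 0) (hVT : b V T < 0) :
    b V (unitNormal D b T) < 0 :=
  h.lorentzian.neg_of_causal h.timelike (by rw [h.unitNormal_apply_self]; norm_num)
    h.unitNormal_apply_T hV.le hVT

/-- A future null vector is determined by the restriction of its dual covector to a spacelike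
hyperplane. -/
theorem eq_of_null {V V' : E} (hV : b V V = 0) (hVT : b V T < 0) (hV' : b V' V' = 0)
    (hVT' : b V' T < 0) (heq : ∀ w, b V (D w) = b V' (D w)) : V = V' := by
  obtain ⟨a, ha⟩ := h.exists_eq_smul_unitNormal hdim (U := V - V') fun w => by
    rw [map_sub, sub_apply, heq, sub_self]
  have e1 := h.apply_unitNormal_neg hV hVT
  have e2 := h.apply_unitNormal_neg hV' hVT'
  have e3 : V = V' + a • unitNormal D b T := by rw [← ha]; abel
  have e5 : b (unitNormal D b T) V' = b V' (unitNormal D b T) := h.lorentzian.symm _ _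
  have e4 : b V V = b V' V' + 2 * a * b V' (unitNormal D b T) - a ^ 2 := by
    rw [e3]
    simp only [map_add, map_smul, add_apply, smul_apply, smul_eq_mul, e5, h.unitNormal_apply_self]
    ring
  have e6 : b V (unitNormal D b T) = b V' (unitNormal D b T) - a := by
    rw [e3]
    simp only [map_add, map_smul, add_apply, smul_apply, smul_eq_mul, h.unitNormal_apply_self]
    ring
  -- The other root, a = 2 b(V', n) with n the unit normal, is the reflection of `V'` in the
  -- hyperplane; its pairing with n has the opposite sign, so it points to the past.
  have e7 : a = 0 := by
    by_contra hne
    rw [hV, hV'] at e4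
    have : a * (2 * b V' (unitNormal D b T) - a) = 0 := by linarith
    have := (mul_eq_zero.1 this).resolve_left hne
    linarith
  rw [e3, e7, zero_smul, add_zero]

/-- A vector orthogonal to the hyperplane is a multiple of the timelike unit normal, and the only
null one among these is zero. -/
theorem exists_apply_ne_zero {V : E} (hV : b V V = 0) (hVT : b V T < 0) :
    (b V).comp D ≠ 0 := by
  intro h0
  obtain ⟨a, ha⟩ := h.exists_eq_smul_unitNormal hdim (U := V) fun w =>
    congrArg (fun l : F →L[ℝ] ℝ => l w) h0
  have : a = 0 := by
    rw [ha] at hV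
    simp only [map_smul, smul_apply, smul_eq_mul, h.unitNormal_apply_self] at hV
    nlinarith
  rw [ha, this] at hVT
  simp at hVT

omit [FiniteDimensional ℝ E] hdim in
theorem conorm_pos {v : F →L[ℝ] ℝ} (hv : v ≠ 0) : 0 < v ((pullForm D b).inverse v) := by
  have h1 : (pullForm D b).inverse v ≠ 0 := fun h0 => hv (by
    rw [← h.pullForm_inverse v, h0, map_zero])
  rw [← h.apply_inverse]
  exact h.spacelike _ h1

omit [FiniteDimensional ℝ E] hdim h [FiniteDimensional ℝ F] in
theorem conorm_smul (a : ℝ) (v : F →L[ℝ] ℝ) :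
    (a • v) ((pullForm D b).inverse (a • v)) = a ^ 2 * v ((pullForm D b).inverse v) := by
  simp only [map_smul, smul_apply, smul_eq_mul]
  ring

/-- Both sides correspond to future null vectors with the same restriction, so `eq_of_null` applies.
The lift can thus be recognised in any chart without following the unit normal through the
coordinate change. -/
theorem eq_smul_liftCov {V : E} (hV : b V V = 0) (hVT : b V T < 0) {v : F →L[ℝ] ℝ} {s : ℝ}
    (hs : 0 < s) (hv : v ((pullForm D b).inverse v) = 1) (hVv : (b V).comp D = s • v) :
    b V = s • liftCov D b T v := by
  rw [liftCov, ← map_smul]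
  congr 1
  refine h.eq_of_null hdim hV hVT ?_ ?_ fun w => ?_
  · simp [h.liftVec_apply_self, hv]
  · rw [map_smul, smul_apply, smul_eq_mul]
    exact mul_neg_of_pos_of_neg hs (h.liftVec_apply_T hv.le)
  · rw [map_smul, smul_apply, h.liftVec_apply]
    exact congrArg (fun l : F →L[ℝ] ℝ => l w) hVv

end IsSpacelikeFor

section Smooth
variable [FiniteDimensional ℝ F] {P : Type*} [NormedAddCommGroup P] [NormedSpace ℝ P] {p : P}
  {D : P → F →L[ℝ] E} {b : P → E →L[ℝ] E →L[ℝ] ℝ} {T : P → E} {v : P → F →L[ℝ] ℝ}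

set_option maxSynthPendingDepth 3 in
omit [FiniteDimensional ℝ F] in
theorem contDiffAt_pullForm (hD : ContDiffAt ℝ ∞ D p) (hb : ContDiffAt ℝ ∞ b p) :
    ContDiffAt ℝ ∞ (fun p => pullForm (D p) (b p)) p := by
  have h1 : ContDiffAt ℝ ∞ (fun p => (ContinuousLinearMap.compL ℝ F E ℝ).flip (D p)) p :=
    (ContinuousLinearMap.compL ℝ F E ℝ).flip.contDiff.contDiffAt.comp p hD
  exact h1.clm_comp (hb.clm_comp hD)

theorem contDiffAt_inverse_pullForm (hD : ContDiffAt ℝ ∞ D p) (hb : ContDiffAt ℝ ∞ b p)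
    (hv : ContDiffAt ℝ ∞ v p) (h : IsSpacelikeFor (D p) (b p) (T p)) :
    ContDiffAt ℝ ∞ (fun p => (pullForm (D p) (b p)).inverse (v p)) p := by
  have := FiniteDimensional.complete ℝ F
  obtain ⟨e, he⟩ := exists_equiv_dual h.nondegenerate
  have h2 : ContDiffAt ℝ ∞ ContinuousLinearMap.inverse (pullForm (D p) (b p)) := by
    rw [← he]; exact contDiffAt_map_inverse e
  exact (h2.comp p (contDiffAt_pullForm hD hb)).clm_apply hv

theorem contDiffAt_liftCov (hD : ContDiffAt ℝ ∞ D p) (hb : ContDiffAt ℝ ∞ b p)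
    (hT : ContDiffAt ℝ ∞ T p) (hv : ContDiffAt ℝ ∞ v p)
    (h : IsSpacelikeFor (D p) (b p) (T p)) :
    ContDiffAt ℝ ∞ (fun p => liftCov (D p) (b p) (T p) (v p)) p := by
  have h1 : ContDiffAt ℝ ∞ (fun p => (b p (T p)).comp (D p)) p :=
    (hb.clm_apply hT).clm_comp hD
  have h2 : ContDiffAt ℝ ∞ (fun p => normalPart (D p) (b p) (T p)) p :=
    hT.sub (hD.clm_apply (contDiffAt_inverse_pullForm hD hb h1 h))
  have h3 : ContDiffAt ℝ ∞ (fun p => unitNormal (D p) (b p) (T p)) p :=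
    (((hb.clm_apply h2).clm_apply h2).neg.sqrt (neg_pos.2 h.normalPart_neg).ne' |>.inv
      h.sqrt_pos.ne').smul h2
  exact hb.clm_apply ((hD.clm_apply (contDiffAt_inverse_pullForm hD hb hv h)).add h3)

end Smooth

end Abstract

/-! ### Spacelike hypersurfaces in coordinates -/

section
variable {M : Type*} [TopologicalSpace M] [ChartedSpace (EuclideanSpace ℝ (Fin 4)) M]
  [IsManifold (𝓡 4) ∞ M] {𝓜 : Spacetime M}
  {S : Type*} [TopologicalSpace S] [ChartedSpace (EuclideanSpace ℝ (Fin 3)) S]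
  [IsManifold (𝓡 3) ∞ S] {ι : S → M}

namespace Spacetime

theorem isLorentzian_coordMetric {x₀ x : M} (hx : x ∈ (extChartAt (𝓡 4) x₀).source) :
    IsLorentzian (𝓜.coordMetric x₀ (extChartAt (𝓡 4) x₀ x)) := by
  refine ⟨(𝓜.isMetricOn_coordMetric x₀).symm _ ((extChartAt (𝓡 4) x₀).map_source hx),
    coordD x₀ x (𝓜.T x), ?_, fun w hw hTw => ?_⟩
  · rw [𝓜.coordMetric_coordD hx]; exact 𝓜.T_timelike x
  · rw [← coordD_coordInv hx w, 𝓜.coordMetric_coordD hx] at hTw ⊢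
    refine (𝓜.isLorentzian x).pos_of_orthogonal (𝓜.T_timelike x) hTw fun h => hw ?_
    rw [← coordD_coordInv hx w]
    exact (congrArg (coordD x₀ x) h).trans (map_zero _)

theorem IsCauchySurface.isSpacelikeFor (hι : 𝓜.IsCauchySurface ι) (x : S) :
    IsSpacelikeFor (E := EuclideanSpace ℝ (Fin 4)) (F := EuclideanSpace ℝ (Fin 3))
      (mfderiv (𝓡 3) (𝓡 4) ι x) (𝓜.g (ι x)) (𝓜.T (ι x)) :=
  ⟨𝓜.isLorentzian _, 𝓜.T_timelike _, hι.spacelike x⟩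

variable (ι) in
/-- The map `ι` in the charts at `x₀` and `ι x₀`. -/
def coordEmb (x₀ : S) (y : EuclideanSpace ℝ (Fin 3)) : EuclideanSpace ℝ (Fin 4) :=
  extChartAt (𝓡 4) (ι x₀) (ι ((extChartAt (𝓡 3) x₀).symm y))

variable (ι) in
/-- The domain of `coordEmb`. -/
def coordDomain (x₀ : S) : Set (EuclideanSpace ℝ (Fin 3)) :=
  (extChartAt (𝓡 3) x₀).target ∩
    (extChartAt (𝓡 3) x₀).symm ⁻¹' (ι ⁻¹' (extChartAt (𝓡 4) (ι x₀)).source)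

theorem coordEmb_chart {x₀ x : S} (hx : x ∈ (extChartAt (𝓡 3) x₀).source) :
    coordEmb ι x₀ (extChartAt (𝓡 3) x₀ x) = extChartAt (𝓡 4) (ι x₀) (ι x) := by
  rw [coordEmb, (extChartAt (𝓡 3) x₀).left_inv hx]

theorem chart_mem_coordDomain {x₀ x : S} (hx : x ∈ (extChartAt (𝓡 3) x₀).source)
    (hx' : ι x ∈ (extChartAt (𝓡 4) (ι x₀)).source) :
    extChartAt (𝓡 3) x₀ x ∈ coordDomain ι x₀ :=
  ⟨(extChartAt (𝓡 3) x₀).map_source hx, by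
    rwa [mem_preimage, mem_preimage, (extChartAt (𝓡 3) x₀).left_inv hx]⟩

namespace IsCauchySurface
variable (hι : 𝓜.IsCauchySurface ι)
include hι

theorem isOpen_coordDomain (x₀ : S) : IsOpen (coordDomain ι x₀) :=
  (continuousOn_extChartAt_symm x₀).isOpen_inter_preimage (isOpen_extChartAt_target x₀)
    ((isOpen_extChartAt_source (ι x₀)).preimage hι.smooth.continuous)

theorem contDiffOn_coordEmb (x₀ : S) : ContDiffOn ℝ ∞ (coordEmb ι x₀) (coordDomain ι x₀) := by
  have h1 : ContMDiffOn 𝓘(ℝ, EuclideanSpace ℝ (Fin 3)) (𝓡 4) ∞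
      (ι ∘ (extChartAt (𝓡 3) x₀).symm) (coordDomain ι x₀) :=
    hι.smooth.comp_contMDiffOn ((contMDiffOn_extChartAt_symm x₀).mono inter_subset_left)
  have h2 := contMDiffOn_extChartAt (I := 𝓡 4) (n := ∞) (x := ι x₀)
  rw [← extChartAt_source (𝓡 4)] at h2
  exact contMDiffOn_iff_contDiffOn.1 (h2.comp h1 fun y hy => hy.2)

theorem fderiv_coordEmb {x₀ x : S} (hx : x ∈ (extChartAt (𝓡 3) x₀).source)
    (hx' : ι x ∈ (extChartAt (𝓡 4) (ι x₀)).source) (v : TangentSpace (𝓡 3) x) :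
    fderiv ℝ (coordEmb ι x₀) (extChartAt (𝓡 3) x₀ x) (coordD x₀ x v) =
      coordD (ι x₀) (ι x) (mfderiv (𝓡 3) (𝓡 4) ι x v) := by
  have hy := chart_mem_coordDomain hx hx'
  have h1 : HasFDerivAt (coordEmb ι x₀) _ (extChartAt (𝓡 3) x₀ x) :=
    (((hι.contDiffOn_coordEmb x₀).contDiffAt
      ((hι.isOpen_coordDomain x₀).mem_nhds hy)).differentiableAt (by simp)).hasFDerivAt
  have hxc : x ∈ (chartAt (EuclideanSpace ℝ (Fin 3)) x₀).source := by
    rwa [← extChartAt_source (𝓡 3)]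
  have hxc' : ι x ∈ (chartAt (EuclideanSpace ℝ (Fin 4)) (ι x₀)).source := by
    rwa [← extChartAt_source (𝓡 4)]
  have h2 : HasMFDerivAt (𝓡 3) 𝓘(ℝ, EuclideanSpace ℝ (Fin 4))
      (coordEmb ι x₀ ∘ extChartAt (𝓡 3) x₀) x _ :=
    h1.hasMFDerivAt.comp x (mdifferentiableAt_extChartAt (I := 𝓡 3) hxc).hasMFDerivAt
  have h3 : HasMFDerivAt (𝓡 3) 𝓘(ℝ, EuclideanSpace ℝ (Fin 4))
      (extChartAt (𝓡 4) (ι x₀) ∘ ι) x _ :=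
    (mdifferentiableAt_extChartAt (I := 𝓡 4) hxc').hasMFDerivAt.comp x
      ((hι.smooth x).mdifferentiableAt (by simp)).hasMFDerivAt
  have h4 : HasMFDerivAt (𝓡 3) 𝓘(ℝ, EuclideanSpace ℝ (Fin 4))
      (coordEmb ι x₀ ∘ extChartAt (𝓡 3) x₀) x _ := h3.congr_of_eventuallyEq (by
    filter_upwards [(isOpen_extChartAt_source x₀).mem_nhds hx] with x' hx''
    exact coordEmb_chart hx'')
  exact congrArg (fun l => l v) (hasMFDerivAt_unique h2 h4)

end IsCauchySurface

variable (𝓜 ι) in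
/-- The induced metric in the chart at `x₀`. -/
def coordInduced (x₀ : S) (y : EuclideanSpace ℝ (Fin 3)) :
    EuclideanSpace ℝ (Fin 3) →L[ℝ] EuclideanSpace ℝ (Fin 3) →L[ℝ] ℝ :=
  pullForm (fderiv ℝ (coordEmb ι x₀) y) (𝓜.coordMetric (ι x₀) (coordEmb ι x₀ y))

namespace IsCauchySurface
variable (hι : 𝓜.IsCauchySurface ι)
include hι

theorem coordInduced_coordD {x₀ x : S} (hx : x ∈ (extChartAt (𝓡 3) x₀).source)
    (hx' : ι x ∈ (extChartAt (𝓡 4) (ι x₀)).source) (v w : TangentSpace (𝓡 3) x) :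
    𝓜.coordInduced ι x₀ (extChartAt (𝓡 3) x₀ x) (coordD x₀ x v) (coordD x₀ x w) =
      𝓜.inducedMetric ι x v w := by
  rw [coordInduced, pullForm_apply, hι.fderiv_coordEmb hx hx', hι.fderiv_coordEmb hx hx',
    coordEmb_chart hx, 𝓜.coordMetric_coordD hx']
  rfl

theorem isSpacelikeFor_coord {x₀ : S} {y : EuclideanSpace ℝ (Fin 3)} (hy : y ∈ coordDomain ι x₀) :
    IsSpacelikeFor (fderiv ℝ (coordEmb ι x₀) y) (𝓜.coordMetric (ι x₀) (coordEmb ι x₀ y))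
      (𝓜.coordT (ι x₀) (coordEmb ι x₀ y)) := by
  set x := (extChartAt (𝓡 3) x₀).symm y with hxdef
  have hx : x ∈ (extChartAt (𝓡 3) x₀).source := (extChartAt (𝓡 3) x₀).map_target hy.1
  have hx' : ι x ∈ (extChartAt (𝓡 4) (ι x₀)).source := hy.2
  have hyx : y = extChartAt (𝓡 3) x₀ x := ((extChartAt (𝓡 3) x₀).right_inv hy.1).symm
  refine ⟨isLorentzian_coordMetric hx', ?_, fun v hv => ?_⟩
  · rw [hyx, coordEmb_chart hx, 𝓜.coordT_chart hx', 𝓜.coordMetric_coordD hx']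
    exact 𝓜.T_timelike _
  · rw [hyx, ← coordD_coordInv hx v, hι.fderiv_coordEmb hx hx', coordEmb_chart hx,
      𝓜.coordMetric_coordD hx']
    refine hι.spacelike x _ fun h0 => hv ?_
    rw [← coordD_coordInv hx v]
    exact (congrArg (coordD x₀ x) h0).trans (map_zero _)

theorem contDiffOn_coordMetric_coordEmb (x₀ : S) :
    ContDiffOn ℝ ∞ (fun y => 𝓜.coordMetric (ι x₀) (coordEmb ι x₀ y)) (coordDomain ι x₀) :=
  (𝓜.isMetricOn_coordMetric (ι x₀)).contDiffOn.comp (hι.contDiffOn_coordEmb x₀) fun _ hy =>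
    (extChartAt (𝓡 4) (ι x₀)).map_source hy.2

theorem contDiffOn_coordT_coordEmb (x₀ : S) :
    ContDiffOn ℝ ∞ (fun y => 𝓜.coordT (ι x₀) (coordEmb ι x₀ y)) (coordDomain ι x₀) :=
  (𝓜.contDiffOn_coordT (ι x₀)).comp (hι.contDiffOn_coordEmb x₀) fun _ hy =>
    (extChartAt (𝓡 4) (ι x₀)).map_source hy.2

theorem contDiffOn_fderiv_coordEmb (x₀ : S) :
    ContDiffOn ℝ ∞ (fderiv ℝ (coordEmb ι x₀)) (coordDomain ι x₀) :=
  (hι.contDiffOn_coordEmb x₀).fderiv_of_isOpen (hι.isOpen_coordDomain x₀) (by simp)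

theorem isMetricOn_coordInduced (x₀ : S) :
    IsMetricOn (𝓜.coordInduced ι x₀) (coordDomain ι x₀) where
  isOpen := hι.isOpen_coordDomain x₀
  contDiffOn y hy := by
    have hn := (hι.isOpen_coordDomain x₀).mem_nhds hy
    exact (contDiffAt_pullForm ((hι.contDiffOn_fderiv_coordEmb x₀).contDiffAt hn)
      ((hι.contDiffOn_coordMetric_coordEmb x₀).contDiffAt hn)).contDiffWithinAt
  symm y hy v w := (hι.isSpacelikeFor_coord hy).lorentzian.symm _ _
  nondegenerate y hy := (hι.isSpacelikeFor_coord hy).nondegenerate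

theorem raise_cotChart_induced {x₀ : S} {u : Cotangent 3 S}
    (hx : u.1 ∈ (extChartAt (𝓡 3) x₀).source)
    (hx' : ι u.1 ∈ (extChartAt (𝓡 4) (ι x₀)).source) :
    raise (𝓜.coordInduced ι x₀) (cotChart x₀ u) =
      coordD x₀ u.1 ((𝓜.inducedMetric ι u.1).inverse u.2) := by
  rw [← (hι.isMetricOn_coordInduced x₀).raise_lower (chart_mem_coordDomain hx hx')
    (coordD x₀ u.1 ((𝓜.inducedMetric ι u.1).inverse u.2))]
  congr 1
  refine Prod.ext (cotChart_fst x₀ u) (ContinuousLinearMap.ext fun v => ?_)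
  have h1 := hι.coordInduced_coordD hx hx' ((𝓜.inducedMetric ι u.1).inverse u.2)
    (coordInv x₀ u.1 v)
  rw [coordD_coordInv hx] at h1
  rw [cotChart_snd_apply hx, h1]
  exact (congrArg (fun l => l (coordInv x₀ u.1 v))
    ((hι.isSpacelikeFor u.1).pullForm_inverse u.2)).symm

theorem two_mul_ham_cotChart_induced {x₀ : S} {u : Cotangent 3 S}
    (hx : u.1 ∈ (extChartAt (𝓡 3) x₀).source)
    (hx' : ι u.1 ∈ (extChartAt (𝓡 4) (ι x₀)).source) :
    2 * ham (𝓜.coordInduced ι x₀) (cotChart x₀ u) =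
      u.2 ((𝓜.inducedMetric ι u.1).inverse u.2) := by
  rw [ham, hι.raise_cotChart_induced hx hx', cotChart_snd_coordD hx]
  ring

theorem isOpen_chartDomain (x₀ : S) : IsOpen {u : Cotangent 3 S |
    u.1 ∈ (extChartAt (𝓡 3) x₀).source ∧ ι u.1 ∈ (extChartAt (𝓡 4) (ι x₀)).source} :=
  ((isOpen_extChartAt_source x₀).inter
    ((isOpen_extChartAt_source (ι x₀)).preimage hι.smooth.continuous)).preimage
    continuous_cotangent_proj

end IsCauchySurface

/-! ### The smooth structures on the null bundle and the unit cotangent bundle -/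

/-- In a fibre direction `P` the derivative is `P` evaluated on the raised covector, and some
functional does not vanish there. -/
theorem fderiv_ham_ne_zero {E : Type*} [NormedAddCommGroup E] [NormedSpace ℝ E]
    [FiniteDimensional ℝ E] {g : E → E →L[ℝ] E →L[ℝ] ℝ} {Ω : Set E} (hg : IsMetricOn g Ω)
    {z : E × (E →L[ℝ] ℝ)} (hz : z.1 ∈ Ω) (h : raise g z ≠ 0) : fderiv ℝ (ham g) z ≠ 0 := by
  obtain ⟨P, hP⟩ := SeparatingDual.exists_ne_zero (R := ℝ) h
  intro h0
  have h1 := hg.fderiv_ham hz (0, P)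
  rw [h0] at h1
  simp only [zero_apply, map_zero, sub_zero, hamField_fst] at h1
  exact hP h1.symm

theorem finrank_prod_dual {E : Type*} [NormedAddCommGroup E] [NormedSpace ℝ E]
    [FiniteDimensional ℝ E] :
    Module.finrank ℝ (E × (E →L[ℝ] ℝ)) = Module.finrank ℝ E + Module.finrank ℝ E := by
  rw [Module.finrank_prod]
  congr 1
  rw [← Subspace.dual_finrank_eq (K := ℝ) (V := E)]
  exact (LinearEquiv.finrank_eq
    (LinearMap.toContinuousLinearMap : (E →ₗ[ℝ] ℝ) ≃ₗ[ℝ] (E →L[ℝ] ℝ))).symm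

theorem sharp_ne_zero {z : Cotangent 4 M} (hz : z ∈ 𝓜.nullBundle) : 𝓜.sharp z.1 z.2 ≠ 0 := by
  intro h
  have := hz.2.2
  rw [h, map_zero] at this
  exact lt_irrefl _ this

theorem coordD_ne_zero {n : ℕ} {X : Type*} [TopologicalSpace X]
    [ChartedSpace (EuclideanSpace ℝ (Fin n)) X] [IsManifold (𝓡 n) ∞ X] {x₀ x : X}
    (hx : x ∈ (extChartAt (𝓡 n) x₀).source) {v : TangentSpace (𝓡 n) x} (hv : v ≠ 0) :
    coordD x₀ x v ≠ 0 := fun h => hv (coordD_injective hx (h.trans (map_zero _).symm))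

theorem contMDiffAt_hamiltonian (z : Cotangent 4 M) :
    ContMDiffAt (cotangentModel 4) 𝓘(ℝ, ℝ) ∞ 𝓜.hamiltonian z := by
  have hz : z.1 ∈ (extChartAt (𝓡 4) z.1).source := mem_extChartAt_source _
  have hm := 𝓜.isMetricOn_coordMetric z.1
  have h1 : ContDiffAt ℝ ∞ (ham (𝓜.coordMetric z.1)) (cotChart z.1 z) :=
    hm.contDiffOn_ham.contDiffAt (hm.isOpen_domain.mem_nhds
      ⟨cotChart_fst_mem_target hz, mem_univ _⟩)
  refine (h1.contMDiffAt.comp z (contMDiffAt_cotChart hz)).congr_of_eventuallyEq ?_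
  filter_upwards [(isOpen_cotChart_source z.1).mem_nhds (mem_cotChart_source.2 hz)] with z' hz'
  exact (𝓜.ham_cotChart (mem_cotChart_source.1 hz')).symm

/-- The defining function is H on the open set p(T) < 0; it is regular because p♯ is nonzero, and
the dimension is 8 - 1. -/
theorem nonempty_sliceChart_nullBundle (a : 𝓜.nullBundle) :
    Nonempty (SliceChart (cotangentModel 4) 7 𝓜.nullBundle a) := by
  have hz : a.1.1 ∈ (extChartAt (𝓡 4) a.1.1).source := mem_extChartAt_source _
  refine nonempty_sliceChart ?_ a (f := 𝓜.hamiltonian) (U := {z | z.2 (𝓜.T z.1) < 0})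
    (isOpen_lt 𝓜.continuous_apply_T continuous_const) (mem_nullBundle_iff.1 a.2).2
    (fun z hz => mem_nullBundle_iff.trans (and_iff_left hz))
    (fun z _ => (contMDiffAt_hamiltonian z).contMDiffWithinAt) ?_
  · rw [finrank_prod_dual, finrank_euclideanSpace_fin]
  · rw [extChartAt_eq_cotChart]
    have h1 : 𝓜.hamiltonian ∘ (cotChart a.1.1).symm =ᶠ[𝓝 (cotChart a.1.1 a.1)]
        ham (𝓜.coordMetric a.1.1) := by
      filter_upwards [(isOpen_cotChart_target a.1.1).mem_nhds
        ((cotChart a.1.1).map_source (mem_cotChart_source.2 hz))] with w hw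
      rw [Function.comp_apply, ← 𝓜.ham_cotChart
        (mem_cotChart_source.1 ((cotChart a.1.1).map_target hw)), (cotChart a.1.1).right_inv hw]
    rw [h1.fderiv_eq]
    refine fderiv_ham_ne_zero (𝓜.isMetricOn_coordMetric a.1.1) (cotChart_fst_mem_target hz) ?_
    rw [𝓜.raise_cotChart hz]
    exact coordD_ne_zero hz (sharp_ne_zero a.2)

theorem unitCotangent_ne_zero {u : Cotangent 3 S} (hu : u ∈ 𝓜.unitCotangent ι) :
    (𝓜.inducedMetric ι u.1).inverse u.2 ≠ 0 := by
  intro h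
  have h1 : u.2 ((𝓜.inducedMetric ι u.1).inverse u.2) = (1 : ℝ) := hu
  rw [h, map_zero] at h1
  exact zero_ne_one h1

theorem IsCauchySurface.nonempty_sliceChart_unitCotangent (hι : 𝓜.IsCauchySurface ι)
    (a : 𝓜.unitCotangent ι) :
    Nonempty (SliceChart (cotangentModel 3) 5 (𝓜.unitCotangent ι) a) := by
  set x₀ := a.1.1 with hx₀
  have hz : a.1.1 ∈ (extChartAt (𝓡 3) x₀).source := mem_extChartAt_source _
  have hz' : ι a.1.1 ∈ (extChartAt (𝓡 4) (ι x₀)).source := mem_extChartAt_source _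
  have hm := hι.isMetricOn_coordInduced x₀
  have hF : ∀ u : Cotangent 3 S, u.1 ∈ (extChartAt (𝓡 3) x₀).source →
      ι u.1 ∈ (extChartAt (𝓡 4) (ι x₀)).source → (cotChart x₀ u).1 ∈ coordDomain ι x₀ :=
    fun u h1 h2 => by rw [cotChart_fst]; exact chart_mem_coordDomain h1 h2
  refine nonempty_sliceChart ?_ a (f := fun u => 2 * ham (𝓜.coordInduced ι x₀) (cotChart x₀ u) - 1)
    (hι.isOpen_chartDomain x₀) ⟨hz, hz'⟩ (fun u hu => ?_) (fun u hu => ?_) ?_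
  · rw [finrank_prod_dual, finrank_euclideanSpace_fin]
  · rw [hι.two_mul_ham_cotChart_induced hu.1 hu.2, sub_eq_zero]
    rfl
  · have h1 : ContDiffAt ℝ ∞ (fun w => 2 * ham (𝓜.coordInduced ι x₀) w - 1) (cotChart x₀ u) :=
      (contDiffAt_const.mul (hm.contDiffOn_ham.contDiffAt (hm.isOpen_domain.mem_nhds
        ⟨hF u hu.1 hu.2, mem_univ _⟩))).sub contDiffAt_const
    exact (h1.contMDiffAt.comp u (contMDiffAt_cotChart hu.1)).contMDiffWithinAt
  · rw [extChartAt_eq_cotChart]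
    have h1 : (fun u : Cotangent 3 S => 2 * ham (𝓜.coordInduced ι x₀) (cotChart x₀ u) - 1) ∘
        (cotChart x₀).symm =ᶠ[𝓝 (cotChart x₀ a.1)]
        fun w => 2 * ham (𝓜.coordInduced ι x₀) w - 1 := by
      filter_upwards [(isOpen_cotChart_target x₀).mem_nhds
        ((cotChart x₀).map_source (mem_cotChart_source.2 hz))] with w hw
      rw [Function.comp_apply, (cotChart x₀).right_inv hw]
    rw [h1.fderiv_eq, ((hm.hasFDerivAt_ham (hF a.1 hz hz')).const_mul 2 |>.sub_const 1).fderiv]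
    refine smul_ne_zero two_ne_zero (fderiv_ham_ne_zero hm (hF a.1 hz hz') ?_)
    rw [hι.raise_cotChart_induced hz hz']
    exact coordD_ne_zero hz (unitCotangent_ne_zero a.2)

end Spacetime
end

/-! ### The null covectors along a spacelike hypersurface -/

section
variable {M : Type*} [TopologicalSpace M] [ChartedSpace (EuclideanSpace ℝ (Fin 4)) M]
  [IsManifold (𝓡 4) ∞ M] {𝓜 : Spacetime M}
  {S : Type*} [TopologicalSpace S] [ChartedSpace (EuclideanSpace ℝ (Fin 3)) S]
  [IsManifold (𝓡 3) ∞ S] {ι : S → M}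

namespace Spacetime

set_option linter.unusedSectionVars false

variable (𝓜 ι) in
/-- The covector `w + n` of `M` defined by a covector of `S`. -/
def nullLift (u : Cotangent 3 S) : TangentSpace (𝓡 4) (ι u.1) →L[ℝ] ℝ :=
  liftCov (E := EuclideanSpace ℝ (Fin 4)) (F := EuclideanSpace ℝ (Fin 3))
    (mfderiv (𝓡 3) (𝓡 4) ι u.1) (𝓜.g (ι u.1)) (𝓜.T (ι u.1)) u.2

variable (𝓜 ι) in
/-- The multiple by `a` of the covector `w + n` of `M` defined by a covector of `S`. -/
def scaledLift (a : ℝ) (u : Cotangent 3 S) : Cotangent 4 M := ⟨ι u.1, a • 𝓜.nullLift ι u⟩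

theorem mem_unitCotangent_iff {u : Cotangent 3 S} : u ∈ 𝓜.unitCotangent ι ↔
    u.2 ((𝓜.inducedMetric ι u.1).inverse u.2) = 1 := Iff.rfl

theorem hamiltonian_mk_g (x : M) (V : TangentSpace (𝓡 4) x) :
    𝓜.hamiltonian (⟨x, 𝓜.g x V⟩ : Cotangent 4 M) = (1 / 2) * 𝓜.g x V V := by
  rw [hamiltonian_eq]
  simp only [𝓜.sharp_g]

namespace IsCauchySurface
variable (hι : 𝓜.IsCauchySurface ι)
include hι

theorem nullLift_comp (u : Cotangent 3 S) :
    (𝓜.nullLift ι u).comp (mfderiv (𝓡 3) (𝓡 4) ι u.1) = u.2 :=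
  ContinuousLinearMap.ext fun v => (hι.isSpacelikeFor u.1).liftVec_apply u.2 v

theorem scaledLift_mem {a : ℝ} (ha : 0 < a) {u : Cotangent 3 S} (hu : u ∈ 𝓜.unitCotangent ι) :
    𝓜.scaledLift ι a u ∈ 𝓜.nullBundle := by
  have h := hι.isSpacelikeFor u.1
  set W : TangentSpace (𝓡 4) (ι u.1) := liftVec (E := EuclideanSpace ℝ (Fin 4))
    (F := EuclideanSpace ℝ (Fin 3)) (mfderiv (𝓡 3) (𝓡 4) ι u.1) (𝓜.g (ι u.1)) (𝓜.T (ι u.1)) u.2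
  have hu1 : u.2 ((𝓜.inducedMetric ι u.1).inverse u.2) = (1 : ℝ) := hu
  have h1 : 𝓜.g (ι u.1) W W = 0 := by
    refine (h.liftVec_apply_self u.2).trans ?_
    rw [sub_eq_zero]; exact hu1
  have h2 : 𝓜.g (ι u.1) W (𝓜.T (ι u.1)) < 0 := h.liftVec_apply_T hu1.le
  have h3 : 𝓜.scaledLift ι a u = ⟨ι u.1, 𝓜.g (ι u.1) (a • W)⟩ := by
    rw [map_smul]; rfl
  refine mem_nullBundle_iff.2 ⟨?_, ?_⟩
  · rw [h3, hamiltonian_mk_g, map_smul, map_smul, smul_apply, h1]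
    simp
  · exact mul_neg_of_pos_of_neg ha h2

theorem isLift_nullLift (u : Cotangent 3 S) : 𝓜.IsLift ι u.1 u.2 (𝓜.nullLift ι u) := by
  have h := hι.isSpacelikeFor u.1
  set D : EuclideanSpace ℝ (Fin 3) →L[ℝ] EuclideanSpace ℝ (Fin 4) := mfderiv (𝓡 3) (𝓡 4) ι u.1
  set b : EuclideanSpace ℝ (Fin 4) →L[ℝ] EuclideanSpace ℝ (Fin 4) →L[ℝ] ℝ := 𝓜.g (ι u.1)
  set T : EuclideanSpace ℝ (Fin 4) := 𝓜.T (ι u.1)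
  set ν := unitNormal D b T
  have hν : 𝓜.sharp (ι u.1) (b ν) = ν := 𝓜.sharp_g (ι u.1) ν
  refine ⟨b ν, b (D ((pullForm D b).inverse u.2)), ⟨?_, ?_, ?_⟩, ?_, ?_, ?_⟩
  · exact h.unitNormal_apply
  · exact (congrArg (b ν) hν).trans
      h.unitNormal_apply_self
  · rw [hν]
    refine ⟨?_, h.unitNormal_apply_T⟩
    refine h.unitNormal_apply_self.le.trans (by norm_num)
  · exact ContinuousLinearMap.ext fun v => h.apply_inverse u.2 v
  · refine (congrArg (b (D ((pullForm D b).inverse u.2))) hν).trans ?_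
    exact (h.lorentzian.symm _ _).trans (h.unitNormal_apply _)
  · exact map_add b _ _

/-- Injectivity of `ι` gives the base point, restriction to S gives `a • v = a' • v'`, and the unit
lengths force `a = a'`. -/
theorem scaledLift_injective {a a' : ℝ} (ha : 0 < a) (ha' : 0 < a') {u u' : Cotangent 3 S}
    (hu : u ∈ 𝓜.unitCotangent ι) (hu' : u' ∈ 𝓜.unitCotangent ι)
    (h : 𝓜.scaledLift ι a u = 𝓜.scaledLift ι a' u') : u = u' := by
  obtain ⟨x, v⟩ := u
  obtain ⟨x', v'⟩ := u'
  obtain rfl : x = x' := hι.isEmbedding.injective (congrArg TotalSpace.proj h)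
  have h1 : a • 𝓜.nullLift ι ⟨x, v⟩ = a' • 𝓜.nullLift ι ⟨x, v'⟩ :=
    eq_of_heq (TotalSpace.mk.inj h).2
  have h2 : a • v = a' • v' := by
    have := congrArg (fun l => ContinuousLinearMap.comp l (mfderiv (𝓡 3) (𝓡 4) ι x)) h1
    have e1 := hι.nullLift_comp ⟨x, v⟩
    have e2 := hι.nullLift_comp ⟨x, v'⟩
    simp only [ContinuousLinearMap.smul_comp] at this
    rw [e1, e2] at this
    exact this
  have h3 : a ^ 2 = a' ^ 2 := by
    have e1 : v ((𝓜.inducedMetric ι x).inverse v) = (1 : ℝ) := hu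
    have e2 : v' ((𝓜.inducedMetric ι x).inverse v') = (1 : ℝ) := hu'
    have e3 := congrArg (fun l : EuclideanSpace ℝ (Fin 3) →L[ℝ] ℝ =>
      l ((𝓜.inducedMetric ι x).inverse l)) h2
    have e4 := IsSpacelikeFor.conorm_smul (E := EuclideanSpace ℝ (Fin 4))
      (F := EuclideanSpace ℝ (Fin 3)) (D := (mfderiv (𝓡 3) (𝓡 4) ι x :
      EuclideanSpace ℝ (Fin 3) →L[ℝ] EuclideanSpace ℝ (Fin 4))) (b := 𝓜.g (ι x)) a v
    have e5 := IsSpacelikeFor.conorm_smul (E := EuclideanSpace ℝ (Fin 4))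
      (F := EuclideanSpace ℝ (Fin 3)) (D := (mfderiv (𝓡 3) (𝓡 4) ι x :
      EuclideanSpace ℝ (Fin 3) →L[ℝ] EuclideanSpace ℝ (Fin 4))) (b := 𝓜.g (ι x)) a' v'
    have e6 := e4.symm.trans (e3.trans e5)
    erw [e1, e2] at e6
    simpa using e6
  have h4 : a = a' := (pow_left_inj₀ ha.le ha'.le two_ne_zero).1 h3
  rw [h4] at h2
  rw [smul_right_injective _ ha'.ne' h2]

theorem finrank_eq : Module.finrank ℝ (EuclideanSpace ℝ (Fin 4)) =
    Module.finrank ℝ (EuclideanSpace ℝ (Fin 3)) + 1 := by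
  rw [finrank_euclideanSpace_fin, finrank_euclideanSpace_fin]

/-- Every future null covector at a point of the hypersurface is a multiple of a lift. -/
theorem exists_eq_scaledLift {x : S} {p : TangentSpace (𝓡 4) (ι x) →L[ℝ] ℝ}
    (hp : (⟨ι x, p⟩ : Cotangent 4 M) ∈ 𝓜.nullBundle) :
    ∃ a > 0, ∃ u ∈ 𝓜.unitCotangent ι, (⟨ι x, p⟩ : Cotangent 4 M) = 𝓜.scaledLift ι a u := by
  have h := hι.isSpacelikeFor x
  have hdim := hι.finrank_eq
  obtain ⟨V, rfl⟩ : ∃ V, p = 𝓜.g (ι x) V := ⟨_, (𝓜.g_sharp (ι x) p).symm⟩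
  have hV : 𝓜.g (ι x) V V = 0 := by
    have := hp.1
    rw [hamiltonian_mk_g] at this
    linarith
  have hVT : 𝓜.g (ι x) V (𝓜.T (ι x)) < 0 := (mem_nullBundle_iff.1 hp).2
  set D : EuclideanSpace ℝ (Fin 3) →L[ℝ] EuclideanSpace ℝ (Fin 4) := mfderiv (𝓡 3) (𝓡 4) ι x
  set b : EuclideanSpace ℝ (Fin 4) →L[ℝ] EuclideanSpace ℝ (Fin 4) →L[ℝ] ℝ := 𝓜.g (ι x)
  set v := (b V).comp D with hv
  have hpos := h.conorm_pos (h.exists_apply_ne_zero hdim hV hVT)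
  -- The scale is the length of the restriction to S; dividing by it produces the unit covector.
  set s := √(v ((pullForm D b).inverse v)) with hs
  have hs0 : 0 < s := Real.sqrt_pos.2 hpos
  have hunit : (s⁻¹ • v) ((pullForm D b).inverse (s⁻¹ • v)) = 1 := by
    rw [IsSpacelikeFor.conorm_smul, ← Real.sq_sqrt hpos.le, ← hs, ← mul_pow, inv_mul_cancel₀ hs0.ne', one_pow]
  refine ⟨s, hs0, ⟨x, s⁻¹ • v⟩, hunit, ?_⟩
  have := h.eq_smul_liftCov hdim hV hVT hs0 hunit (by rw [smul_smul, mul_inv_cancel₀ hs0.ne',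
    one_smul])
  exact congrArg (TotalSpace.mk (ι x)) this

/-- The lift in canonical coordinates. -/
theorem cotChart_scaledLift {x₀ : S} {a : ℝ} (ha : 0 < a) {u : Cotangent 3 S}
    (hu : u ∈ 𝓜.unitCotangent ι)
    (hx : u.1 ∈ (extChartAt (𝓡 3) x₀).source)
    (hx' : ι u.1 ∈ (extChartAt (𝓡 4) (ι x₀)).source) :
    cotChart (ι x₀) (𝓜.scaledLift ι a u) = (coordEmb ι x₀ (cotChart x₀ u).1,
      a • liftCov (fderiv ℝ (coordEmb ι x₀) (cotChart x₀ u).1)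
        (𝓜.coordMetric (ι x₀) (coordEmb ι x₀ (cotChart x₀ u).1))
        (𝓜.coordT (ι x₀) (coordEmb ι x₀ (cotChart x₀ u).1)) (cotChart x₀ u).2) := by
  have hz : (𝓜.scaledLift ι a u).1 ∈ (extChartAt (𝓡 4) (ι x₀)).source := hx'
  have hy := chart_mem_coordDomain hx hx'
  have hN := hι.scaledLift_mem ha hu
  have hH := 𝓜.g_sharp_sharp (𝓜.scaledLift ι a u)
  rw [hN.1, mul_zero] at hH
  have hemb := coordEmb_chart (ι := ι) hx
  rw [cotChart_fst]
  refine Prod.ext (by rw [cotChart_fst]; exact hemb.symm) ?_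
  have hform := (𝓜.isMetricOn_coordMetric (ι x₀)).lower_raise (cotChart_fst_mem_target hz)
  rw [𝓜.raise_cotChart hz, cotChart_fst] at hform
  rw [← hform]
  have hfst : extChartAt (𝓡 4) (ι x₀) (𝓜.scaledLift ι a u).1 =
    coordEmb ι x₀ (extChartAt (𝓡 3) x₀ u.1) := hemb.symm
  rw [hfst]
  -- The momentum is identified by its properties, null, future pointing and with restriction `a`
  -- times the given covector, each of which transfers through the charts.
  refine (hι.isSpacelikeFor_coord hy).eq_smul_liftCov hι.finrank_eq ?_ ?_ ha ?_ ?_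
  · rw [← hfst, 𝓜.coordMetric_coordD hz]; exact hH
  · rw [← hfst, 𝓜.coordT_chart hz, 𝓜.coordMetric_coordD hz]
    exact hN.2.2
  · have h1 := hι.two_mul_ham_cotChart_induced hx hx'
    rw [ham, raise, mem_unitCotangent_iff.1 hu, cotChart_fst] at h1
    rw [← coordInduced]
    linarith
  · refine ContinuousLinearMap.ext fun w => ?_
    have h1 := hι.fderiv_coordEmb hx hx' (coordInv x₀ u.1 w)
    rw [coordD_coordInv hx] at h1
    rw [ContinuousLinearMap.comp_apply, h1, ← hfst]
    refine (𝓜.coordMetric_coordD hz _ _).trans ?_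
    refine (𝓜.g_sharp_apply _ _ _).trans ?_
    rw [smul_apply, cotChart_snd_apply hx]
    exact congrArg (a • ·) (congrArg (fun l => l (coordInv x₀ u.1 w)) (hι.nullLift_comp u))

/-- The lift is a smooth map from the unit cotangent bundle to the cotangent bundle. -/
theorem contMDiff_scaledLift [ChartedSpace (EuclideanSpace ℝ (Fin 5)) (𝓜.unitCotangent ι)]
    (hU : HasRetractions (cotangentModel 3) 5 (𝓜.unitCotangent ι)) {a : ℝ} (ha : 0 < a) :
    ContMDiff (𝓡 5) (cotangentModel 4) ∞
      (fun u : 𝓜.unitCotangent ι => 𝓜.scaledLift ι a u) := by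
  intro u
  set x₀ := u.1.1
  have hx : u.1.1 ∈ (extChartAt (𝓡 3) x₀).source := mem_extChartAt_source _
  have hx' : ι u.1.1 ∈ (extChartAt (𝓡 4) (ι x₀)).source := mem_extChartAt_source _
  have hy : (cotChart x₀ u.1).1 ∈ coordDomain ι x₀ := by
    rw [cotChart_fst]; exact chart_mem_coordDomain hx hx'
  have hn := (hι.isOpen_coordDomain x₀).mem_nhds hy
  have hfst : ContDiffAt ℝ ∞ (Prod.fst : EuclideanSpace ℝ (Fin 3) ×
    (EuclideanSpace ℝ (Fin 3) →L[ℝ] ℝ) → _) (cotChart x₀ u.1) := contDiffAt_fst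
  have h1 : ContDiffAt ℝ ∞ (fun w : EuclideanSpace ℝ (Fin 3) ×
      (EuclideanSpace ℝ (Fin 3) →L[ℝ] ℝ) => (coordEmb ι x₀ w.1,
      a • liftCov (fderiv ℝ (coordEmb ι x₀) w.1) (𝓜.coordMetric (ι x₀) (coordEmb ι x₀ w.1))
        (𝓜.coordT (ι x₀) (coordEmb ι x₀ w.1)) w.2)) (cotChart x₀ u.1) :=
    (((hι.contDiffOn_coordEmb x₀).contDiffAt hn).comp _ hfst).prodMk
      ((contDiffAt_liftCov (((hι.contDiffOn_fderiv_coordEmb x₀).contDiffAt hn).comp _ hfst)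
        (((hι.contDiffOn_coordMetric_coordEmb x₀).contDiffAt hn).comp _ hfst)
        (((hι.contDiffOn_coordT_coordEmb x₀).contDiffAt hn).comp _ hfst) contDiffAt_snd
        (hι.isSpacelikeFor_coord hy)).const_smul a)
  have h2 := h1.contMDiffAt.comp u
    ((contMDiffAt_cotChart (x₀ := x₀) hx).comp u (hU.contMDiff_incl u))
  have h3 : 𝓜.scaledLift ι a u ∈ (cotChart (ι x₀) : PartialEquiv (Cotangent 4 M) _).source :=
    mem_cotChart_source.2 hx'
  have h4 := (cotChart (ι x₀)).map_source h3
  rw [hι.cotChart_scaledLift ha u.2 hx hx'] at h4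
  have h5 := ((contMDiffOn_cotChart_symm (ι x₀)).contMDiffAt
    ((isOpen_cotChart_target (ι x₀)).mem_nhds h4)).comp u h2
  refine h5.congr_of_eventuallyEq ?_
  filter_upwards [((hι.isOpen_chartDomain x₀).preimage continuous_subtype_val).mem_nhds
    (show u ∈ _ from ⟨hx, hx'⟩)] with u' hu'
  have h6 : 𝓜.scaledLift ι a u' ∈ (cotChart (ι x₀) : PartialEquiv (Cotangent 4 M) _).source :=
    mem_cotChart_source.2 hu'.2
  rw [← (cotChart (ι x₀)).left_inv h6, hι.cotChart_scaledLift ha u'.2 hu'.1 hu'.2]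
  rfl

end IsCauchySurface

end Spacetime
end

/-! ### Leaves and their intersections with the Cauchy surface -/

section
variable {M : Type*} [TopologicalSpace M] [ChartedSpace (EuclideanSpace ℝ (Fin 4)) M]
  [IsManifold (𝓡 4) ∞ M] {𝓜 : Spacetime M}
  {S : Type*} [TopologicalSpace S] [ChartedSpace (EuclideanSpace ℝ (Fin 3)) S]
  [IsManifold (𝓡 3) ∞ S] {ι : S → M}

namespace Spacetime

set_option linter.unusedSectionVars false

/-- Multiples of a covector. -/
def smulCov (a : ℝ) (z : Cotangent 4 M) : Cotangent 4 M := ⟨z.1, a • z.2⟩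

theorem smulCov_smulCov (a b : ℝ) (z : Cotangent 4 M) :
    smulCov a (smulCov b z) = smulCov (a * b) z :=
  congrArg (TotalSpace.mk z.1) (smul_smul a b z.2)

theorem one_smulCov (z : Cotangent 4 M) : smulCov 1 z = z := by
  simp only [smulCov, one_smul]

theorem smulCov_scaledLift (a b : ℝ) (u : Cotangent 3 S) :
    smulCov a (𝓜.scaledLift ι b u) = 𝓜.scaledLift ι (a * b) u :=
  congrArg (TotalSpace.mk (ι u.1)) (smul_smul a b (𝓜.nullLift ι u))

theorem smulCov_mem {a : ℝ} (ha : 0 < a) {z : Cotangent 4 M} (hz : z ∈ 𝓜.nullBundle) :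
    smulCov a z ∈ 𝓜.nullBundle := by
  obtain ⟨h1, h2⟩ := mem_nullBundle_iff.1 hz
  refine mem_nullBundle_iff.2 ⟨?_, mul_neg_of_pos_of_neg ha h2⟩
  rw [← 𝓜.ham_cotChart (x₀ := z.1) (z := smulCov a z) (mem_extChartAt_source (I := 𝓡 4) z.1)]
  rw [← 𝓜.ham_cotChart (x₀ := z.1) (mem_extChartAt_source _)] at h1
  have e1 := cotChart_mk (mem_extChartAt_source (I := 𝓡 4) z.1) z.2
  have e2 := cotChart_mk (mem_extChartAt_source (I := 𝓡 4) z.1) (a • z.2)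
  have e3 : cotChart z.1 (smulCov a z) = ((cotChart z.1 z).1, a • (cotChart z.1 z).2) := by
    rw [show cotChart z.1 z = _ from e1]
    exact e2
  rw [e3, ham, (𝓜.isMetricOn_coordMetric z.1).raise_smul]
  rw [ham] at h1
  simp only [map_smul, smul_apply, smul_eq_mul] at h1 ⊢
  linear_combination a ^ 2 * h1

variable (𝓜) in
/-- Two covectors lie on a common integral curve of the geodesic spray. -/
def Joined (z z' : Cotangent 4 M) : Prop :=
  ∃ (c : ℝ → Cotangent 4 M) (J : Set ℝ), IsOpen J ∧ J.OrdConnected ∧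
    𝓜.IsGeodesicFlowLine c J ∧ z ∈ c '' J ∧ z' ∈ c '' J

theorem IsGeodesicFlowLine.comp_add {c : ℝ → Cotangent 4 M} {J : Set ℝ}
    (h : 𝓜.IsGeodesicFlowLine c J) (a : ℝ) :
    𝓜.IsGeodesicFlowLine (fun t => c (t + a)) ((fun t => t + a) ⁻¹' J) :=
  fun t ht => GeodesicAt.comp_add_const (h (t + a) ht)

theorem isOpen_preimage_add {J : Set ℝ} (hJ : IsOpen J) (a : ℝ) :
    IsOpen ((fun t => t + a) ⁻¹' J) := hJ.preimage (continuous_add_const a)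

theorem ordConnected_preimage_add {J : Set ℝ} (hJ : J.OrdConnected) (a : ℝ) :
    ((fun t => t + a) ⁻¹' J).OrdConnected :=
  hJ.preimage_mono fun _ _ h => add_le_add_left h a

theorem Joined.refl [T2Space M] (z : Cotangent 4 M) : 𝓜.Joined z z := by
  obtain ⟨c, J, hJ, hJc, h0, h, hz, -⟩ := 𝓜.exists_maximal_flowLine z
  exact ⟨c, J, hJ, hJc, h, ⟨0, h0, hz⟩, ⟨0, h0, hz⟩⟩

theorem Joined.symm {z z' : Cotangent 4 M} (h : 𝓜.Joined z z') : 𝓜.Joined z' z := by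
  obtain ⟨c, J, hJ, hJc, h, hz, hz'⟩ := h
  exact ⟨c, J, hJ, hJc, h, hz', hz⟩

/-- Shifting the second curve by `s' - t` makes both curves pass through `z'` at time `t`, where
they can be glued. -/
theorem Joined.trans [T2Space M] {z z' z'' : Cotangent 4 M} (h : 𝓜.Joined z z')
    (h' : 𝓜.Joined z' z'') : 𝓜.Joined z z'' := by
  obtain ⟨c, J, hJ, hJc, h, ⟨s, hs, hz⟩, ⟨t, ht, hz'⟩⟩ := h
  obtain ⟨c', J', hJ', hJc', h', ⟨s', hs', hw⟩, ⟨t', ht', hw'⟩⟩ := h'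
  have hts : t ∈ (fun r => r + (s' - t)) ⁻¹' J' := by
    rw [mem_preimage, add_sub_cancel]; exact hs'
  obtain ⟨c'', hc'', e1, e2⟩ := h.union hJ (isOpen_preimage_add hJ' _) hJc
    (ordConnected_preimage_add hJc' _) (h'.comp_add (s' - t)) ht hts
    (by rw [add_sub_cancel, hz', hw])
  refine ⟨c'', _, hJ.union (isOpen_preimage_add hJ' _),
    (hJc.isPreconnected.union t ht hts (ordConnected_preimage_add hJc' _).isPreconnected).ordConnected,
    hc'', ⟨s, Or.inl hs, by rw [e1 hs, hz]⟩, ⟨t' - (s' - t), Or.inr ?_, ?_⟩⟩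
  · rw [mem_preimage, sub_add_cancel]; exact ht'
  · rw [e2 (by rw [mem_preimage, sub_add_cancel]; exact ht')]
    simp only [sub_add_cancel]
    exact hw'

theorem Joined.smul {z z' : Cotangent 4 M} (h : 𝓜.Joined z z') {a : ℝ} (ha : 0 < a) :
    𝓜.Joined (smulCov a z) (smulCov a z') := by
  obtain ⟨c, J, hJ, hJc, h, ⟨s, hs, rfl⟩, ⟨t, ht, rfl⟩⟩ := h
  have hmem : ∀ r ∈ J, a⁻¹ * r ∈ (fun r => a * r) ⁻¹' J := fun r hr => by
    rw [mem_preimage, mul_inv_cancel_left₀ ha.ne']; exact hr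
  refine ⟨fun r => smulCov a (c (a * r)), (fun r => a * r) ⁻¹' J,
    hJ.preimage (continuous_const_mul a),
    hJc.preimage_mono fun _ _ h => mul_le_mul_of_nonneg_left h ha.le,
    fun r hr => GeodesicAt.smul (h (a * r) hr), ⟨a⁻¹ * s, hmem s hs, ?_⟩, ⟨a⁻¹ * t, hmem t ht, ?_⟩⟩
  · simp only [mul_inv_cancel_left₀ ha.ne']
  · simp only [mul_inv_cancel_left₀ ha.ne']

variable (𝓜) in
/-- Two covectors lie on a common leaf. -/
def SameLeaf (z z' : Cotangent 4 M) : Prop := ∃ a > 0, 𝓜.Joined (smulCov a z) z'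

theorem Joined.sameLeaf {z z' : Cotangent 4 M} (h : 𝓜.Joined z z') : 𝓜.SameLeaf z z' :=
  ⟨1, one_pos, by rwa [one_smulCov]⟩

theorem sameLeaf_smulCov [T2Space M] {a : ℝ} (ha : 0 < a) (z : Cotangent 4 M) :
    𝓜.SameLeaf z (smulCov a z) := ⟨a, ha, Joined.refl _⟩

theorem SameLeaf.refl [T2Space M] (z : Cotangent 4 M) : 𝓜.SameLeaf z z :=
  (Joined.refl z).sameLeaf

theorem SameLeaf.symm {z z' : Cotangent 4 M} (h : 𝓜.SameLeaf z z') : 𝓜.SameLeaf z' z := by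
  obtain ⟨a, ha, h⟩ := h
  refine ⟨a⁻¹, inv_pos.2 ha, ?_⟩
  have := (h.smul (inv_pos.2 ha)).symm
  rwa [smulCov_smulCov, inv_mul_cancel₀ ha.ne', one_smulCov] at this

theorem SameLeaf.trans [T2Space M] {z z' z'' : Cotangent 4 M} (h : 𝓜.SameLeaf z z')
    (h' : 𝓜.SameLeaf z' z'') : 𝓜.SameLeaf z z'' := by
  obtain ⟨a, ha, h⟩ := h
  obtain ⟨b, hb, h'⟩ := h'
  refine ⟨b * a, mul_pos hb ha, ?_⟩
  rw [← smulCov_smulCov]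
  exact (h.smul hb).trans h'

/-- Scalings move past flow segments (`Joined.smul`), so `SameLeaf`, one scaling followed by one
segment, is already an equivalence relation, and it contains the relation generated by `leafRel`. -/
theorem sameLeaf_of_proj_eq [T2Space M] {p q : 𝓜.nullBundle} (h : 𝓜.proj p = 𝓜.proj q) :
    𝓜.SameLeaf p q := by
  have key : ∀ p q : 𝓜.nullBundle, Relation.EqvGen 𝓜.leafRel p q → 𝓜.SameLeaf p q := by
    intro p q h
    induction h with
    | rel p q h =>
      rcases h with ⟨a, ha, h⟩ | h
      · rw [h]; exact sameLeaf_smulCov ha _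
      · exact Joined.sameLeaf h
    | refl p => exact SameLeaf.refl _
    | symm p q _ ih => exact ih.symm
    | trans p q r _ _ ih1 ih2 => exact ih1.trans ih2
  exact key p q (Quot.eqvGen_exact h)

theorem SameLeaf.proj_eq {p q : 𝓜.nullBundle} (h : 𝓜.SameLeaf p q) : 𝓜.proj p = 𝓜.proj q := by
  obtain ⟨a, ha, h⟩ := h
  have h1 : 𝓜.proj p = 𝓜.proj ⟨smulCov a p, smulCov_mem ha p.2⟩ :=
    Quot.sound (Or.inl ⟨a, ha, rfl⟩)
  exact h1.trans (Quot.sound (Or.inr h))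

namespace IsCauchySurface
variable [T2Space M] (hι : 𝓜.IsCauchySurface ι)
include hι

/-- Every null geodesic meets the Cauchy surface. -/
theorem exists_joined_scaledLift {z : Cotangent 4 M} (hz : z ∈ 𝓜.nullBundle) :
    ∃ a > 0, ∃ u ∈ 𝓜.unitCotangent ι, 𝓜.Joined z (𝓜.scaledLift ι a u) := by
  obtain ⟨c, J, hJ, hJc, h0, h, rfl, hmax⟩ := 𝓜.exists_maximal_flowLine z
  have hext := isInextendibleCausalCurve_of_maximal hJ hJc h0 h hmax hz
  obtain ⟨t, ⟨ht, x, hx⟩, -⟩ := hι.meets_once _ _ hext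
  have hN := h.mem_nullBundle hJ hJc h0 ht hz
  have hjoin : 𝓜.Joined (c 0) (c t) := ⟨c, J, hJ, hJc, h, ⟨0, h0, rfl⟩, ⟨t, ht, rfl⟩⟩
  generalize c t = w at hN hjoin hx
  obtain ⟨y, p⟩ := w
  obtain rfl : ι x = y := hx
  obtain ⟨a, ha, u, hu, he⟩ := hι.exists_eq_scaledLift hN
  exact ⟨a, ha, u, hu, by rwa [← he]⟩

/-- A null geodesic meets the Cauchy surface only once. -/
theorem eq_of_joined {a a' : ℝ} (ha : 0 < a) (ha' : 0 < a') {u u' : Cotangent 3 S}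
    (hu : u ∈ 𝓜.unitCotangent ι) (hu' : u' ∈ 𝓜.unitCotangent ι)
    (h : 𝓜.Joined (𝓜.scaledLift ι a u) (𝓜.scaledLift ι a' u')) : u = u' := by
  refine hι.scaledLift_injective ha ha' hu hu' ?_
  obtain ⟨c₁, J₁, hJ₁, hJc₁, h₁, ⟨s, hs, hsu⟩, ⟨t, ht, htu⟩⟩ := h
  obtain ⟨c, J, hJ, hJc, h0, h, hc0, hmax⟩ := 𝓜.exists_maximal_flowLine (𝓜.scaledLift ι a u)
  have hN0 : c 0 ∈ 𝓜.nullBundle := hc0 ▸ hι.scaledLift_mem ha hu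
  have hext := isInextendibleCausalCurve_of_maximal hJ hJc h0 h (by rwa [hc0]) hN0
  have h0' : (0 : ℝ) ∈ (fun r => r + s) ⁻¹' J₁ := by rw [mem_preimage, zero_add]; exact hs
  have hz' : (fun r => c₁ (r + s)) 0 = 𝓜.scaledLift ι a u := by simp only [zero_add]; exact hsu
  -- Up to a shift of time the joining curve is part of the maximal geodesic. This inextendible
  -- curve lies over the Cauchy surface at the times 0 and `t - s`, so the two times are equal.
  have hsub := hmax _ _ (isOpen_preimage_add hJ₁ s) (ordConnected_preimage_add hJc₁ s) h0'
    (h₁.comp_add s) hz'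
  have hE := (h₁.comp_add s).eqOn (isOpen_preimage_add hJ₁ s) (ordConnected_preimage_add hJc₁ s)
    (h.mono hsub) h0' (hz'.trans hc0.symm)
  have hts : t - s ∈ (fun r => r + s) ⁻¹' J₁ := by rw [mem_preimage, sub_add_cancel]; exact ht
  have hct : c (t - s) = 𝓜.scaledLift ι a' u' := by
    rw [← hE hts]
    simp only [sub_add_cancel]
    exact htu
  have huniq := (hι.meets_once _ _ hext).unique
    (⟨h0, u.1, by rw [hc0]; rfl⟩ : (0 : ℝ) ∈ J ∧ (c 0).1 ∈ range ι)
    (⟨hsub hts, u'.1, by rw [hct]; rfl⟩ : t - s ∈ J ∧ (c (t - s)).1 ∈ range ι)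
  rw [← hc0, huniq, hct]

theorem eq_of_sameLeaf {a a' : ℝ} (ha : 0 < a) (ha' : 0 < a') {u u' : Cotangent 3 S}
    (hu : u ∈ 𝓜.unitCotangent ι) (hu' : u' ∈ 𝓜.unitCotangent ι)
    (h : 𝓜.SameLeaf (𝓜.scaledLift ι a u) (𝓜.scaledLift ι a' u')) : u = u' := by
  obtain ⟨b, hb, h⟩ := h
  rw [smulCov_scaledLift] at h
  exact hι.eq_of_joined (mul_pos hb ha) ha' hu hu' h

/-- The section of the projection to the space of null geodesics defined by the Cauchy surface. -/
def lift (a : ℝ) (ha : 0 < a) (u : 𝓜.unitCotangent ι) : 𝓜.nullBundle :=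
  ⟨𝓜.scaledLift ι a u, hι.scaledLift_mem ha u.2⟩

/-- The null geodesic through a covector of the Cauchy surface. -/
def geodesicOf (u : 𝓜.unitCotangent ι) : 𝓜.NullGeodesicSpace := 𝓜.proj (hι.lift 1 one_pos u)

theorem geodesicOf_bijective : Function.Bijective hι.geodesicOf := by
  refine ⟨fun u u' h => Subtype.ext ?_, fun y => ?_⟩
  · exact hι.eq_of_sameLeaf one_pos one_pos u.2 u'.2 (sameLeaf_of_proj_eq h)
  · obtain ⟨z, rfl⟩ := Quot.exists_rep y
    obtain ⟨a, ha, u, hu, h⟩ := hι.exists_joined_scaledLift z.2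
    refine ⟨⟨u, hu⟩, SameLeaf.proj_eq ?_⟩
    have h1 := (sameLeaf_smulCov (𝓜 := 𝓜) ha (𝓜.scaledLift ι 1 u))
    rw [smulCov_scaledLift, mul_one] at h1
    exact h1.trans h.sameLeaf.symm

/-- The identification of the unit cotangent bundle with the space of null geodesics. -/
def geodesicEquiv : 𝓜.unitCotangent ι ≃ 𝓜.NullGeodesicSpace :=
  Equiv.ofBijective _ hι.geodesicOf_bijective

/-- The unit covector of the Cauchy surface that determines the null geodesic through `z`. -/
def trace (z : 𝓜.nullBundle) : 𝓜.unitCotangent ι := hι.geodesicEquiv.symm (𝓜.proj z)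

theorem geodesicEquiv_trace (z : 𝓜.nullBundle) : hι.geodesicEquiv (hι.trace z) = 𝓜.proj z :=
  hι.geodesicEquiv.apply_symm_apply _

theorem trace_eq_of_sameLeaf {z z' : 𝓜.nullBundle} (h : 𝓜.SameLeaf z z') :
    hι.trace z = hι.trace z' := by
  rw [trace, h.proj_eq, trace]

theorem trace_lift {a : ℝ} (ha : 0 < a) (u : 𝓜.unitCotangent ι) :
    hι.trace (hι.lift a ha u) = u := by
  rw [trace, Equiv.symm_apply_eq]
  refine SameLeaf.proj_eq (SameLeaf.symm ?_)
  have h1 := (sameLeaf_smulCov (𝓜 := 𝓜) ha (𝓜.scaledLift ι 1 u))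
  rwa [smulCov_scaledLift, mul_one] at h1

end IsCauchySurface

end Spacetime
end

/-! ### The hitting time of a hypersurface -/

section Abstract
variable {E F : Type*} [NormedAddCommGroup E] [NormedSpace ℝ E] [FiniteDimensional ℝ E]
  [NormedAddCommGroup F] [NormedSpace ℝ F] [FiniteDimensional ℝ F]

/-- The equation for the hitting point is nondegenerate. -/
theorem exists_hitting_equiv {D : F →L[ℝ] E} {b : E →L[ℝ] E →L[ℝ] ℝ} {T V : E}
    (h : IsSpacelikeFor D b T) (hdim : Module.finrank ℝ E = Module.finrank ℝ F + 1)
    (hV : b V V = 0) (hV0 : V ≠ 0) {G : Type*} [NormedAddCommGroup G] [NormedSpace ℝ G]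
    [FiniteDimensional ℝ G] (P : G →L[ℝ] E) :
    ∃ L : (ℝ × F × G) ≃L[ℝ] (E × G), ∀ x, L x = (x.1 • V + P x.2.2 - D x.2.1, x.2.2) := by
  let L : (ℝ × F × G) →ₗ[ℝ] (E × G) :=
    { toFun := fun x => (x.1 • V + P x.2.2 - D x.2.1, x.2.2)
      map_add' := fun x y => by
        refine Prod.ext ?_ rfl
        simp only [Prod.fst_add, Prod.snd_add, map_add, add_smul]
        abel
      map_smul' := fun a x => by
        refine Prod.ext ?_ rfl
        simp only [Prod.smul_fst, Prod.smul_snd, map_smul, RingHom.id_apply, smul_eq_mul, mul_smul,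
          smul_sub, smul_add] }
  have hinj : Function.Injective L := by
    refine (injective_iff_map_eq_zero _).2 fun x hx => ?_
    obtain ⟨s, v, ξ⟩ := x
    have hξ : ξ = 0 := congrArg Prod.snd hx
    have h1 : s • V + P ξ - D v = 0 := congrArg Prod.fst hx
    rw [hξ, map_zero, add_zero, sub_eq_zero] at h1
    -- Transversality: `D v` would be a multiple of the null vector `V`, while nonzero tangent
    -- vectors of the hypersurface are spacelike.
    have hv : v = 0 := by
      by_contra hne
      have h2 := h.spacelike v hne
      rw [← h1] at h2
      simp [hV] at h2
    rw [hv, map_zero, smul_eq_zero] at h1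
    rw [h1.resolve_right hV0, hv, hξ]
    rfl
  have hfin : Module.finrank ℝ (ℝ × F × G) = Module.finrank ℝ (E × G) := by
    simp only [Module.finrank_prod, Module.finrank_self, hdim]
    ring
  exact ⟨(LinearEquiv.ofInjectiveOfFinrankEq L hinj hfin).toContinuousLinearEquiv, fun x => rfl⟩

/-- Null geodesics hit a spacelike hypersurface at a time and a place that depend smoothly on the
initial conditions. -/
theorem exists_hitting {j : F → E} {Ω' : Set F} (hΩ' : IsOpen Ω') (hj : ContDiffOn ℝ ∞ j Ω')
    {y₀ : F} (hy₀ : y₀ ∈ Ω') {g : E → E →L[ℝ] E →L[ℝ] ℝ} {T : E}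
    (h : IsSpacelikeFor (fderiv ℝ j y₀) (g (j y₀)) T)
    (hdim : Module.finrank ℝ E = Module.finrank ℝ F + 1)
    {w₀ : E × (E →L[ℝ] ℝ)} (hw₀ : w₀.1 = j y₀)
    (hV : g (j y₀) (raise g w₀) (raise g w₀) = 0) (hV0 : raise g w₀ ≠ 0)
    (hH : ham g w₀ = 0)
    {ε : ℝ} (hε : 0 < ε) {U : Set (E × (E →L[ℝ] ℝ))} (hU : IsOpen U) (hwU : w₀ ∈ U)
    {Fl : ℝ × (E × (E →L[ℝ] ℝ)) → E × (E →L[ℝ] ℝ)}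
    (hF : ContDiffOn ℝ ∞ Fl (Ioo (-ε) ε ×ˢ U)) (hF0 : ∀ w ∈ U, Fl (0, w) = w)
    (hFd : ∀ w ∈ U, ∀ t ∈ Ioo (-ε) ε,
      HasDerivAt (fun s => Fl (s, w)) (hamField g (Fl (t, w))) t) :
    ∃ W ⊆ U, IsOpen W ∧ w₀ ∈ W ∧ ∃ (τ : E × (E →L[ℝ] ℝ) → ℝ) (y : E × (E →L[ℝ] ℝ) → F),
      ContDiffOn ℝ ∞ τ W ∧ ContDiffOn ℝ ∞ y W ∧ τ w₀ = 0 ∧ y w₀ = y₀ ∧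
      (∀ w ∈ W, τ w ∈ Ioo (-ε) ε ∧ y w ∈ Ω' ∧ (Fl (τ w, w)).1 = j (y w)) ∧
      ∀ ξ, w₀.2 (fderiv ℝ j y₀ (fderiv ℝ y w₀ ξ)) = w₀.2 ξ.1 := by
  have h0 : (0 : ℝ) ∈ Ioo (-ε) ε := ⟨by linarith, hε⟩
  set V := raise g w₀
  obtain ⟨L, hL⟩ := exists_hitting_equiv h hdim hV hV0
    (ContinuousLinearMap.fst ℝ E (E →L[ℝ] ℝ))
  let O : Set (ℝ × F × (E × (E →L[ℝ] ℝ))) := {x | x.1 ∈ Ioo (-ε) ε ∧ x.2.1 ∈ Ω' ∧ x.2.2 ∈ U}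
  have hO : IsOpen O := (isOpen_Ioo.preimage continuous_fst).inter
    ((hΩ'.preimage (continuous_fst.comp continuous_snd)).inter
      (hU.preimage (continuous_snd.comp continuous_snd)))
  -- A time and a point of the hypersurface solve the hitting problem for `w` exactly when the first
  -- component vanishes. Carrying `w` along as second component makes the inverse function theorem
  -- applicable.
  let f : ℝ × F × (E × (E →L[ℝ] ℝ)) → E × (E × (E →L[ℝ] ℝ)) :=
    fun x => ((Fl (x.1, x.2.2)).1 - j x.2.1, x.2.2)
  have hf : ContDiffOn ℝ ∞ f O := by
    have h1 : ContDiffOn ℝ ∞ (fun x : ℝ × F × (E × (E →L[ℝ] ℝ)) => Fl (x.1, x.2.2)) O :=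
      hF.comp (by fun_prop) fun x hx => ⟨hx.1, hx.2.2⟩
    have h2 : ContDiffOn ℝ ∞ (fun x : ℝ × F × (E × (E →L[ℝ] ℝ)) => j x.2.1) O :=
      hj.comp (by fun_prop) fun x hx => hx.2.1
    exact (h1.fst.sub h2).prodMk (by fun_prop)
  have hFl : HasFDerivAt Fl (fderiv ℝ Fl (0, w₀)) (0, w₀) :=
    ((hF.contDiffAt ((isOpen_Ioo.prod hU).mem_nhds ⟨h0, hwU⟩)).differentiableAt
      (by simp)).hasFDerivAt
  have hFl1 : ∀ s : ℝ, (fderiv ℝ Fl (0, w₀) (s, 0)).1 = s • V := by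
    intro s
    have e1 : HasDerivAt (fun t : ℝ => (t, w₀)) ((1 : ℝ), (0 : E × (E →L[ℝ] ℝ))) 0 :=
      (hasDerivAt_id (0 : ℝ)).prodMk (hasDerivAt_const 0 w₀)
    have e2 : HasDerivAt (fun t => Fl (t, w₀)) (fderiv ℝ Fl (0, w₀) (1, 0)) 0 :=
      hFl.comp_hasDerivAt (0 : ℝ) e1
    have e3 := e2.unique (hFd w₀ hwU 0 h0)
    have e4 : ((s, 0) : ℝ × (E × (E →L[ℝ] ℝ))) = s • (1, 0) := by simp
    rw [e4, map_smul, e3, hF0 w₀ hwU]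
    rfl
  have hFl2 : ∀ ξ, fderiv ℝ Fl (0, w₀) (0, ξ) = ξ := by
    intro ξ
    have e1 : HasFDerivAt (fun w : E × (E →L[ℝ] ℝ) => ((0 : ℝ), w)) _ w₀ :=
      hasFDerivAt_prodMk_right (𝕜 := ℝ) (0 : ℝ) w₀
    have e2 := hFl.comp w₀ e1
    have e3 : HasFDerivAt (fun w => Fl (0, w)) (ContinuousLinearMap.id ℝ _) w₀ :=
      (hasFDerivAt_id w₀).congr_of_eventuallyEq (by
        filter_upwards [hU.mem_nhds hwU] with w hw
        exact hF0 w hw)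
    exact congrArg (fun l => l ξ) (e2.unique e3)
  have hjd : HasFDerivAt j (fderiv ℝ j y₀) y₀ :=
    ((hj.contDiffAt (hΩ'.mem_nhds hy₀)).differentiableAt (by simp)).hasFDerivAt
  have hsplit : ∀ (s : ℝ) ξ, (fderiv ℝ Fl (0, w₀) (s, ξ)).1 = s • V + ξ.1 := by
    intro s ξ
    have e1 : ((s, ξ) : ℝ × (E × (E →L[ℝ] ℝ))) = (s, 0) + (0, ξ) := by simp
    rw [e1, map_add, Prod.fst_add, hFl1, hFl2]
  have hfd : HasFDerivAt f (L : (ℝ × F × (E × (E →L[ℝ] ℝ))) →L[ℝ] _) (0, y₀, w₀) := by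
    have e0 : HasFDerivAt (fun x : ℝ × F × (E × (E →L[ℝ] ℝ)) => (x.1, x.2.2))
        ((ContinuousLinearMap.fst ℝ ℝ (F × (E × (E →L[ℝ] ℝ)))).prod
          ((ContinuousLinearMap.snd ℝ F (E × (E →L[ℝ] ℝ))).comp
            (ContinuousLinearMap.snd ℝ ℝ (F × (E × (E →L[ℝ] ℝ)))))) (0, y₀, w₀) :=
      hasFDerivAt_fst.prodMk ((ContinuousLinearMap.snd ℝ F (E × (E →L[ℝ] ℝ))).comp
        (ContinuousLinearMap.snd ℝ ℝ (F × (E × (E →L[ℝ] ℝ))))).hasFDerivAt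
    have e1 := (HasFDerivAt.comp (0, y₀, w₀) (g := Fl) hFl e0).fst
    have e2 : HasFDerivAt (fun x : ℝ × F × (E × (E →L[ℝ] ℝ)) => x.2.1)
        ((ContinuousLinearMap.fst ℝ F (E × (E →L[ℝ] ℝ))).comp
            (ContinuousLinearMap.snd ℝ ℝ (F × (E × (E →L[ℝ] ℝ))))) (0, y₀, w₀) :=
      ((ContinuousLinearMap.fst ℝ F (E × (E →L[ℝ] ℝ))).comp
        (ContinuousLinearMap.snd ℝ ℝ (F × (E × (E →L[ℝ] ℝ))))).hasFDerivAt
    have e3 := HasFDerivAt.comp (0, y₀, w₀) (g := j) hjd e2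
    have e4 : HasFDerivAt (fun x : ℝ × F × (E × (E →L[ℝ] ℝ)) => x.2.2)
        ((ContinuousLinearMap.snd ℝ F (E × (E →L[ℝ] ℝ))).comp
            (ContinuousLinearMap.snd ℝ ℝ (F × (E × (E →L[ℝ] ℝ))))) (0, y₀, w₀) :=
      ((ContinuousLinearMap.snd ℝ F (E × (E →L[ℝ] ℝ))).comp
        (ContinuousLinearMap.snd ℝ ℝ (F × (E × (E →L[ℝ] ℝ))))).hasFDerivAt
    refine ((e1.sub e3).prodMk e4).congr_fderiv (ContinuousLinearMap.ext fun x => ?_)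
    refine Prod.ext ?_ (congrArg Prod.snd (hL x)).symm
    refine Eq.trans ?_ (congrArg Prod.fst (hL x)).symm
    change (fderiv ℝ Fl (0, w₀) (x.1, x.2.2)).1 - fderiv ℝ j y₀ x.2.1 = _
    rw [hsplit]
    rfl
  have := FiniteDimensional.complete ℝ E
  have := FiniteDimensional.complete ℝ F
  have hx₀ : ((0, y₀, w₀) : ℝ × F × (E × (E →L[ℝ] ℝ))) ∈ O := ⟨h0, hy₀, hwU⟩
  obtain ⟨e, hxe, heO, hef, hesymm⟩ := exists_openPartialHomeomorph_contDiffOn hO hf hx₀ hfd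
  let W : Set (E × (E →L[ℝ] ℝ)) := (fun w => ((0 : E), w)) ⁻¹' e.target
  have hW : IsOpen W := e.open_target.preimage (by fun_prop)
  have he0 : e (0, y₀, w₀) = (0, w₀) := by
    rw [hef]
    refine Prod.ext ?_ rfl
    change (Fl (0, w₀)).1 - j y₀ = 0
    rw [hF0 w₀ hwU, hw₀, sub_self]
  have hw₀W : w₀ ∈ W := by
    change ((0 : E), w₀) ∈ e.target
    rw [← he0]; exact e.map_source hxe
  have hs : ContDiffOn ℝ ∞ (fun w => e.symm (0, w)) W :=
    hesymm.comp (by fun_prop) fun w hw => hw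
  have hprop : ∀ w ∈ W, e.symm (0, w) ∈ O ∧ (e.symm (0, w)).2.2 = w ∧
      (Fl ((e.symm (0, w)).1, w)).1 = j (e.symm (0, w)).2.1 := by
    intro w hw
    have e1 := e.right_inv hw
    rw [hef] at e1
    have e2 : (e.symm (0, w)).2.2 = w := congrArg Prod.snd e1
    have e3 : (Fl ((e.symm (0, w)).1, (e.symm (0, w)).2.2)).1 - j (e.symm (0, w)).2.1 = 0 :=
      congrArg Prod.fst e1
    rw [e2, sub_eq_zero] at e3
    exact ⟨heO (e.map_target hw), e2, e3⟩
  have hs0 : e.symm (0, w₀) = (0, y₀, w₀) := by rw [← he0, e.left_inv hxe]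
  refine ⟨W, fun w hw => ?_, hW, hw₀W, fun w => (e.symm (0, w)).1, fun w => (e.symm (0, w)).2.1,
    hs.fst, hs.snd.fst, congrArg Prod.fst hs0, congrArg (fun x => x.2.1) hs0, fun w hw => ⟨(hprop w hw).1.1,
      (hprop w hw).1.2.1, (hprop w hw).2.2⟩, fun ξ => ?_⟩
  · have := (hprop w hw).1.2.2
    rwa [(hprop w hw).2.1] at this
  · have hsd : HasFDerivAt (fun w => e.symm (0, w)) (fderiv ℝ (fun w => e.symm (0, w)) w₀) w₀ :=
      ((hs.contDiffAt (hW.mem_nhds hw₀W)).differentiableAt (by simp)).hasFDerivAt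
    set σ := fderiv ℝ (fun w => e.symm (0, w)) w₀
    have ey : fderiv ℝ (fun w => (e.symm (0, w)).2.1) w₀ ξ = (σ ξ).2.1 := by
      rw [hsd.snd.fst.fderiv]; rfl
    have e1 : HasFDerivAt (fun w => e (e.symm (0, w)))
        ((L : (ℝ × F × (E × (E →L[ℝ] ℝ))) →L[ℝ] E × (E × (E →L[ℝ] ℝ))).comp σ) w₀ := by
      have h1 : HasFDerivAt e (L : (ℝ × F × (E × (E →L[ℝ] ℝ))) →L[ℝ] _) (e.symm (0, w₀)) := by
        rw [hs0]
        exact hfd.congr_of_eventuallyEq (Eventually.of_forall hef)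
      exact h1.comp w₀ hsd
    have e2 : HasFDerivAt (fun w => ((0 : E), w))
        (ContinuousLinearMap.inr ℝ E (E × (E →L[ℝ] ℝ))) w₀ :=
      hasFDerivAt_prodMk_right (𝕜 := ℝ) (0 : E) w₀
    have e3 : HasFDerivAt (fun w => e (e.symm (0, w)))
        (ContinuousLinearMap.inr ℝ E (E × (E →L[ℝ] ℝ))) w₀ := e2.congr_of_eventuallyEq (by
      filter_upwards [hW.mem_nhds hw₀W] with w hw
      exact e.right_inv hw)
    have e4 : L (σ ξ) = (0, ξ) := congrArg (fun l => l ξ) (e1.unique e3)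
    rw [hL] at e4
    have e5 : (σ ξ).2.2 = ξ := congrArg Prod.snd e4
    have e6 : (σ ξ).1 • V + (σ ξ).2.2.1 - fderiv ℝ j y₀ (σ ξ).2.1 = 0 := congrArg Prod.fst e4
    -- The hitting point moves by the base part of the variation plus a multiple of the velocity
    -- `V`, due to the change of hitting time. The covector kills `V` since H = 0, so the hitting
    -- time drops out.
    have e7 : w₀.2 V = 0 := by
      have := hH
      rw [ham] at this
      change w₀.2 (raise g w₀) = 0
      linarith
    rw [ey, ← sub_eq_zero.1 e6, e5, map_add, map_smul, e7, smul_zero, zero_add]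

end Abstract

/-! ### The trace of null geodesics on the Cauchy surface -/

/-- The canonical one-form, restricted to a submanifold, in canonical coordinates. -/
theorem canonicalForm_mfderiv_val {n k : ℕ} {X : Type*} [TopologicalSpace X]
    [ChartedSpace (EuclideanSpace ℝ (Fin n)) X] [IsManifold (𝓡 n) ∞ X] {A : Set (Cotangent n X)}
    [ChartedSpace (EuclideanSpace ℝ (Fin k)) A] (hA : HasRetractions (cotangentModel n) k A)
    {x₀ : X} {a : A} (hx : a.1.1 ∈ (extChartAt (𝓡 n) x₀).source) (v : TangentSpace (𝓡 k) a) :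
    canonicalForm n X a.1 (mfderiv (𝓡 k) (cotangentModel n) (Subtype.val : A → Cotangent n X) a v) =
      (cotChart x₀ a.1).2 (mfderiv (𝓡 k)
        𝓘(ℝ, EuclideanSpace ℝ (Fin n) × (EuclideanSpace ℝ (Fin n) →L[ℝ] ℝ))
        (fun b : A => cotChart x₀ b.1) a v :
          EuclideanSpace ℝ (Fin n) × (EuclideanSpace ℝ (Fin n) →L[ℝ] ℝ)).1 := by
  rw [canonicalForm_eq hx]
  have h1 : HasMFDerivAt (𝓡 k)
      𝓘(ℝ, EuclideanSpace ℝ (Fin n) × (EuclideanSpace ℝ (Fin n) →L[ℝ] ℝ))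
      (fun b : A => cotChart x₀ b.1) a _ :=
    ((contMDiffAt_cotChart hx).mdifferentiableAt (by simp)).hasMFDerivAt.comp a
      ((hA.contMDiff_incl a).mdifferentiableAt (by simp)).hasMFDerivAt
  rw [h1.mfderiv]
  rfl

section
variable {M : Type*} [TopologicalSpace M] [ChartedSpace (EuclideanSpace ℝ (Fin 4)) M]
  [IsManifold (𝓡 4) ∞ M] {𝓜 : Spacetime M}
  {S : Type*} [TopologicalSpace S] [ChartedSpace (EuclideanSpace ℝ (Fin 3)) S]
  [IsManifold (𝓡 3) ∞ S] {ι : S → M}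

namespace Spacetime.IsCauchySurface

set_option linter.unusedSectionVars false

variable (hι : 𝓜.IsCauchySurface ι)

include hι in
theorem cotChart_scaledLift_comp {x₀ : S} {a : ℝ} (ha : 0 < a) {u : Cotangent 3 S}
    (hu : u ∈ 𝓜.unitCotangent ι)
    (hx : u.1 ∈ (extChartAt (𝓡 3) x₀).source)
    (hx' : ι u.1 ∈ (extChartAt (𝓡 4) (ι x₀)).source) :
    (cotChart (ι x₀) (𝓜.scaledLift ι a u)).2.comp
      (fderiv ℝ (coordEmb ι x₀) (cotChart x₀ u).1) = a • (cotChart x₀ u).2 := by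
  rw [hι.cotChart_scaledLift ha hu hx hx']
  have hy := chart_mem_coordDomain hx hx'
  rw [← cotChart_fst] at hy
  refine ContinuousLinearMap.ext fun v => ?_
  exact congrArg (a • ·) ((hι.isSpacelikeFor_coord hy).liftVec_apply (cotChart x₀ u).2 v)

include hι in
theorem conorm_cotChart {x₀ : S} {u : Cotangent 3 S} (hu : u ∈ 𝓜.unitCotangent ι)
    (hx : u.1 ∈ (extChartAt (𝓡 3) x₀).source)
    (hx' : ι u.1 ∈ (extChartAt (𝓡 4) (ι x₀)).source) :
    (cotChart x₀ u).2 ((𝓜.coordInduced ι x₀ (cotChart x₀ u).1).inverse (cotChart x₀ u).2) = 1 := by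
  have h1 := hι.two_mul_ham_cotChart_induced hx hx'
  rw [ham, raise, mem_unitCotangent_iff.1 hu] at h1
  linarith

variable [T2Space M]

/-- If `z` flows to a covector over the Cauchy surface, then this covector determines the trace of
`z` in coordinates. -/
theorem cotChart_trace {x₀ : S} {z : 𝓜.nullBundle} {z' : Cotangent 4 M} (hz : 𝓜.Joined z z')
    (hz' : z' ∈ 𝓜.nullBundle) {y : EuclideanSpace ℝ (Fin 3)} (hy : y ∈ coordDomain ι x₀)
    (hzy : z'.1 = ι ((extChartAt (𝓡 3) x₀).symm y)) :
    (hι.trace z).1.1 = (extChartAt (𝓡 3) x₀).symm y ∧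
    cotChart x₀ (hι.trace z).1 = (y,
      (√(((cotChart (ι x₀) z').2.comp (fderiv ℝ (coordEmb ι x₀) y))
        ((𝓜.coordInduced ι x₀ y).inverse
          ((cotChart (ι x₀) z').2.comp (fderiv ℝ (coordEmb ι x₀) y)))))⁻¹ •
        (cotChart (ι x₀) z').2.comp (fderiv ℝ (coordEmb ι x₀) y)) := by
  obtain ⟨y', p⟩ := z'
  obtain rfl : y' = ι ((extChartAt (𝓡 3) x₀).symm y) := hzy
  obtain ⟨a, ha, u, hu, he⟩ := hι.exists_eq_scaledLift hz'
  have hux : u.1 = (extChartAt (𝓡 3) x₀).symm y :=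
    hι.isEmbedding.injective (congrArg TotalSpace.proj he).symm
  have hx : u.1 ∈ (extChartAt (𝓡 3) x₀).source := by
    rw [hux]; exact (extChartAt (𝓡 3) x₀).map_target hy.1
  have hx' : ι u.1 ∈ (extChartAt (𝓡 4) (ι x₀)).source := by rw [hux]; exact hy.2
  rw [he] at hz ⊢
  have htr : hι.trace z = ⟨u, hu⟩ :=
    (hι.trace_eq_of_sameLeaf (z' := hι.lift a ha ⟨u, hu⟩) hz.sameLeaf).trans
      (hι.trace_lift ha ⟨u, hu⟩)
  have hfst : (cotChart x₀ u).1 = y := by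
    rw [cotChart_fst, hux, (extChartAt (𝓡 3) x₀).right_inv hy.1]
  have hcomp := hι.cotChart_scaledLift_comp ha hu hx hx'
  have hnorm := hι.conorm_cotChart hu hx hx'
  rw [hfst] at hcomp hnorm
  rw [htr]
  refine ⟨hux, Prod.ext hfst ?_⟩
  rw [hcomp]
  -- The restriction is `a` times a unit covector, so its length recovers `a` and normalisation
  -- removes it.
  have h1 : (a • (cotChart x₀ u).2) ((𝓜.coordInduced ι x₀ y).inverse (a • (cotChart x₀ u).2)) =
      a ^ 2 := by
    simp only [map_smul, smul_apply, smul_eq_mul, hnorm]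
    ring
  rw [h1, Real.sqrt_sq ha.le, smul_smul, inv_mul_cancel₀ ha.ne', one_smul]

variable [ChartedSpace (EuclideanSpace ℝ (Fin 7)) 𝓜.nullBundle]
  [ChartedSpace (EuclideanSpace ℝ (Fin 5)) (𝓜.unitCotangent ι)]

/-- At `z`, the trace is a submersion that pulls the contact form back to a multiple of `θ`. -/
structure IsContactSubmersionAt (z : 𝓜.nullBundle) : Prop where
  contMDiffAt : ContMDiffAt (𝓡 7) (𝓡 5) ∞ hι.trace z
  surjective : Function.Surjective (mfderiv (𝓡 7) (𝓡 5) hι.trace z)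
  theta : ∃ a ≠ 0, ∀ ζ : TangentSpace (𝓡 7) z,
    𝓜.contactForm ι ⟨hι.trace z, mfderiv (𝓡 7) (𝓡 5) hι.trace z ζ⟩ = a * 𝓜.theta ⟨z, ζ⟩

variable (hN : HasRetractions (cotangentModel 4) 7 𝓜.nullBundle)
  (hU : HasRetractions (cotangentModel 3) 5 (𝓜.unitCotangent ι))

include hN hU in
theorem contMDiff_lift {a : ℝ} (ha : 0 < a) : ContMDiff (𝓡 5) (𝓡 7) ∞ (hι.lift a ha) :=
  fun u => hN.contMDiffAt_of_comp (hι.contMDiff_scaledLift hU ha u)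

-- `lift` is a smooth section of `trace`, so the differential of `trace` has a right inverse at
-- every lifted point.
include hN hU in
theorem surjective_mfderiv_trace {a : ℝ} (ha : 0 < a) (u : 𝓜.unitCotangent ι)
    (h : ContMDiffAt (𝓡 7) (𝓡 5) ∞ hι.trace (hι.lift a ha u)) :
    Function.Surjective (mfderiv (𝓡 7) (𝓡 5) hι.trace (hι.lift a ha u)) := by
  have h1 : HasMFDerivAt (𝓡 5) (𝓡 5) (fun u => hι.trace (hι.lift a ha u)) u _ :=
    (h.mdifferentiableAt (by simp)).hasMFDerivAt.comp u
      ((hι.contMDiff_lift hN hU ha u).mdifferentiableAt (by simp)).hasMFDerivAt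
  have h2 : HasMFDerivAt (𝓡 5) (𝓡 5) (fun u => hι.trace (hι.lift a ha u)) u
      (ContinuousLinearMap.id ℝ (TangentSpace (𝓡 5) u)) :=
    (hasMFDerivAt_id u).congr_of_eventuallyEq (Eventually.of_forall fun u => hι.trace_lift ha u)
  have h3 := hasMFDerivAt_unique h1 h2
  exact fun v => ⟨mfderiv (𝓡 5) (𝓡 7) (hι.lift a ha) u v, congrArg (fun l => l v) h3⟩

include hN in
theorem theta_eq {x₀ : M} {z : 𝓜.nullBundle} (hx : z.1.1 ∈ (extChartAt (𝓡 4) x₀).source)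
    (ζ : TangentSpace (𝓡 7) z) : 𝓜.theta ⟨z, ζ⟩ =
      (cotChart x₀ z.1).2 (mfderiv (𝓡 7)
        𝓘(ℝ, EuclideanSpace ℝ (Fin 4) × (EuclideanSpace ℝ (Fin 4) →L[ℝ] ℝ))
        (fun b : 𝓜.nullBundle => cotChart x₀ b.1) z ζ :
          EuclideanSpace ℝ (Fin 4) × (EuclideanSpace ℝ (Fin 4) →L[ℝ] ℝ)).1 :=
  canonicalForm_mfderiv_val hN hx ζ

include hU in
theorem contactForm_eq {x₀ : S} {u : 𝓜.unitCotangent ι}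
    (hx : u.1.1 ∈ (extChartAt (𝓡 3) x₀).source)
    (ζ : TangentSpace (𝓡 5) u) : 𝓜.contactForm ι ⟨u, ζ⟩ =
      (cotChart x₀ u.1).2 (mfderiv (𝓡 5)
        𝓘(ℝ, EuclideanSpace ℝ (Fin 3) × (EuclideanSpace ℝ (Fin 3) →L[ℝ] ℝ))
        (fun b : 𝓜.unitCotangent ι => cotChart x₀ b.1) u ζ :
          EuclideanSpace ℝ (Fin 3) × (EuclideanSpace ℝ (Fin 3) →L[ℝ] ℝ)).1 :=
  canonicalForm_mfderiv_val hU hx ζ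

-- The starting point of the propagation argument. Over the hypersurface the trace is computed in
-- one flow box: flow to the hitting point, restrict to S, normalise. The last clause of
-- `exists_hitting` compares the one-forms, and the factor `a⁻¹` comes from the normalisation.
include hN hU in
theorem isContactSubmersionAt_lift {a : ℝ} (ha : 0 < a) (u : 𝓜.unitCotangent ι) :
    hι.IsContactSubmersionAt (hι.lift a ha u) := by
  set x₀ := u.1.1 with hx₀
  set z₀ := hι.lift a ha u with hz₀
  have hx : u.1.1 ∈ (extChartAt (𝓡 3) x₀).source := mem_extChartAt_source _
  have hx' : ι u.1.1 ∈ (extChartAt (𝓡 4) (ι x₀)).source := mem_extChartAt_source _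
  have hz : z₀.1.1 ∈ (extChartAt (𝓡 4) (ι x₀)).source := hx'
  set y₀ := (cotChart x₀ u.1).1 with hy₀
  have hy₀D : y₀ ∈ coordDomain ι x₀ := by
    rw [hy₀, cotChart_fst]; exact chart_mem_coordDomain hx hx'
  set w₀ := cotChart (ι x₀) z₀.1 with hw₀
  have hw₀t : w₀ ∈ (cotChart (ι x₀) : PartialEquiv (Cotangent 4 M) _).target :=
    (cotChart (ι x₀)).map_source (mem_cotChart_source.2 hz)
  have hw₀1 : w₀.1 = coordEmb ι x₀ y₀ := by
    rw [hw₀, hy₀, cotChart_fst, cotChart_fst, coordEmb_chart hx]; rfl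
  have hφ : coordEmb ι x₀ y₀ = extChartAt (𝓡 4) (ι x₀) z₀.1.1 := by rw [← hw₀1, hw₀, cotChart_fst]
  obtain ⟨ε, hε, U, hUt, hUo, hwU, Fl, hF, hF0, hFd⟩ := 𝓜.exists_coord_flow (ι x₀) hw₀t
  have hjn := (hι.isOpen_coordDomain x₀).mem_nhds hy₀D
  obtain ⟨W, hWU, hW, hw₀W, τ, y, hτ, hy, hτ0, hyw₀, hprop, hθ⟩ :=
    exists_hitting (hι.isOpen_coordDomain x₀) (hι.contDiffOn_coordEmb x₀) hy₀D
      (hι.isSpacelikeFor_coord hy₀D) hι.finrank_eq hw₀1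
      (by rw [hw₀, 𝓜.raise_cotChart hz, hφ, 𝓜.coordMetric_coordD hz, 𝓜.g_sharp_sharp, z₀.2.1,
        mul_zero])
      (by rw [hw₀, 𝓜.raise_cotChart hz]; exact coordD_ne_zero hz (sharp_ne_zero z₀.2))
      (by rw [hw₀, 𝓜.ham_cotChart hz]; exact z₀.2.1) hε hUo hwU hF hF0
      (fun w hw t ht => (hFd w hw t ht).2)
  -- `Q` restricts the covector at the hitting point to the tangent space of S; `G` adds the base
  -- point and normalises, so it is the trace in canonical coordinates.
  let Q : EuclideanSpace ℝ (Fin 4) × (EuclideanSpace ℝ (Fin 4) →L[ℝ] ℝ) →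
      (EuclideanSpace ℝ (Fin 3) →L[ℝ] ℝ) := fun w =>
    (Fl (τ w, w)).2.comp (fderiv ℝ (coordEmb ι x₀) (y w))
  let G : EuclideanSpace ℝ (Fin 4) × (EuclideanSpace ℝ (Fin 4) →L[ℝ] ℝ) →
      EuclideanSpace ℝ (Fin 3) × (EuclideanSpace ℝ (Fin 3) →L[ℝ] ℝ) := fun w =>
    (y w, (√(Q w ((𝓜.coordInduced ι x₀ (y w)).inverse (Q w))))⁻¹ • Q w)
  have htrace : ∀ z : 𝓜.nullBundle,
      z.1 ∈ (cotChart (ι x₀) : PartialEquiv (Cotangent 4 M) _).source →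
      cotChart (ι x₀) z.1 ∈ W → (hι.trace z).1.1 ∈ (extChartAt (𝓡 3) x₀).source ∧
        cotChart x₀ (hι.trace z).1 = G (cotChart (ι x₀) z.1) := by
    intro z hzs hzW
    set w := cotChart (ι x₀) z.1
    obtain ⟨hτw, hyw, heq⟩ := hprop w hzW
    have hwU' := hWU hzW
    have h0 : (0 : ℝ) ∈ Ioo (-ε) ε := ⟨by linarith, hε⟩
    set c : ℝ → Cotangent 4 M := fun t => (cotChart (ι x₀)).symm (Fl (t, w)) with hc
    have hcf : 𝓜.IsGeodesicFlowLine c (Ioo (-ε) ε) := fun t ht =>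
      geodesicAt_of_hasDerivAt (f := fun t => Fl (t, w)) (hFd w hwU' t ht).1 (hFd w hwU' t ht).2
    have hc0 : c 0 = z.1 := by
      simp only [hc, hF0 w hwU']
      exact (cotChart (ι x₀)).left_inv hzs
    have hj : 𝓜.Joined z (c (τ w)) := ⟨c, _, isOpen_Ioo, ordConnected_Ioo, hcf, ⟨0, h0, hc0⟩,
      ⟨τ w, hτw, rfl⟩⟩
    have hcN : c (τ w) ∈ 𝓜.nullBundle := hcf.mem_nullBundle isOpen_Ioo ordConnected_Ioo h0 hτw
      (hc0 ▸ z.2)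
    have ht := (hFd w hwU' _ hτw).1
    have hproj : (c (τ w)).1 = ι ((extChartAt (𝓡 3) x₀).symm (y w)) := by
      have h1 : (Fl (τ w, w)).1 ∈ (extChartAt (𝓡 4) (ι x₀)).target := by
        rw [cotChart_target] at ht; exact ht.1
      have h2 : (c (τ w)).1 = _ := cotChart_symm_fst h1 (Fl (τ w, w)).2
      rw [h2, heq]
      exact (extChartAt (𝓡 4) (ι x₀)).left_inv hyw.2
    have key := hι.cotChart_trace hj hcN hyw hproj
    have hκc : cotChart (ι x₀) (c (τ w)) = Fl (τ w, w) := (cotChart (ι x₀)).right_inv ht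
    rw [hκc] at key
    exact ⟨key.1 ▸ (extChartAt (𝓡 3) x₀).map_target hyw.1, key.2⟩
  have hτd : ContDiffAt ℝ ∞ τ w₀ := hτ.contDiffAt (hW.mem_nhds hw₀W)
  have hyd : ContDiffAt ℝ ∞ y w₀ := hy.contDiffAt (hW.mem_nhds hw₀W)
  have hFld : ContDiffAt ℝ ∞ (fun w => Fl (τ w, w)) w₀ := by
    have h1 : ContDiffAt ℝ ∞ Fl (τ w₀, w₀) := hF.contDiffAt ((isOpen_Ioo.prod hUo).mem_nhds
      ⟨(hprop w₀ hw₀W).1, hwU⟩)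
    exact ContDiffAt.comp (f := fun w => (τ w, w)) w₀ h1 (hτd.prodMk contDiffAt_id)
  have hDy : ContDiffAt ℝ ∞ (fun w => fderiv ℝ (coordEmb ι x₀) (y w)) w₀ :=
    ContDiffAt.comp w₀ (by rw [hyw₀]; exact (hι.contDiffOn_fderiv_coordEmb x₀).contDiffAt hjn) hyd
  have hgy : ContDiffAt ℝ ∞ (fun w => 𝓜.coordMetric (ι x₀) (coordEmb ι x₀ (y w))) w₀ :=
    ContDiffAt.comp (g := fun y => 𝓜.coordMetric (ι x₀) (coordEmb ι x₀ y)) w₀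
      (by rw [hyw₀]; exact (hι.contDiffOn_coordMetric_coordEmb x₀).contDiffAt hjn) hyd
  have hQd : ContDiffAt ℝ ∞ Q w₀ := hFld.snd.clm_comp hDy
  have hsp : IsSpacelikeFor (fderiv ℝ (coordEmb ι x₀) (y w₀))
      (𝓜.coordMetric (ι x₀) (coordEmb ι x₀ (y w₀))) (𝓜.coordT (ι x₀) (coordEmb ι x₀ (y w₀))) := by
    rw [hyw₀]; exact hι.isSpacelikeFor_coord hy₀D
  have hQw₀ : Q w₀ = a • (cotChart x₀ u.1).2 := by
    simp only [Q]
    rw [hτ0, hF0 w₀ hwU, hyw₀]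
    exact hι.cotChart_scaledLift_comp ha u.2 hx hx'
  have hnorm := hι.conorm_cotChart u.2 hx hx'
  have hQpos : 0 < Q w₀ ((𝓜.coordInduced ι x₀ (y w₀)).inverse (Q w₀)) := by
    refine hsp.conorm_pos ?_
    rw [hQw₀]
    refine smul_ne_zero ha.ne' fun h0 => ?_
    rw [h0] at hnorm
    simp at hnorm
  have hGd : ContDiffAt ℝ ∞ G w₀ := by
    have h1 : ContDiffAt ℝ ∞ (fun w => (𝓜.coordInduced ι x₀ (y w)).inverse (Q w)) w₀ :=
      contDiffAt_inverse_pullForm (T := fun w => 𝓜.coordT (ι x₀) (coordEmb ι x₀ (y w)))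
        hDy hgy hQd hsp
    exact hyd.prodMk ((((hQd.clm_apply h1).sqrt hQpos.ne').inv
      (Real.sqrt_pos.2 hQpos).ne').smul hQd)
  have htr0 : hι.trace z₀ = u := hι.trace_lift ha u
  have hκ : ContMDiffAt (𝓡 7)
      𝓘(ℝ, EuclideanSpace ℝ (Fin 4) × (EuclideanSpace ℝ (Fin 4) →L[ℝ] ℝ)) ∞
      (fun z : 𝓜.nullBundle => cotChart (ι x₀) z.1) z₀ :=
    (contMDiffAt_cotChart hz).comp z₀ (hN.contMDiff_incl z₀)
  have hev : ∀ᶠ z : 𝓜.nullBundle in 𝓝 z₀,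
      (hι.trace z).1.1 ∈ (extChartAt (𝓡 3) x₀).source ∧
        cotChart x₀ (hι.trace z).1 = G (cotChart (ι x₀) z.1) := by
    filter_upwards [((isOpen_cotChart_source (ι x₀)).preimage continuous_subtype_val).mem_nhds
      (mem_cotChart_source.2 hz), hκ.continuousAt (hW.mem_nhds hw₀W)] with z h1 h2
    exact htrace z h1 h2
  have hGκ : ContMDiffAt (𝓡 7)
      𝓘(ℝ, EuclideanSpace ℝ (Fin 3) × (EuclideanSpace ℝ (Fin 3) →L[ℝ] ℝ)) ∞
      (fun z : 𝓜.nullBundle => G (cotChart (ι x₀) z.1)) z₀ :=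
    ContMDiffAt.comp z₀ (g := G) hGd.contMDiffAt hκ
  have hGt : G (cotChart (ι x₀) z₀.1) ∈ (cotChart x₀ : PartialEquiv (Cotangent 3 S) _).target := by
    rw [← hev.self_of_nhds.2]
    exact (cotChart x₀).map_source (mem_cotChart_source.2 hev.self_of_nhds.1)
  have hsmooth : ContMDiffAt (𝓡 7) (𝓡 5) ∞ hι.trace z₀ := by
    refine hU.contMDiffAt_of_comp ?_
    have h1 : ContMDiffAt (𝓡 7) (cotangentModel 3) ∞
        (fun z : 𝓜.nullBundle => (cotChart x₀).symm (G (cotChart (ι x₀) z.1))) z₀ :=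
      ContMDiffAt.comp z₀ ((contMDiffOn_cotChart_symm x₀).contMDiffAt
        ((isOpen_cotChart_target x₀).mem_nhds hGt)) hGκ
    refine h1.congr_of_eventuallyEq ?_
    filter_upwards [hev] with z hz
    rw [← hz.2, (cotChart x₀).left_inv (mem_cotChart_source.2 hz.1)]
  refine ⟨hsmooth, hι.surjective_mfderiv_trace hN hU ha u hsmooth, a⁻¹, inv_ne_zero ha.ne',
    fun ζ => ?_⟩
  have htrx : (hι.trace z₀).1.1 ∈ (extChartAt (𝓡 3) x₀).source := hev.self_of_nhds.1
  rw [contactForm_eq hU htrx, theta_eq hN hz]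
  have hκU : MDifferentiableAt (𝓡 5)
      𝓘(ℝ, EuclideanSpace ℝ (Fin 3) × (EuclideanSpace ℝ (Fin 3) →L[ℝ] ℝ))
      (fun b : 𝓜.unitCotangent ι => cotChart x₀ b.1) (hι.trace z₀) :=
    ((contMDiffAt_cotChart htrx).comp (hι.trace z₀) (hU.contMDiff_incl _)).mdifferentiableAt
      (by simp)
  have hc1 : HasMFDerivAt (𝓡 7)
      𝓘(ℝ, EuclideanSpace ℝ (Fin 3) × (EuclideanSpace ℝ (Fin 3) →L[ℝ] ℝ))
      (fun z : 𝓜.nullBundle => cotChart x₀ (hι.trace z).1) z₀ _ :=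
    hκU.hasMFDerivAt.comp z₀ (hsmooth.mdifferentiableAt (by simp)).hasMFDerivAt
  have hGf : HasFDerivAt G (fderiv ℝ G w₀) w₀ := (hGd.differentiableAt (by simp)).hasFDerivAt
  have hc2 : HasMFDerivAt (𝓡 7)
      𝓘(ℝ, EuclideanSpace ℝ (Fin 3) × (EuclideanSpace ℝ (Fin 3) →L[ℝ] ℝ))
      (fun z : 𝓜.nullBundle => G (cotChart (ι x₀) z.1)) z₀ _ :=
    HasMFDerivAt.comp z₀ (g := G) hGf.hasMFDerivAt
      (hκ.mdifferentiableAt (by simp)).hasMFDerivAt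
  have hc3 := hasMFDerivAt_unique hc1 (hc2.congr_of_eventuallyEq (hev.mono fun z hz => hz.2))
  set ξ : EuclideanSpace ℝ (Fin 4) × (EuclideanSpace ℝ (Fin 4) →L[ℝ] ℝ) := mfderiv (𝓡 7)
        𝓘(ℝ, EuclideanSpace ℝ (Fin 4) × (EuclideanSpace ℝ (Fin 4) →L[ℝ] ℝ))
        (fun b : 𝓜.nullBundle => cotChart (ι x₀) b.1) z₀ ζ
  have hc4 : (mfderiv (𝓡 5)
        𝓘(ℝ, EuclideanSpace ℝ (Fin 3) × (EuclideanSpace ℝ (Fin 3) →L[ℝ] ℝ))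
        (fun b : 𝓜.unitCotangent ι => cotChart x₀ b.1) (hι.trace z₀)
        (mfderiv (𝓡 7) (𝓡 5) hι.trace z₀ ζ) :
          EuclideanSpace ℝ (Fin 3) × (EuclideanSpace ℝ (Fin 3) →L[ℝ] ℝ)) = fderiv ℝ G w₀ ξ :=
    congrArg (fun l => l ζ) hc3
  rw [hc4]
  -- The canonical form sees only the base part of the differential, which is the derivative of the
  -- hitting point.
  have hG1 : (fderiv ℝ G w₀ ξ).1 = fderiv ℝ y w₀ ξ := by
    have : HasFDerivAt y _ w₀ := hGf.fst
    rw [this.fderiv]; rfl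
  rw [hG1, htr0]
  have h5 := congrArg (fun l : EuclideanSpace ℝ (Fin 3) →L[ℝ] ℝ => l (fderiv ℝ y w₀ ξ)) hQw₀
  simp only [Q] at h5
  rw [hτ0, hF0 w₀ hwU, hyw₀] at h5
  have h6 : w₀.2 (fderiv ℝ (coordEmb ι x₀) y₀ (fderiv ℝ y w₀ ξ)) =
    a * (cotChart x₀ u.1).2 (fderiv ℝ y w₀ ξ) := h5
  rw [hθ ξ] at h6
  change _ = a⁻¹ * w₀.2 ξ.1
  rw [h6, inv_mul_cancel_left₀ ha.ne']

end Spacetime.IsCauchySurface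

end

/-! ### Propagation along null geodesics -/

section
variable {M : Type*} [TopologicalSpace M] [ChartedSpace (EuclideanSpace ℝ (Fin 4)) M]
  [IsManifold (𝓡 4) ∞ M] {𝓜 : Spacetime M}
  {S : Type*} [TopologicalSpace S] [ChartedSpace (EuclideanSpace ℝ (Fin 3)) S]
  [IsManifold (𝓡 3) ∞ S] {ι : S → M}

namespace Spacetime

set_option linter.unusedSectionVars false

/-- A local symmetry of the space of null covectors at `z`: a map that is smooth at `z`, preserves
`θ` at `z`, and maps the points near `z` to points on the same integral curve of the geodesic
spray. -/
structure IsFlowMapAt [ChartedSpace (EuclideanSpace ℝ (Fin 7)) 𝓜.nullBundle]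
    (f : 𝓜.nullBundle → 𝓜.nullBundle) (z : 𝓜.nullBundle) : Prop where
  contMDiffAt : ContMDiffAt (𝓡 7) (𝓡 7) ∞ f z
  joined : ∀ᶠ z' in 𝓝 z, 𝓜.Joined z'.1 (f z').1
  theta : ∀ ζ : TangentSpace (𝓡 7) z,
    𝓜.theta ⟨f z, mfderiv (𝓡 7) (𝓡 7) f z ζ⟩ = 𝓜.theta ⟨z, ζ⟩

namespace IsCauchySurface

variable [T2Space M] (hι : 𝓜.IsCauchySurface ι)
  [ChartedSpace (EuclideanSpace ℝ (Fin 7)) 𝓜.nullBundle]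
  [ChartedSpace (EuclideanSpace ℝ (Fin 5)) (𝓜.unitCotangent ι)]

/-- The trace is constant along geodesics, so near `z` it equals itself composed with `f`;
smoothness and the relation to θ are pulled back along `f`. Surjectivity uses `g`: the differential
at `f z` factors through the one at `g (f z) = z`. -/
theorem IsContactSubmersionAt.of_flowMap {f g : 𝓜.nullBundle → 𝓜.nullBundle} {z : 𝓜.nullBundle}
    (hf : IsFlowMapAt f z) (hg : IsFlowMapAt g (f z)) (hgf : g (f z) = z)
    (h : hι.IsContactSubmersionAt (f z)) : hι.IsContactSubmersionAt z := by
  have hev : hι.trace =ᶠ[𝓝 z] fun z' => hι.trace (f z') :=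
    hf.joined.mono fun z' hz' => hι.trace_eq_of_sameLeaf hz'.sameLeaf
  have hev' : hι.trace =ᶠ[𝓝 (f z)] fun z' => hι.trace (g z') :=
    hg.joined.mono fun z' hz' => hι.trace_eq_of_sameLeaf hz'.sameLeaf
  have hs : ContMDiffAt (𝓡 7) (𝓡 5) ∞ hι.trace z :=
    (h.contMDiffAt.comp z hf.contMDiffAt).congr_of_eventuallyEq hev
  have hs' : ContMDiffAt (𝓡 7) (𝓡 5) ∞ hι.trace (g (f z)) := by rwa [hgf]
  have hd : HasMFDerivAt (𝓡 7) (𝓡 5) hι.trace z _ :=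
    ((h.contMDiffAt.mdifferentiableAt (by simp)).hasMFDerivAt.comp z
      (hf.contMDiffAt.mdifferentiableAt (by simp)).hasMFDerivAt).congr_of_eventuallyEq hev
  have hd' : HasMFDerivAt (𝓡 7) (𝓡 5) hι.trace (f z) _ :=
    ((hs'.mdifferentiableAt (by simp)).hasMFDerivAt.comp (f z)
      (hg.contMDiffAt.mdifferentiableAt (by simp)).hasMFDerivAt).congr_of_eventuallyEq hev'
  have hz : hι.trace z = hι.trace (f z) := hev.self_of_nhds
  refine ⟨hs, ?_, ?_⟩
  · have h1 : Function.Surjective (mfderiv (𝓡 7) (𝓡 5) hι.trace (g (f z))) := by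
      intro v
      obtain ⟨ζ, hζ⟩ := h.surjective v
      exact ⟨mfderiv (𝓡 7) (𝓡 7) g (f z) ζ,
        (congrArg (fun l => l ζ) hd'.mfderiv).symm.trans hζ⟩
    rwa [hgf] at h1
  · obtain ⟨a, ha, hθ⟩ := h.theta
    refine ⟨a, ha, fun ζ => ?_⟩
    rw [← hf.theta ζ, ← hθ, hd.mfderiv, hz]
    rfl

end IsCauchySurface

variable [T2Space M] [ChartedSpace (EuclideanSpace ℝ (Fin 7)) 𝓜.nullBundle]
  (hN : HasRetractions (cotangentModel 4) 7 𝓜.nullBundle)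

include hN in
/-- The local flow of the geodesic spray on the null covectors. -/
theorem exists_flowMap (z₀ : 𝓜.nullBundle) : ∃ ε > 0, ∃ O : Set (Cotangent 4 M), IsOpen O ∧
    z₀.1 ∈ O ∧ ∀ s ∈ Ioo (-ε) ε, ∃ f : 𝓜.nullBundle → 𝓜.nullBundle, ∀ z : 𝓜.nullBundle, z.1 ∈ O →
      IsFlowMapAt f z ∧ ∀ (c : ℝ → Cotangent 4 M) (J : Set ℝ), IsOpen J → J.OrdConnected →
        𝓜.IsGeodesicFlowLine c J → ∀ r ∈ J, c r = z.1 → r + s ∈ J → c (r + s) = (f z).1 := by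
  classical
  set x₀ := z₀.1.1 with hx₀
  have hz₀ : z₀.1.1 ∈ (extChartAt (𝓡 4) x₀).source := mem_extChartAt_source _
  have hw₀t : cotChart x₀ z₀.1 ∈ (cotChart x₀ : PartialEquiv (Cotangent 4 M) _).target :=
    (cotChart x₀).map_source (mem_cotChart_source.2 hz₀)
  obtain ⟨ε, hε, U, hUt, hUo, hwU, Fl, hF, hF0, hFd⟩ := 𝓜.exists_coord_flow x₀ hw₀t
  have h0 : (0 : ℝ) ∈ Ioo (-ε) ε := ⟨by linarith, hε⟩
  set O : Set (Cotangent 4 M) :=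
    (cotChart x₀ : PartialEquiv (Cotangent 4 M) _).source ∩ cotChart x₀ ⁻¹' U with hO
  have hOo : IsOpen O :=
    (contMDiffOn_cotChart x₀).continuousOn.isOpen_inter_preimage (isOpen_cotChart_source x₀) hUo
  refine ⟨ε, hε, O, hOo, ⟨mem_cotChart_source.2 hz₀, hwU⟩, fun s hs => ?_⟩
  let C : Cotangent 4 M → ℝ → Cotangent 4 M := fun z t =>
    (cotChart x₀).symm (Fl (t, cotChart x₀ z))
  have hC : ∀ z ∈ O, 𝓜.IsGeodesicFlowLine (C z) (Ioo (-ε) ε) := fun z hz t ht =>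
    geodesicAt_of_hasDerivAt (f := fun t => Fl (t, cotChart x₀ z)) (hFd _ hz.2 t ht).1
      (hFd _ hz.2 t ht).2
  have hC0 : ∀ z ∈ O, C z 0 = z := fun z hz => by
    simp only [C]; rw [hF0 _ hz.2, (cotChart x₀).left_inv hz.1]
  have hCN : ∀ z ∈ O, z ∈ 𝓜.nullBundle → C z s ∈ 𝓜.nullBundle := fun z hz hzN =>
    (hC z hz).mem_nullBundle isOpen_Ioo ordConnected_Ioo h0 hs (by rwa [hC0 z hz])
  -- Off `O` the identity only serves to make the map total; nothing is claimed there.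
  let f : 𝓜.nullBundle → 𝓜.nullBundle := fun z =>
    if h : z.1 ∈ O then ⟨C z.1 s, hCN z.1 h z.2⟩ else z
  have hf : ∀ z : 𝓜.nullBundle, z.1 ∈ O → (f z).1 = C z.1 s := fun z hz => by
    simp only [f]; rw [dif_pos hz]
  refine ⟨f, fun z hz => ⟨?_, ?_⟩⟩
  · have hnear : ∀ᶠ z' : 𝓜.nullBundle in 𝓝 z, z'.1 ∈ O :=
      (hOo.preimage continuous_subtype_val).mem_nhds hz
    have hzs := mem_cotChart_source.1 hz.1
    have hκ : ContMDiffAt (𝓡 7)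
        𝓘(ℝ, EuclideanSpace ℝ (Fin 4) × (EuclideanSpace ℝ (Fin 4) →L[ℝ] ℝ)) ∞
        (fun z : 𝓜.nullBundle => cotChart x₀ z.1) z :=
      (contMDiffAt_cotChart hzs).comp z (hN.contMDiff_incl z)
    have hFs : ContDiffAt ℝ ∞ (fun w => Fl (s, w)) (cotChart x₀ z.1) := by
      have h1 : ContDiffAt ℝ ∞ Fl (s, cotChart x₀ z.1) :=
        hF.contDiffAt ((isOpen_Ioo.prod hUo).mem_nhds ⟨hs, hz.2⟩)
      exact ContDiffAt.comp (f := fun w => (s, w)) _ h1 (by fun_prop)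
    have hFκ : ContMDiffAt (𝓡 7)
        𝓘(ℝ, EuclideanSpace ℝ (Fin 4) × (EuclideanSpace ℝ (Fin 4) →L[ℝ] ℝ)) ∞
        (fun z : 𝓜.nullBundle => Fl (s, cotChart x₀ z.1)) z :=
      ContMDiffAt.comp z (g := fun w => Fl (s, w)) hFs.contMDiffAt hκ
    have ht := (hFd _ hz.2 s hs).1
    have hsm : ContMDiffAt (𝓡 7) (𝓡 7) ∞ f z := by
      refine hN.contMDiffAt_of_comp ?_
      have h1 : ContMDiffAt (𝓡 7) (cotangentModel 4) ∞ (fun z : 𝓜.nullBundle => C z.1 s) z :=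
        ContMDiffAt.comp z ((contMDiffOn_cotChart_symm x₀).contMDiffAt
          ((isOpen_cotChart_target x₀).mem_nhds ht)) hFκ
      exact h1.congr_of_eventuallyEq (hnear.mono fun z' hz' => hf z' hz')
    refine ⟨hsm, hnear.mono fun z' hz' => ?_, fun ζ => ?_⟩
    · exact ⟨C z'.1, _, isOpen_Ioo, ordConnected_Ioo, hC _ hz', ⟨0, h0, hC0 _ hz'⟩,
        ⟨s, hs, (hf z' hz').symm⟩⟩
    have hev : (fun z : 𝓜.nullBundle => cotChart x₀ (f z).1) =ᶠ[𝓝 z]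
        fun z => Fl (s, cotChart x₀ z.1) := hnear.mono fun z' hz' =>
      (congrArg (cotChart x₀) (hf z' hz')).trans ((cotChart x₀).right_inv (hFd _ hz'.2 s hs).1)
    have hfs : (f z).1.1 ∈ (extChartAt (𝓡 4) x₀).source := by
      rw [← mem_cotChart_source, hf z hz]
      exact (cotChart x₀).map_target ht
    rw [IsCauchySurface.theta_eq hN hfs, IsCauchySurface.theta_eq hN hzs]
    have hκf : MDifferentiableAt (𝓡 7)
        𝓘(ℝ, EuclideanSpace ℝ (Fin 4) × (EuclideanSpace ℝ (Fin 4) →L[ℝ] ℝ))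
        (fun b : 𝓜.nullBundle => cotChart x₀ b.1) (f z) :=
      ((contMDiffAt_cotChart hfs).comp (f z) (hN.contMDiff_incl _)).mdifferentiableAt (by simp)
    have hc1 : HasMFDerivAt (𝓡 7)
        𝓘(ℝ, EuclideanSpace ℝ (Fin 4) × (EuclideanSpace ℝ (Fin 4) →L[ℝ] ℝ))
        (fun z : 𝓜.nullBundle => cotChart x₀ (f z).1) z _ :=
      hκf.hasMFDerivAt.comp z (hsm.mdifferentiableAt (by simp)).hasMFDerivAt
    have hκd := (hκ.mdifferentiableAt (by simp)).hasMFDerivAt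
    have hc2 : HasMFDerivAt (𝓡 7)
        𝓘(ℝ, EuclideanSpace ℝ (Fin 4) × (EuclideanSpace ℝ (Fin 4) →L[ℝ] ℝ))
        (fun z : 𝓜.nullBundle => Fl (s, cotChart x₀ z.1)) z _ :=
      HasMFDerivAt.comp z (g := fun w => Fl (s, w))
        (hFs.differentiableAt (by simp)).hasFDerivAt.hasMFDerivAt hκd
    have hc3 := hasMFDerivAt_unique hc1 (hc2.congr_of_eventuallyEq hev)
    set ξ : EuclideanSpace ℝ (Fin 4) × (EuclideanSpace ℝ (Fin 4) →L[ℝ] ℝ) := mfderiv (𝓡 7)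
      𝓘(ℝ, EuclideanSpace ℝ (Fin 4) × (EuclideanSpace ℝ (Fin 4) →L[ℝ] ℝ))
      (fun b : 𝓜.nullBundle => cotChart x₀ b.1) z ζ with hξ
    have hc4 : (mfderiv (𝓡 7)
        𝓘(ℝ, EuclideanSpace ℝ (Fin 4) × (EuclideanSpace ℝ (Fin 4) →L[ℝ] ℝ))
        (fun b : 𝓜.nullBundle => cotChart x₀ b.1) (f z)
        (mfderiv (𝓡 7) (𝓡 7) f z ζ) :
          EuclideanSpace ℝ (Fin 4) × (EuclideanSpace ℝ (Fin 4) →L[ℝ] ℝ)) =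
        fderiv ℝ (fun w => Fl (s, w)) (cotChart x₀ z.1) ξ :=
      congrArg (fun l => l ζ) hc3
    have hev0 : cotChart x₀ (f z).1 = Fl (s, cotChart x₀ z.1) := hev.self_of_nhds
    rw [hc4, hev0]
    -- `ξ` annihilates the differential of the Hamiltonian
    have hham : fderiv ℝ (ham (𝓜.coordMetric x₀)) (cotChart x₀ z.1) ξ = 0 := by
      have h1 : HasMFDerivAt (𝓡 7) 𝓘(ℝ, ℝ)
          (fun z : 𝓜.nullBundle => ham (𝓜.coordMetric x₀) (cotChart x₀ z.1)) z _ :=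
        HasMFDerivAt.comp z (g := ham (𝓜.coordMetric x₀))
          ((𝓜.isMetricOn_coordMetric x₀).hasFDerivAt_ham
            (cotChart_fst_mem_target hzs)).hasMFDerivAt hκd
      have h2 : HasMFDerivAt (𝓡 7) 𝓘(ℝ, ℝ)
          (fun z : 𝓜.nullBundle => ham (𝓜.coordMetric x₀) (cotChart x₀ z.1)) z
          (0 : TangentSpace (𝓡 7) z →L[ℝ] ℝ) :=
        (hasMFDerivAt_const (0 : ℝ) z).congr_of_eventuallyEq (hnear.mono fun z' hz' =>
          (𝓜.ham_cotChart (mem_cotChart_source.1 hz'.1)).trans z'.2.1)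
      exact congrArg (fun l => l ζ) (hasMFDerivAt_unique h1 h2)
    exact (𝓜.isMetricOn_coordMetric x₀).canonical_flow hUo hF hF0
      (fun w hw t ht => ⟨cotChart_target (n := 4) x₀ ▸ (hFd w hw t ht).1, (hFd w hw t ht).2⟩)
      hz.2 hham hs
  -- By uniqueness `f` advances every geodesic through `z` by the time `s`. This is what shows that
  -- the maps for opposite times invert each other along a geodesic.
  · intro c J hJ hJc hc r hr hcr hrs
    have h1 : 𝓜.IsGeodesicFlowLine (fun t => c (t + r)) ((fun t => t + r) ⁻¹' J ∩ Ioo (-ε) ε) :=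
      (hc.comp_add (a := r)).mono inter_subset_left
    have h2 := (hC z.1 hz).mono (inter_subset_right (s := (fun t => t + r) ⁻¹' J))
    have h3 := h1.eqOn ((isOpen_preimage_add hJ r).inter isOpen_Ioo)
      ((ordConnected_preimage_add hJc r).inter ordConnected_Ioo) h2 (t₀ := 0)
      ⟨by simpa using hr, h0⟩ (by simp only [zero_add]; rw [hcr, hC0 _ hz])
    have h4 := h3 (x := s) ⟨by simpa [add_comm] using hrs, hs⟩
    rw [hf z hz, ← h4, add_comm r s]

namespace IsCauchySurface
variable (hι : 𝓜.IsCauchySurface ι)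
  [ChartedSpace (EuclideanSpace ℝ (Fin 5)) (𝓜.unitCotangent ι)]

-- Flow maps in both directions make the property at one time equivalent to the property at all
-- nearby times, and an interval is connected.
include hN in
theorem isContactSubmersionAt_iff_of_joined {z z' : 𝓜.nullBundle} (h : 𝓜.Joined z.1 z'.1) :
    hι.IsContactSubmersionAt z ↔ hι.IsContactSubmersionAt z' := by
  obtain ⟨c, J, hJ, hJc, hc, ⟨t, ht, htz⟩, ⟨t', ht', htz'⟩⟩ := h
  let P : ℝ → Prop := fun r => ∀ hr : c r ∈ 𝓜.nullBundle, hι.IsContactSubmersionAt ⟨c r, hr⟩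
  have hmem : ∀ r ∈ J, c r ∈ 𝓜.nullBundle := fun r hr =>
    hc.mem_nullBundle hJ hJc ht hr (by rw [htz]; exact z.2)
  have hloc : ∀ r ∈ J, ∀ᶠ r' in 𝓝 r, (P r ↔ P r') := by
    intro r hr
    obtain ⟨ε, hε, O, hO, hrO, hfl⟩ := exists_flowMap hN ⟨c r, hmem r hr⟩
    have hcc : ContinuousAt c r := GeodesicAt.continuousAt (hc r hr)
    filter_upwards [hcc (hO.mem_nhds hrO), hJ.mem_nhds hr,
      Ioo_mem_nhds (show r - ε < r by linarith) (show r < r + ε by linarith)] with r' hr'O hr'J hr'ε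
    obtain ⟨f, hf⟩ := hfl (r' - r) ⟨by linarith [hr'ε.1], by linarith [hr'ε.2]⟩
    obtain ⟨g, hg⟩ := hfl (r - r') ⟨by linarith [hr'ε.2], by linarith [hr'ε.1]⟩
    have hf1 := hf ⟨c r, hmem r hr⟩ hrO
    have hg1 := hg ⟨c r', hmem r' hr'J⟩ hr'O
    have hfe : f ⟨c r, hmem r hr⟩ = ⟨c r', hmem r' hr'J⟩ := Subtype.ext <| by
      rw [← hf1.2 c J hJ hJc hc r hr rfl (by rwa [add_sub_cancel]), add_sub_cancel]
    have hge : g ⟨c r', hmem r' hr'J⟩ = ⟨c r, hmem r hr⟩ := Subtype.ext <| by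
      rw [← hg1.2 c J hJ hJc hc r' hr'J rfl (by rwa [add_sub_cancel]), add_sub_cancel]
    constructor
    · intro h _
      refine IsContactSubmersionAt.of_flowMap hι hg1.1 (g := f) ?_ ?_ ?_
      · rw [hge]; exact hf1.1
      · rw [hge, hfe]
      · rw [hge]; exact h _
    · intro h _
      refine IsContactSubmersionAt.of_flowMap hι hf1.1 (g := g) ?_ ?_ ?_
      · rw [hfe]; exact hg1.1
      · rw [hfe, hge]
      · rw [hfe]; exact h _
  have key : P t ↔ P t' :=
    hJc.isPreconnected.induction₂ (fun r r' => P r ↔ P r')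
      (fun r hr => (hloc r hr).filter_mono nhdsWithin_le_nhds)
      (fun _ _ _ _ _ _ h1 h2 => h1.trans h2) (fun _ _ _ _ h => h.symm) ht ht'
  have h1 : P t ↔ hι.IsContactSubmersionAt z := by
    have : (⟨c t, hmem t ht⟩ : 𝓜.nullBundle) = z := Subtype.ext htz
    rw [← this]
    exact ⟨fun h => h _, fun h _ => h⟩
  have h2 : P t' ↔ hι.IsContactSubmersionAt z' := by
    have : (⟨c t', hmem t' ht'⟩ : 𝓜.nullBundle) = z' := Subtype.ext htz'
    rw [← this]
    exact ⟨fun h => h _, fun h _ => h⟩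
  rw [← h1, key, h2]

include hN in
/-- The trace of null geodesics on the Cauchy surface is a submersion that pulls back the contact
planes to the planes `ker θ`. -/
theorem isContactSubmersionAt (hU : HasRetractions (cotangentModel 3) 5 (𝓜.unitCotangent ι))
    (z : 𝓜.nullBundle) : hι.IsContactSubmersionAt z := by
  obtain ⟨a, ha, u, hu, hj⟩ := hι.exists_joined_scaledLift z.2
  exact (isContactSubmersionAt_iff_of_joined hN hι (z' := hι.lift a ha ⟨u, hu⟩) hj).2
    (hι.isContactSubmersionAt_lift hN hU ha ⟨u, hu⟩)

end IsCauchySurface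
end Spacetime
end

/-! ### Contact structures defined by maps to symplectic vector spaces -/

/-- A linear map to `E × E*` pulls back the form `p dx` to a form `α ≠ 0`, and the symplectic form
to a form that is nondegenerate on `ker α`. -/
def IsContactMap {V E : Type*} [AddCommGroup V] [Module ℝ V] [TopologicalSpace V]
    [NormedAddCommGroup E] [NormedSpace ℝ E] (p : E →L[ℝ] ℝ) (L : V →L[ℝ] E × (E →L[ℝ] ℝ)) : Prop :=
  (∃ v, p (L v).1 ≠ 0) ∧
    ∀ v, p (L v).1 = 0 → (∀ w, p (L w).1 = 0 → (L v).2 (L w).1 - (L w).2 (L v).1 = 0) → v = 0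

/-- The unit cosphere bundle of a metric is of contact type. -/
theorem IsMetricOn.isContactMap {V E : Type*} [NormedAddCommGroup V] [NormedSpace ℝ V]
    [FiniteDimensional ℝ V] [NormedAddCommGroup E] [NormedSpace ℝ E] [FiniteDimensional ℝ E]
    {g : E → E →L[ℝ] E →L[ℝ] ℝ} {Ω : Set E} (hg : IsMetricOn g Ω) {z : E × (E →L[ℝ] ℝ)}
    (hz : z.1 ∈ Ω) (h1 : 2 * ham g z = 1) {L : V →L[ℝ] E × (E →L[ℝ] ℝ)}
    (hL : Function.Injective L) (hL0 : ∀ v, fderiv ℝ (ham g) z (L v) = 0)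
    (hdim : Module.finrank ℝ E + Module.finrank ℝ E = Module.finrank ℝ V + 1) :
    IsContactMap z.2 L := by
  set X := hamField g z with hX
  set l := fderiv ℝ (ham g) z with hl
  have hθX : z.2 X.1 = 1 := (hg.apply_hamField_fst z).trans h1
  have hle : l (0, z.2) = 1 := by rw [hl, hg.fderiv_ham hz]; simpa using hθX
  have hl0 : (l : E × (E →L[ℝ] ℝ) →ₗ[ℝ] ℝ) ≠ 0 := fun h => by
    have := congrArg (fun m : E × (E →L[ℝ] ℝ) →ₗ[ℝ] ℝ => m (0, z.2)) h
    exact one_ne_zero (hle.symm.trans this)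
  -- The image lies in the hyperplane ker dH and has its dimension, so every vector killed by dH
  -- comes from `V`.
  have hrange : LinearMap.range (L : V →ₗ[ℝ] E × (E →L[ℝ] ℝ)) =
      LinearMap.ker (l : E × (E →L[ℝ] ℝ) →ₗ[ℝ] ℝ) := by
    refine Submodule.eq_of_le_of_finrank_eq ?_ ?_
    · rintro _ ⟨v, rfl⟩
      exact hL0 v
    · have h2 := Module.Dual.finrank_ker_add_one_of_ne_zero hl0
      rw [Spacetime.finrank_prod_dual, hdim] at h2
      rw [LinearMap.finrank_range_of_inj hL]
      omega
  have hmem : ∀ w, l w = 0 → ∃ v, L v = w := fun w hw => by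
    have : w ∈ LinearMap.range (L : V →ₗ[ℝ] E × (E →L[ℝ] ℝ)) := by rw [hrange]; exact hw
    exact this
  have hlX : l X = 0 := hg.fderiv_ham_hamField hz
  refine ⟨?_, fun v hv hvw => ?_⟩
  · obtain ⟨v, hv⟩ := hmem X hlX
    exact ⟨v, by rw [hv, hθX]; exact one_ne_zero⟩
  -- `ψ` is ω(L v, ·). It vanishes where dH and θ both do, so ψ = c₀ dH + c₁ θ. On the Euler vector
  -- `(0, z.2)`, dH is 1 while θ and ψ vanish, so c₀ = 0; on the Hamiltonian vector, θ is 1 while dH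
  -- and ψ vanish, so c₁ = 0. Nondegeneracy of ω then gives L v = 0.
  let ψ : E × (E →L[ℝ] ℝ) →ₗ[ℝ] ℝ :=
    ((L v).2 : E →ₗ[ℝ] ℝ).comp (LinearMap.fst ℝ E (E →L[ℝ] ℝ)) -
      ((ContinuousLinearMap.apply ℝ ℝ (L v).1 : (E →L[ℝ] ℝ) →L[ℝ] ℝ) :
        (E →L[ℝ] ℝ) →ₗ[ℝ] ℝ).comp (LinearMap.snd ℝ E (E →L[ℝ] ℝ))
  have hψ : ∀ w, ψ w = (L v).2 w.1 - w.2 (L v).1 := fun w => rfl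
  let K : Fin 2 → E × (E →L[ℝ] ℝ) →ₗ[ℝ] ℝ :=
    ![(l : E × (E →L[ℝ] ℝ) →ₗ[ℝ] ℝ), (z.2 : E →ₗ[ℝ] ℝ).comp (LinearMap.fst ℝ E (E →L[ℝ] ℝ))]
  have hspan : ψ ∈ Submodule.span ℝ (range K) := by
    refine mem_span_of_iInf_ker_le_ker fun w hw => ?_
    rw [Submodule.mem_iInf] at hw
    have hw0 : l w = 0 := hw 0
    have hw1 : z.2 w.1 = 0 := hw 1
    obtain ⟨w', rfl⟩ := hmem w hw0
    exact hvw w' hw1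
  obtain ⟨c, hc⟩ := (Submodule.mem_span_range_iff_exists_fun ℝ).1 hspan
  have hc' : ∀ w, c 0 * l w + c 1 * z.2 w.1 = (L v).2 w.1 - w.2 (L v).1 := fun w => by
    rw [← hψ, ← hc, Fin.sum_univ_two]
    rfl
  have hc0 : c 0 = 0 := by
    have := hc' (0, z.2)
    simpa [hle, hv] using this
  have hc1 : c 1 = 0 := by
    have h3 := hc' X
    have h4 := hL0 v
    rw [hl, hg.fderiv_ham hz] at h4
    rw [hlX, hθX, h4, hc0] at h3
    simpa using h3
  have h5 : ∀ w : E × (E →L[ℝ] ℝ), (L v).2 w.1 - w.2 (L v).1 = 0 := fun w => by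
    rw [← hc', hc0, hc1]; simp
  have h6 : L v = 0 := by
    refine Prod.ext ?_ (ContinuousLinearMap.ext fun e => by simpa using h5 (e, 0))
    by_contra h
    obtain ⟨P, hP⟩ := SeparatingDual.exists_ne_zero (R := ℝ) h
    exact hP (by simpa using h5 (0, P))
  exact hL (h6.trans (map_zero L).symm)

section
variable {k : ℕ} {X : Type*} [TopologicalSpace X] [ChartedSpace (EuclideanSpace ℝ (Fin k)) X]
  [IsManifold (𝓡 k) ∞ X] {E : Type*} [NormedAddCommGroup E] [NormedSpace ℝ E]

theorem mfderiv_eq_fderiv_comp_coordD {F : Type*} [NormedAddCommGroup F] [NormedSpace ℝ F]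
    {G : X → F} {x₀ x : X} (hx : x ∈ (extChartAt (𝓡 k) x₀).source)
    (hG : ContMDiffAt (𝓡 k) 𝓘(ℝ, F) ∞ G x) :
    ContDiffAt ℝ ∞ (G ∘ (extChartAt (𝓡 k) x₀).symm) (extChartAt (𝓡 k) x₀ x) ∧
    ∀ v : TangentSpace (𝓡 k) x, (mfderiv (𝓡 k) 𝓘(ℝ, F) G x v : F) =
      fderiv ℝ (G ∘ (extChartAt (𝓡 k) x₀).symm) (extChartAt (𝓡 k) x₀ x) (coordD x₀ x v) := by
  have hy : extChartAt (𝓡 k) x₀ x ∈ (extChartAt (𝓡 k) x₀).target :=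
    (extChartAt (𝓡 k) x₀).map_source hx
  have h1 : ContMDiffAt 𝓘(ℝ, EuclideanSpace ℝ (Fin k)) 𝓘(ℝ, F) ∞
      (G ∘ (extChartAt (𝓡 k) x₀).symm) (extChartAt (𝓡 k) x₀ x) := by
    refine ContMDiffAt.comp (I' := 𝓡 k) _ ?_ ((contMDiffOn_extChartAt_symm x₀).contMDiffAt
      ((isOpen_extChartAt_target x₀).mem_nhds hy))
    rwa [(extChartAt (𝓡 k) x₀).left_inv hx]
  have h2 : ContDiffAt ℝ ∞ (G ∘ (extChartAt (𝓡 k) x₀).symm) (extChartAt (𝓡 k) x₀ x) :=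
    contMDiffAt_iff_contDiffAt.1 h1
  refine ⟨h2, fun v => ?_⟩
  have h3 : HasMFDerivAt (𝓡 k) 𝓘(ℝ, F)
      (fun x => (G ∘ (extChartAt (𝓡 k) x₀).symm) (extChartAt (𝓡 k) x₀ x)) x _ :=
    HasMFDerivAt.comp (I' := 𝓘(ℝ, EuclideanSpace ℝ (Fin k))) x
      (g := G ∘ (extChartAt (𝓡 k) x₀).symm)
      (h2.differentiableAt (by simp)).hasFDerivAt.hasMFDerivAt
      ((contMDiffAt_extChartAt' (n := ∞) (by rwa [← extChartAt_source (𝓡 k)])).mdifferentiableAt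
        (by simp)).hasMFDerivAt
  have h4 := h3.congr_of_eventuallyEq (f₁ := G) (by
    filter_upwards [(isOpen_extChartAt_source (I := 𝓡 k) x₀).mem_nhds hx] with x' hx'
    simp only [Function.comp_apply, (extChartAt (𝓡 k) x₀).left_inv hx'])
  rw [h4.mfderiv]
  rfl

/-- The pullback of the canonical one-form of a vector space, as a one-form on a manifold. -/
def pullbackForm (G : X → E × (E →L[ℝ] ℝ)) (x : X) : TangentSpace (𝓡 k) x →L[ℝ] ℝ :=
  ((G x).2.comp (ContinuousLinearMap.fst ℝ E (E →L[ℝ] ℝ))).comp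
    (mfderiv (𝓡 k) 𝓘(ℝ, E × (E →L[ℝ] ℝ)) G x)

omit [IsManifold (𝓡 k) ∞ X] in
theorem pullbackForm_apply (G : X → E × (E →L[ℝ] ℝ)) (x : X) (v : TangentSpace (𝓡 k) x) :
    pullbackForm G x v =
      (G x).2 (mfderiv (𝓡 k) 𝓘(ℝ, E × (E →L[ℝ] ℝ)) G x v : E × (E →L[ℝ] ℝ)).1 := rfl

/-- In canonical coordinates the form is an explicit expression in the coordinate map and its
derivative. Smoothness of `G` near `x`, not only at `x`, is needed for this formula at the nearby
points. -/
theorem contMDiffAt_pullbackForm {G : X → E × (E →L[ℝ] ℝ)} {x : X}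
    (hG : ∀ᶠ x' in 𝓝 x, ContMDiffAt (𝓡 k) 𝓘(ℝ, E × (E →L[ℝ] ℝ)) ∞ G x') :
    ContMDiffAt (𝓡 k) (cotangentModel k) ∞
      (fun x => (⟨x, pullbackForm G x⟩ : Cotangent k X)) x := by
  set φ := extChartAt (𝓡 k) x with hφ
  have hx : x ∈ φ.source := mem_extChartAt_source x
  let Γ : EuclideanSpace ℝ (Fin k) → E × (E →L[ℝ] ℝ) := G ∘ φ.symm
  let f : EuclideanSpace ℝ (Fin k) →
      EuclideanSpace ℝ (Fin k) × (EuclideanSpace ℝ (Fin k) →L[ℝ] ℝ) := fun y =>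
    (y, ((Γ y).2.comp (ContinuousLinearMap.fst ℝ E (E →L[ℝ] ℝ))).comp (fderiv ℝ Γ y))
  have hΓ : ContDiffAt ℝ ∞ Γ (φ x) := (mfderiv_eq_fderiv_comp_coordD hx hG.self_of_nhds).1
  have hf : ContDiffAt ℝ ∞ f (φ x) :=
    contDiffAt_id.prodMk ((hΓ.snd.clm_comp contDiffAt_const).clm_comp
      (hΓ.fderiv_right (m := ∞) (by simp)))
  have hfκ : ContMDiffAt (𝓡 k)
      𝓘(ℝ, EuclideanSpace ℝ (Fin k) × (EuclideanSpace ℝ (Fin k) →L[ℝ] ℝ)) ∞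
      (fun x => f (φ x)) x :=
    ContMDiffAt.comp (I' := 𝓘(ℝ, EuclideanSpace ℝ (Fin k))) x (g := f) hf.contMDiffAt
      (contMDiffAt_extChartAt (n := ∞))
  have heq : ∀ᶠ x' in 𝓝 x, cotChart x (⟨x', pullbackForm G x'⟩ : Cotangent k X) = f (φ x') := by
    filter_upwards [(isOpen_extChartAt_source (I := 𝓡 k) x).mem_nhds hx, hG] with x' hx' hG'
    refine Prod.ext (cotChart_fst x _) (ContinuousLinearMap.ext fun v => ?_)
    rw [cotChart_snd_apply (show (⟨x', pullbackForm G x'⟩ : Cotangent k X).1 ∈ _ from hx')]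
    have h1 := (mfderiv_eq_fderiv_comp_coordD hx' hG').2 (coordInv x x' v)
    rw [coordD_coordInv hx'] at h1
    change (G x').2 (mfderiv (𝓡 k) 𝓘(ℝ, E × (E →L[ℝ] ℝ)) G x' (coordInv x x' v) :
      E × (E →L[ℝ] ℝ)).1 = (G (φ.symm (φ x'))).2 (fderiv ℝ Γ (φ x') v).1
    rw [h1, φ.left_inv hx']
  have hft : f (φ x) ∈ (cotChart x : PartialEquiv (Cotangent k X) _).target := by
    rw [cotChart_target]
    exact ⟨φ.map_source hx, mem_univ _⟩
  have h2 : ContMDiffAt (𝓡 k) (cotangentModel k) ∞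
      (fun x' => (cotChart x).symm (f (φ x')) : X → Cotangent k X) x :=
    ContMDiffAt.comp x ((contMDiffOn_cotChart_symm x).contMDiffAt
      ((isOpen_cotChart_target x).mem_nhds hft)) hfκ
  refine h2.congr_of_eventuallyEq ?_
  filter_upwards [heq, (isOpen_extChartAt_source (I := 𝓡 k) x).mem_nhds hx] with x' hx' hxs
  rw [← hx', (cotChart x).left_inv (mem_cotChart_source.2 hxs)]

/-- A distribution that is locally the kernel of a one-form pulled back from a symplectic vector
space is a contact structure if the pulled back symplectic form is nondegenerate on it. -/
theorem isContactStructure_of_pullback {D : Set (TangentBundle (𝓡 k) X)}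
    (h : ∀ x₀ : X, ∃ W : Set X, IsOpen W ∧ x₀ ∈ W ∧ ∃ G : X → E × (E →L[ℝ] ℝ),
      ContMDiffOn (𝓡 k) 𝓘(ℝ, E × (E →L[ℝ] ℝ)) ∞ G W ∧ ∀ x ∈ W,
        (∀ v : TangentSpace (𝓡 k) x, (⟨x, v⟩ : TangentBundle (𝓡 k) X) ∈ D ↔
          (G x).2 (mfderiv (𝓡 k) 𝓘(ℝ, E × (E →L[ℝ] ℝ)) G x v : E × (E →L[ℝ] ℝ)).1 = 0) ∧
        IsContactMap (V := EuclideanSpace ℝ (Fin k)) (G x).2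
          (mfderiv (𝓡 k) 𝓘(ℝ, E × (E →L[ℝ] ℝ)) G x)) :
    IsContactStructure D := by
  intro x₀
  obtain ⟨W, hW, hx₀, G, hG, hD⟩ := h x₀
  refine ⟨W, hW, hx₀, pullbackForm G, fun x hx => ?_, fun x hx => ?_⟩
  · refine (contMDiffAt_pullbackForm ?_).contMDiffWithinAt
    filter_upwards [hW.mem_nhds hx] with x' hx'
    exact hG.contMDiffAt (hW.mem_nhds hx')
  · obtain ⟨h1, ⟨v₀, hv₀⟩, h3⟩ := hD x hx
    refine ⟨h1, fun h0 => hv₀ ?_, fun v hv hvw => h3 v hv fun w hw => ?_⟩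
    · exact congrArg (fun l : TangentSpace (𝓡 k) x →L[ℝ] ℝ => l v₀) h0
    · exact (extd_eq_of_pullback hW hG (fun x _ v => pullbackForm_apply G x v) hx v w).symm.trans
        (hvw w hw)

end

/-! ### Transfer of smooth structures and inverse differentials -/

section
variable {E H E' H' : Type*} [NormedAddCommGroup E] [NormedSpace ℝ E] [TopologicalSpace H]
  {I : ModelWithCorners ℝ E H} [NormedAddCommGroup E'] [NormedSpace ℝ E'] [TopologicalSpace H']
  {I' : ModelWithCorners ℝ E' H'} {X Y : Type*} [TopologicalSpace X] [ChartedSpace H X]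
  [TopologicalSpace Y]

theorem injective_mfderiv_of_leftInverse [ChartedSpace H' Y] {f : X → Y} {g : Y → X} {x : X}
    (hf : MDifferentiableAt I I' f x) (hg : MDifferentiableAt I' I g (f x))
    (h : ∀ᶠ x' in 𝓝 x, g (f x') = x') : Function.Injective (mfderiv I I' f x) := by
  have h1 : HasMFDerivAt I I (fun x => g (f x)) x _ := hg.hasMFDerivAt.comp x hf.hasMFDerivAt
  have h2 : HasMFDerivAt I I (fun x => g (f x)) x (ContinuousLinearMap.id ℝ (TangentSpace I x)) :=
    (hasMFDerivAt_id x).congr_of_eventuallyEq h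
  have h3 := hasMFDerivAt_unique h1 h2
  intro v w hvw
  have hv := congrArg (fun l => l v) h3
  have hw := congrArg (fun l => l w) h3
  exact hv.symm.trans ((congrArg (mfderiv I' I g (f x)) hvw).trans hw)

/-- The charted space structure transferred by a homeomorphism. -/
abbrev chartedSpaceOfHomeomorph (e : X ≃ₜ Y) : ChartedSpace H Y where
  atlas := range fun x => e.symm.toOpenPartialHomeomorph.trans (chartAt H x)
  chartAt y := e.symm.toOpenPartialHomeomorph.trans (chartAt H (e.symm y))
  mem_chart_source y := ⟨mem_univ _, mem_chart_source H (e.symm y)⟩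
  chart_mem_atlas _ := mem_range_self _

/-- The homeomorphism cancels in every transition map, leaving a transition map of `X`. -/
theorem isManifold_of_homeomorph [IsManifold I ∞ X] (e : X ≃ₜ Y) :
    letI := chartedSpaceOfHomeomorph (H := H) e
    IsManifold I ∞ Y := by
  let _ := chartedSpaceOfHomeomorph (H := H) e
  have : HasGroupoid Y (contDiffGroupoid ∞ I) := by
    refine ⟨?_⟩
    rintro _ _ ⟨x, rfl⟩ ⟨x', rfl⟩
    refine (contDiffGroupoid ∞ I).mem_of_eqOnSource
      ((contDiffGroupoid ∞ I).compatible (chart_mem_atlas H x) (chart_mem_atlas H x')) ?_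
    refine ⟨?_, fun y _ => ?_⟩
    · ext y
      simp
    · simp
  exact IsManifold.mk' I ∞ Y

theorem contMDiff_homeomorph [IsManifold I ∞ X] (e : X ≃ₜ Y) :
    letI := chartedSpaceOfHomeomorph (H := H) e
    ContMDiff I I ∞ e ∧ ContMDiff I I ∞ e.symm := by
  let _ := chartedSpaceOfHomeomorph (H := H) e
  have hY : IsManifold I ∞ Y := isManifold_of_homeomorph e
  constructor
  · intro x
    have h1 : ContMDiffAt I I ∞ ((chartAt H (e x)).symm ∘ chartAt H (e.symm (e x))) x := by
      refine ContMDiffAt.comp x (contMDiffOn_chart_symm.contMDiffAt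
        ((chartAt H (e x)).open_target.mem_nhds ?_)) (contMDiffOn_chart.contMDiffAt
        ((chartAt H (e.symm (e x))).open_source.mem_nhds ?_))
      · refine ⟨?_, mem_univ _⟩
        rw [e.symm_apply_apply]
        exact mem_chart_target H x
      · rw [e.symm_apply_apply]
        exact mem_chart_source H x
    refine h1.congr_of_eventuallyEq ?_
    have hx : (chartAt H (e.symm (e x))).source ∈ 𝓝 x := by
      rw [e.symm_apply_apply]
      exact chart_source_mem_nhds H x
    filter_upwards [hx] with x' hx'
    exact congrArg e ((chartAt H (e.symm (e x))).left_inv hx').symm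
  · intro y
    have h1 : ContMDiffAt I I ∞ ((chartAt H (e.symm y)).symm ∘ chartAt H y) y :=
      ContMDiffAt.comp y (contMDiffOn_chart_symm.contMDiffAt
        ((chartAt H (e.symm y)).open_target.mem_nhds (mem_chart_target H (e.symm y))))
        (contMDiffOn_chart.contMDiffAt (chart_source_mem_nhds H y))
    refine h1.congr_of_eventuallyEq ?_
    filter_upwards [chart_source_mem_nhds H y] with y' hy'
    exact ((chartAt H (e.symm y)).left_inv hy'.2).symm

end

/-! ### The contact manifold of null geodesics -/

theorem tangentMap_symm_tangentMap {E H E' H' : Type*} [NormedAddCommGroup E] [NormedSpace ℝ E]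
    [TopologicalSpace H] {I : ModelWithCorners ℝ E H} [NormedAddCommGroup E'] [NormedSpace ℝ E']
    [TopologicalSpace H'] {I' : ModelWithCorners ℝ E' H'} {X Y : Type*} [TopologicalSpace X]
    [ChartedSpace H X] [TopologicalSpace Y] [ChartedSpace H' Y] (Φ : X ≃ₘ^∞⟮I, I'⟯ Y)
    (ξ : TangentBundle I X) : tangentMap I' I Φ.symm (tangentMap I I' Φ ξ) = ξ := by
  rw [← tangentMap_comp_at ξ ((Φ.symm.contMDiff _).mdifferentiableAt (by simp))
    ((Φ.contMDiff _).mdifferentiableAt (by simp)), show Φ.symm ∘ Φ = id from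
    funext Φ.symm_apply_apply, tangentMap_id]
  rfl

section
variable {M : Type*} [TopologicalSpace M] [ChartedSpace (EuclideanSpace ℝ (Fin 4)) M]
  [IsManifold (𝓡 4) ∞ M] {𝓜 : Spacetime M}
  {S : Type*} [TopologicalSpace S] [ChartedSpace (EuclideanSpace ℝ (Fin 3)) S]
  [IsManifold (𝓡 3) ∞ S] {ι : S → M}

namespace Spacetime.IsCauchySurface

set_option linter.unusedSectionVars false

variable [T2Space M] (hι : 𝓜.IsCauchySurface ι)
  [ChartedSpace (EuclideanSpace ℝ (Fin 7)) 𝓜.nullBundle]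
  [ChartedSpace (EuclideanSpace ℝ (Fin 5)) (𝓜.unitCotangent ι)]
  (hN : HasRetractions (cotangentModel 4) 7 𝓜.nullBundle)
  (hU : HasRetractions (cotangentModel 3) 5 (𝓜.unitCotangent ι))

/-- The unit cotangent bundle of the Cauchy surface is homeomorphic to the space of null
geodesics. -/
def geodesicHomeomorph : 𝓜.unitCotangent ι ≃ₜ 𝓜.NullGeodesicSpace where
  toEquiv := hι.geodesicEquiv
  continuous_toFun := continuous_quot_mk.comp (hι.contMDiff_lift hN hU one_pos).continuous
  -- The inverse composed with the quotient map is `trace`, which is continuous; for the quotient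
  -- topology this suffices.
  continuous_invFun := isQuotientMap_quot_mk.continuous_iff.2 <| continuous_iff_continuousAt.2
    fun z => (hι.isContactSubmersionAt hN hU z).contMDiffAt.continuousAt

variable [ChartedSpace (EuclideanSpace ℝ (Fin 5)) 𝓜.NullGeodesicSpace]
  (Φ : (𝓜.unitCotangent ι) ≃ₘ^∞⟮𝓡 5, 𝓡 5⟯ 𝓜.NullGeodesicSpace)
  (hΦ : ∀ u, Φ u = hι.geodesicOf u)

-- Through this factorisation the statements about the projection reduce to statements about the
-- trace.
include hΦ in
theorem proj_eq_comp : 𝓜.proj = Φ ∘ hι.trace :=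
  funext fun z => (hι.geodesicEquiv_trace z).symm.trans (hΦ _).symm

include hN hU hΦ in
theorem tangentMap_proj (ζ : TangentBundle (𝓡 7) 𝓜.nullBundle) :
    tangentMap (𝓡 7) (𝓡 5) 𝓜.proj ζ =
      tangentMap (𝓡 5) (𝓡 5) Φ (tangentMap (𝓡 7) (𝓡 5) hι.trace ζ) := by
  rw [proj_eq_comp hι Φ hΦ]
  exact tangentMap_comp_at ζ ((Φ.contMDiff _).mdifferentiableAt (by simp))
    ((hι.isContactSubmersionAt hN hU _).contMDiffAt.mdifferentiableAt (by simp))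

include hN hU in
theorem contactForm_tangentMap_trace_eq_zero_iff (ζ : TangentBundle (𝓡 7) 𝓜.nullBundle) :
    𝓜.contactForm ι (tangentMap (𝓡 7) (𝓡 5) hι.trace ζ) = 0 ↔ 𝓜.theta ζ = 0 := by
  obtain ⟨z, ζ⟩ := ζ
  obtain ⟨a, ha, h⟩ := (hι.isContactSubmersionAt hN hU z).theta
  have := h ζ
  change 𝓜.contactForm ι ⟨hι.trace z, mfderiv (𝓡 7) (𝓡 5) hι.trace z ζ⟩ = 0 ↔ _
  rw [this, mul_eq_zero, or_iff_right ha]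

include hN hU in
theorem surjective_tangentMap_trace :
    Function.Surjective (tangentMap (𝓡 7) (𝓡 5) hι.trace) := by
  rintro ⟨u, v⟩
  obtain ⟨z, rfl⟩ : ∃ z, hι.trace z = u := ⟨_, hι.trace_lift one_pos u⟩
  obtain ⟨ζ, rfl⟩ := (hι.isContactSubmersionAt hN hU z).surjective v
  exact ⟨⟨z, ζ⟩, rfl⟩

-- The tangent map of the trace is onto and pulls the zero set of the contact form back exactly to
-- the zero set of θ; applying Φ gives both inclusions.
include hι hN hU hΦ in
theorem kerTheta_eq :
    tangentMap (𝓡 5) (𝓡 5) Φ '' {ξ | 𝓜.contactForm ι ξ = 0} = 𝓜.kerTheta := by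
  apply Subset.antisymm
  · rintro _ ⟨ξ, hξ, rfl⟩
    obtain ⟨ζ, rfl⟩ := hι.surjective_tangentMap_trace hN hU ξ
    exact ⟨ζ, (hι.contactForm_tangentMap_trace_eq_zero_iff hN hU ζ).1 hξ,
      hι.tangentMap_proj hN hU Φ hΦ ζ⟩
  · rintro _ ⟨ζ, hζ, rfl⟩
    exact ⟨_, (hι.contactForm_tangentMap_trace_eq_zero_iff hN hU ζ).2 hζ,
      (hι.tangentMap_proj hN hU Φ hΦ ζ).symm⟩

include hι hN hU hΦ in
theorem mem_kerTheta_iff (ξ : TangentBundle (𝓡 5) 𝓜.NullGeodesicSpace) :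
    ξ ∈ 𝓜.kerTheta ↔ 𝓜.contactForm ι (tangentMap (𝓡 5) (𝓡 5) Φ.symm ξ) = 0 := by
  rw [← hι.kerTheta_eq hN hU Φ hΦ]
  constructor
  · rintro ⟨ξ', hξ', rfl⟩
    rw [tangentMap_symm_tangentMap]
    exact hξ'
  · exact fun h => ⟨_, h, tangentMap_symm_tangentMap Φ.symm ξ⟩

-- The content is independence of the representative: vanishing of θ depends only on the image under
-- the tangent map of the trace, and that of Φ is injective.
include hι hN hU hΦ in
theorem tangentMap_proj_mem_kerTheta_iff (ζ : TangentBundle (𝓡 7) 𝓜.nullBundle) :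
    tangentMap (𝓡 7) (𝓡 5) 𝓜.proj ζ ∈ 𝓜.kerTheta ↔ 𝓜.theta ζ = 0 := by
  rw [hι.mem_kerTheta_iff hN hU Φ hΦ, hι.tangentMap_proj hN hU Φ hΦ, tangentMap_symm_tangentMap,
    hι.contactForm_tangentMap_trace_eq_zero_iff hN hU]

include hι hN hU hΦ in
theorem isQuotientManifold [IsManifold (𝓡 5) ∞ 𝓜.NullGeodesicSpace] : 𝓜.IsQuotientManifold where
  isManifold := inferInstance
  contMDiff_proj := by
    rw [hι.proj_eq_comp Φ hΦ]
    exact Φ.contMDiff.comp fun z => (hι.isContactSubmersionAt hN hU z).contMDiffAt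
  submersion z := by
    have h := hι.isContactSubmersionAt hN hU z
    rw [hι.proj_eq_comp Φ hΦ, mfderiv_comp z ((Φ.contMDiff _).mdifferentiableAt (by simp))
      (h.contMDiffAt.mdifferentiableAt (by simp))]
    exact ((Φ.mfderivToContinuousLinearEquiv (by simp) _).surjective).comp h.surjective

include hι hN hU hΦ in
theorem isContactStructure_kerTheta [IsManifold (𝓡 5) ∞ 𝓜.NullGeodesicSpace] :
    IsContactStructure 𝓜.kerTheta := by
  refine isContactStructure_of_pullback (E := EuclideanSpace ℝ (Fin 3)) fun y₀ => ?_
  set x₀ := (Φ.symm y₀).1.1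
  let W : Set 𝓜.NullGeodesicSpace := {y | (Φ.symm y).1.1 ∈ (extChartAt (𝓡 3) x₀).source ∧
    ι (Φ.symm y).1.1 ∈ (extChartAt (𝓡 4) (ι x₀)).source}
  have hW : IsOpen W := (hι.isOpen_chartDomain x₀).preimage
    (continuous_subtype_val.comp Φ.symm.continuous)
  -- The local one-form on N is the pullback of p dx under the canonical coordinates of the
  -- corresponding unit covector.
  let κ : 𝓜.unitCotangent ι → EuclideanSpace ℝ (Fin 3) × (EuclideanSpace ℝ (Fin 3) →L[ℝ] ℝ) :=
    fun u => cotChart x₀ u.1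
  have hκ : ∀ y ∈ W, ContMDiffAt (𝓡 5)
      𝓘(ℝ, EuclideanSpace ℝ (Fin 3) × (EuclideanSpace ℝ (Fin 3) →L[ℝ] ℝ)) ∞ κ (Φ.symm y) :=
    fun y hy => (contMDiffAt_cotChart hy.1).comp (Φ.symm y) (hU.contMDiff_incl _)
  have hG : ∀ y ∈ W, ContMDiffAt (𝓡 5)
      𝓘(ℝ, EuclideanSpace ℝ (Fin 3) × (EuclideanSpace ℝ (Fin 3) →L[ℝ] ℝ)) ∞ (κ ∘ Φ.symm) y :=
    fun y hy => (hκ y hy).comp y (Φ.symm.contMDiff y)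
  refine ⟨W, hW, ⟨mem_extChartAt_source _, mem_extChartAt_source _⟩, κ ∘ Φ.symm,
    fun y hy => (hG y hy).contMDiffWithinAt, fun y hy => ⟨fun v => ?_, ?_⟩⟩
  · rw [hι.mem_kerTheta_iff hN hU Φ hΦ]
    have h1 := contactForm_eq hU hy.1 (mfderiv (𝓡 5) (𝓡 5) Φ.symm y v)
    change 𝓜.contactForm ι ⟨Φ.symm y, mfderiv (𝓡 5) (𝓡 5) Φ.symm y v⟩ = 0 ↔ _
    rw [h1, mfderiv_comp y ((hκ y hy).mdifferentiableAt (by simp))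
      ((Φ.symm.contMDiff y).mdifferentiableAt (by simp))]
    rfl
  · have hm := hι.isMetricOn_coordInduced x₀
    have hz : ((κ ∘ Φ.symm) y).1 ∈ coordDomain ι x₀ := by
      have := chart_mem_coordDomain (ι := ι) hy.1 hy.2
      rwa [← cotChart_fst] at this
    have hham : ∀ y ∈ W, 2 * ham (𝓜.coordInduced ι x₀) ((κ ∘ Φ.symm) y) = 1 := fun y hy =>
      (hι.two_mul_ham_cotChart_induced hy.1 hy.2).trans (Φ.symm y).2
    have hd := ((hG y hy).mdifferentiableAt (by simp)).hasMFDerivAt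
    refine hm.isContactMap (V := EuclideanSpace ℝ (Fin 5)) hz (hham y hy) ?_ (fun v => ?_) ?_
    -- Injectivity of the differential: the inverse chart, followed by the retraction onto T*_1 S
    -- and Φ, is a smooth left inverse.
    · obtain ⟨O, r, hO, hyO, hr, hrb⟩ := hU.exists_retraction (Φ.symm y)
      have hκy : (cotChart x₀).symm (κ (Φ.symm y)) = (Φ.symm y).1 :=
        (cotChart x₀).left_inv (mem_cotChart_source.2 hy.1)
      have ht : κ (Φ.symm y) ∈ (cotChart x₀ : PartialEquiv (Cotangent 3 S) _).target :=
        (cotChart x₀).map_source (mem_cotChart_source.2 hy.1)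
      have h1 : ContMDiffAt 𝓘(ℝ, EuclideanSpace ℝ (Fin 3) × (EuclideanSpace ℝ (Fin 3) →L[ℝ] ℝ))
          (𝓡 5) ∞ (fun w => Φ (r ((cotChart x₀).symm w))) ((κ ∘ Φ.symm) y) := by
        refine (Φ.contMDiff _).comp _ (ContMDiffAt.comp (I' := cotangentModel 3) _ (g := r) ?_
          ((contMDiffOn_cotChart_symm x₀).contMDiffAt ((isOpen_cotChart_target x₀).mem_nhds ht)))
        refine hr.contMDiffAt (hO.mem_nhds ?_)
        change (cotChart x₀).symm (κ (Φ.symm y)) ∈ O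
        rw [hκy]; exact hyO
      refine injective_mfderiv_of_leftInverse hd.mdifferentiableAt
        (h1.mdifferentiableAt (by simp)) ?_
      filter_upwards [hW.mem_nhds hy, (hO.preimage (continuous_subtype_val.comp
        Φ.symm.continuous)).mem_nhds hyO] with y' hy' hyO'
      have h2 : (cotChart x₀).symm (κ (Φ.symm y')) = (Φ.symm y').1 :=
        (cotChart x₀).left_inv (mem_cotChart_source.2 hy'.1)
      change Φ (r ((cotChart x₀).symm (κ (Φ.symm y')))) = y'
      rw [h2, hrb _ hyO', Φ.apply_symm_apply]
    -- The map takes values in the level set 2H = 1, so dH kills the image of its differential.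
    · have h1 : HasMFDerivAt (𝓡 5) 𝓘(ℝ, ℝ)
          (fun y => ham (𝓜.coordInduced ι x₀) ((κ ∘ Φ.symm) y)) y _ :=
        HasMFDerivAt.comp y (g := ham (𝓜.coordInduced ι x₀)) (hm.hasFDerivAt_ham hz).hasMFDerivAt
          hd
      have h2 : HasMFDerivAt (𝓡 5) 𝓘(ℝ, ℝ)
          (fun y => ham (𝓜.coordInduced ι x₀) ((κ ∘ Φ.symm) y)) y
          (0 : TangentSpace (𝓡 5) y →L[ℝ] ℝ) := by
        refine (hasMFDerivAt_const (1 / 2 : ℝ) y).congr_of_eventuallyEq ?_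
        filter_upwards [hW.mem_nhds hy] with y' hy'
        linarith [hham y' hy']
      exact congrArg (fun l => l v) (hasMFDerivAt_unique h1 h2)
    · simp only [finrank_euclideanSpace_fin]

end Spacetime.IsCauchySurface
end

end NullGeodesics
end

/-! ### Assembly of the theorem -/

open NullGeodesics
theorem lemma3
    {M : Type*} [TopologicalSpace M] [T2Space M] [SecondCountableTopology M]
    [ChartedSpace (EuclideanSpace ℝ (Fin 4)) M] [IsManifold (𝓡 4) ∞ M]
    (𝓜 : NullGeodesics.Spacetime M)
    {S : Type*} [TopologicalSpace S]
    [ChartedSpace (EuclideanSpace ℝ (Fin 3)) S] [IsManifold (𝓡 3) ∞ S]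
    (ι : S → M) (hι : 𝓜.IsCauchySurface ι) :
    ∃ (_ : ChartedSpace (EuclideanSpace ℝ (Fin 7)) 𝓜.nullBundle)
      (_ : ChartedSpace (EuclideanSpace ℝ (Fin 5)) (𝓜.unitCotangent ι))
      (_ : ChartedSpace (EuclideanSpace ℝ (Fin 5)) 𝓜.NullGeodesicSpace)
      (_ : IsManifold (𝓡 5) ∞ 𝓜.NullGeodesicSpace),
      -- the standard smooth structures on `N'M`, `T*_1 S` and `N`
      IsEmbeddedSubmanifold (cotangentModel 4) 7 𝓜.nullBundle ∧
      IsEmbeddedSubmanifold (cotangentModel 3) 5 (𝓜.unitCotangent ι) ∧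
      𝓜.IsQuotientManifold ∧
      -- the planes `ker θ` on `N'M` project to a well-defined field of planes on `N`
      (∀ ζ : TangentBundle (𝓡 7) 𝓜.nullBundle,
        tangentMap (𝓡 7) (𝓡 5) 𝓜.proj ζ ∈ 𝓜.kerTheta ↔ 𝓜.theta ζ = 0) ∧
      -- the identification of `T*_1 S` with `N`
      (∃ Φ : (𝓜.unitCotangent ι) ≃ₘ^∞⟮𝓡 5, 𝓡 5⟯ 𝓜.NullGeodesicSpace,
        (∀ u : 𝓜.unitCotangent ι, ∃ q : TangentSpace (𝓡 4) (ι u.1.1) →L[ℝ] ℝ,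
          𝓜.IsLift ι u.1.1 u.1.2 q ∧
          ∃ hq : (⟨ι u.1.1, q⟩ : Cotangent 4 M) ∈ 𝓜.nullBundle, Φ u = 𝓜.proj ⟨_, hq⟩) ∧
        -- it carries the contact planes of `T*_1 S` onto the planes `ker [θ]`
        (tangentMap (𝓡 5) (𝓡 5) Φ) '' {ξ | 𝓜.contactForm ι ξ = 0} = 𝓜.kerTheta) ∧
      -- and these form a contact structure on `N`
      IsContactStructure 𝓜.kerTheta := by
  let sN (a : 𝓜.nullBundle) := (Spacetime.nonempty_sliceChart_nullBundle a).some
  let sU (a : 𝓜.unitCotangent ι) := (hι.nonempty_sliceChart_unitCotangent a).some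
  let cN := chartedSpaceOfSlices sN
  let cU := chartedSpaceOfSlices sU
  have hN : HasRetractions (cotangentModel 4) 7 𝓜.nullBundle := hasRetractions_of_slices sN
  have hU : HasRetractions (cotangentModel 3) 5 (𝓜.unitCotangent ι) := hasRetractions_of_slices sU
  have hUm := hU.isManifold
  let e := hι.geodesicHomeomorph hN hU
  -- The smooth structure of N is transported from T*_1 S, so Φ is a diffeomorphism by construction;
  -- that the projection is a submersion for it then follows from the trace.
  let cG := chartedSpaceOfHomeomorph (H := EuclideanSpace ℝ (Fin 5)) e
  have hG : IsManifold (𝓡 5) ∞ 𝓜.NullGeodesicSpace := isManifold_of_homeomorph e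
  have he := contMDiff_homeomorph (I := 𝓡 5) e
  let Φ : (𝓜.unitCotangent ι) ≃ₘ^∞⟮𝓡 5, 𝓡 5⟯ 𝓜.NullGeodesicSpace :=
    { toEquiv := e.toEquiv, contMDiff_toFun := he.1, contMDiff_invFun := he.2 }
  have hΦ : ∀ u, Φ u = hι.geodesicOf u := fun _ => rfl
  refine ⟨cN, cU, cG, hG, hN.isEmbeddedSubmanifold, hU.isEmbeddedSubmanifold,
    hι.isQuotientManifold hN hU Φ hΦ, hι.tangentMap_proj_mem_kerTheta_iff hN hU Φ hΦ,
    ⟨Φ, fun u => ?_, hι.kerTheta_eq hN hU Φ hΦ⟩, hι.isContactStructure_kerTheta hN hU Φ hΦ⟩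
  have h1 : (⟨ι u.1.1, 𝓜.nullLift ι u.1⟩ : Cotangent 4 M) = 𝓜.scaledLift ι 1 u.1 :=
    congrArg (TotalSpace.mk (ι u.1.1)) (one_smul ℝ (𝓜.nullLift ι u.1)).symm
  refine ⟨𝓜.nullLift ι u.1, hι.isLift_nullLift u.1, by
    rw [h1]; exact hι.scaledLift_mem one_pos u.2, ?_⟩
  exact congrArg 𝓜.proj (Subtype.ext h1.symm)
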